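/- Let $n\ge 0$ and let $w_0$ be the longest element of $S_n$, which is generated by $s_1,\dots,s_{n-1}$ with $s_i=(i\ i{+}1)$; put $N=\binom n2$ and $\rho=(n-1,n-2,\dots,1)$. Call $v\in S_n$ decreasing if it has a reduced word with strictly decreasing letters; $v$ is then determined by the set $\operatorname{cont}(v)$ of its letters. For $\ell\ge0$ let $B(w_0)$ be the set of factorizations $w_0=w^\ell\cdots w^1$ into decreasing elements (possibly trivial) with $\ell(w_0)=\ell(w^1)+\cdots+\ell(w^\ell)$, and let $\operatorname{wt}(w^\ell\cdots w^1)=(\ell(w^1),\dots,\ell(w^\ell))$. For $1\le i<\ell$ define operators $\tilde e_i,\tilde f_i\colon B(w_0)\to B(w_0)\cup\{\mathbf 0\}$ as follows. Going through the letters $b$ of $\operatorname{cont}(w^{i+1})$ in decreasing order, pair $b$ with the smallest not yet paired $a>b$ in $\operatorname{cont}(w^i)$, if there is one; let $L_i\subseteq\operatorname{cont}(w^{i+1})$ and $R_i\subseteq\operatorname{cont}(w^i)$ be the sets of unpaired letters. If $L_i=\emptyset$, then $\tilde e_i$ gives $\mathbf 0$; otherwise it removes $b=\min L_i$ from $\operatorname{cont}(w^{i+1})$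 and adds $b-t$ to $\operatorname{cont}(w^i)$, where $t=\min\{j\ge0: b-j-1\notin\operatorname{cont}(w^{i+1})\}$. If $R_i=\emptyset$, then $\tilde f_i$ gives $\mathbf 0$; otherwise it removes $a=\max R_i$ from $\operatorname{cont}(w^i)$ and adds $a+s$ to $\operatorname{cont}(w^{i+1})$, where $s=\min\{j\ge0: a+j+1\notin\operatorname{cont}(w^i)\}$. An element $b$ is of highest weight if $\tilde e_i b=\mathbf 0$ for all $1\le i<\ell$. Let $B(\rho)$ be the type $A_{\ell-1}$ crystal of semistandard tableaux of shape $\rho$ with entries in $\{1,\dots,\ell\}$: the $k$-th coordinate of the weight is the number of entries $k$, and $\tilde e_i$ (resp. $\tilde f_i$) changes the leftmost unpaired $i+1$ into $i$ (resp. the rightmost unpaired $i$ into $i+1$) in the row reading word, where each $i+1$ is an opening and each $i$ a closing bracket, and gives $\mathbf 0$ if there is none. Let $\varphi^Q_{\mathrm{EG}}$ send $w^\ell\cdots w^1$ to the recording tableau obtained by inserting the factors $w^1,w^2,\dots,w^\ell$ successively, each written in increasing order, and filling the cells created by $w^i$ with $i$. Here a letter $a$ is inserted into a row by finding the smallest letter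 $b>a$ of the row. If there is none, $a$ is appended. If $b=a+1$ and $a$ is in the row, the row is unchanged and $a+1$ is inserted into the next row. Otherwise $a$ replaces $b$, and $b$ is inserted into the next row. Then the following hold. 1. For every $\ell\ge n-1$, $B(w_0)$ and $B(\rho)$ are (abstract) crystals of type $A_{\ell-1}$; the crystal $B(w_0)$ has exactly one highest weight element, namely $(s_1)(s_2s_1)\cdots(s_{n-1}\cdots s_2s_1)$, that is $w^k=s_{n-k}\cdots s_1$ for $1\le k<n$ and $w^k=1$ for $k\ge n$; and $\varphi^Q_{\mathrm{EG}}$ is a crystal isomorphism $B(w_0)\to B(\rho)$: a bijection that preserves weights and commutes with all $\tilde e_i$ and $\tilde f_i$. 2. For every $\ell\ge N$, the map $i_1\cdots i_N\mapsto(s_{i_1})\cdots(s_{i_N})$ (with $w^k=s_{i_{N+1-k}}$ for $k\le N$ and trivial $w^k$ for $k>N$) is a bijection from the reduced words of $w_0$ to the elements of weight $(1^N,0^{\ell-N})$ of $B(w_0)$; the elements of weight $(1^N,0^{\ell-N})$ of $B(\rho)$ are exactly the standard tableaux of shape $\rho$; and $\varphi^Q_{\mathrm{EG}}$ restricts to a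 bijection from the former to the latter, hence gives a bijection from the reduced words of $w_0$ to the standard tableaux of shape $\rho$. 3. Consequently the number of reduced words of $w_0$ is finite and equals the number of standard tableaux of shape $\rho$. -/

import Mathlib

namespace StanleyCrystal

/-! ### Reduced words in the symmetric group -/

/-- The simple transposition `s_i` of `S_n`, `1 ≤ i < n`, which interchanges `i` and `i + 1`.
`S_n` is `Equiv.Perm (Fin n)`, where `j : Fin n` stands for the number `j + 1`. The value at an `i`
outside `{1, …, n - 1}` is never used. -/
def simpleTransposition (n i : ℕ) : Equiv.Perm (Fin n) :=
  if h : 1 ≤ i ∧ i < n then Equiv.swap ⟨i - 1, by omega⟩ ⟨i, h.2⟩ else 1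

/-- The list `i₁ i₂ ⋯ i_k` is a word in `{1, …, n - 1}` with `w = s_{i₁} s_{i₂} ⋯ s_{i_k}`. -/
def IsWordFor (n : ℕ) (w : Equiv.Perm (Fin n)) (a : List ℕ) : Prop :=
  (∀ i ∈ a, 1 ≤ i ∧ i < n) ∧ (a.map (simpleTransposition n)).prod = w

/-- The length `ℓ(w)`: the least length of a word for `w`. -/
noncomputable def permLength (n : ℕ) (w : Equiv.Perm (Fin n)) : ℕ :=
  sInf {k | ∃ a : List ℕ, IsWordFor n w a ∧ a.length = k}

/-- `w` is a longest element of `S_n`. -/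
def IsLongest (n : ℕ) (w : Equiv.Perm (Fin n)) : Prop :=
  ∀ v : Equiv.Perm (Fin n), permLength n v ≤ permLength n w

/-- `Red(w)`, the set of reduced words of `w`. -/
def reducedWords (n : ℕ) (w : Equiv.Perm (Fin n)) : Set (List ℕ) :=
  {a | IsWordFor n w a ∧ a.length = permLength n w}

/-! ### Abstract crystals of type `A_{ℓ-1}` -/

/-- Weight function and crystal operators on an ambient type `X`; the index `i` of `e i`, `f i` is
meant to run through `{1, …, ℓ - 1}`, `none` is the symbol `0`, and a weight is a vector whose
coordinates are numbered `1, 2, …`. -/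
structure CrystalData (X : Type) where
  wt : X → ℕ → ℤ
  e : ℕ → X → Option X
  f : ℕ → X → Option X

/-- The simple root `α_i` of type `A`. -/
def simpleRoot (i : ℕ) : ℕ → ℤ := Pi.single i 1 - Pi.single (i + 1) 1

/-- The `d`-fold application of a crystal operator to `b`. -/
def iterOp {X : Type} (g : X → Option X) (d : ℕ) (b : X) : Option X :=
  (fun o => o.bind g)^[d] (some b)

/-- The set `B` with the given data is an abstract crystal of type `A_{ℓ-1}`. -/
structure IsCrystal {X : Type} (ℓ : ℕ) (D : CrystalData X) (B : Set X) : Prop where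
  nonempty : B.Nonempty
  e_mem : ∀ i, 1 ≤ i → i < ℓ → ∀ b ∈ B, ∀ b', D.e i b = some b' → b' ∈ B
  f_mem : ∀ i, 1 ≤ i → i < ℓ → ∀ b ∈ B, ∀ b', D.f i b = some b' → b' ∈ B
  f_iff_e : ∀ i, 1 ≤ i → i < ℓ → ∀ b ∈ B, ∀ b' ∈ B, D.f i b = some b' ↔ D.e i b' = some b
  wt_e : ∀ i, 1 ≤ i → i < ℓ → ∀ b ∈ B, ∀ b', D.e i b = some b' → D.wt b' = D.wt b + simpleRoot i
  wt_f : ∀ i, 1 ≤ i → i < ℓ → ∀ b ∈ B, ∀ b', D.f i b = some b' → D.wt b' = D.wt b - simpleRoot i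
  strings : ∀ i, 1 ≤ i → i < ℓ → ∀ b ∈ B, ∃ ε φ : ℕ,
    IsGreatest {d | iterOp (D.e i) d b ≠ none} ε ∧
    IsGreatest {d | iterOp (D.f i) d b ≠ none} φ ∧
    (φ : ℤ) = ε + (D.wt b i - D.wt b (i + 1))

/-- `b` is a highest weight element: `e_i b = 0` for all `1 ≤ i < ℓ`. -/
def IsHighestWeight {X : Type} (ℓ : ℕ) (D : CrystalData X) (b : X) : Prop :=
  ∀ i, 1 ≤ i → i < ℓ → D.e i b = none

/-- `Φ` restricts to an isomorphism from the crystal `B` to the crystal `B'`. -/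
structure IsCrystalIso {X X' : Type} (ℓ : ℕ) (D : CrystalData X) (B : Set X)
    (D' : CrystalData X') (B' : Set X') (Φ : X → X') : Prop where
  bijOn : Set.BijOn Φ B B'
  map_wt : ∀ b ∈ B, D'.wt (Φ b) = D.wt b
  map_e : ∀ i, 1 ≤ i → i < ℓ → ∀ b ∈ B, D'.e i (Φ b) = (D.e i b).map Φ
  map_f : ∀ i, 1 ≤ i → i < ℓ → ∀ b ∈ B, D'.f i (Φ b) = (D.f i b).map Φ

/-! ### The crystal `B(w)` on decreasing factorizations -/

/-- A sequence of factors `w^1, w^2, …`. A decreasing element of `S_n` is recorded by its content,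
so `v k` is the content of the factor `w^k`. -/
abbrev Factors : Type := ℕ → Finset ℕ

/-- The word of `w^ℓ ⋯ w^2 w^1`, in which every factor is written in decreasing order. -/
def factorizationWord (ℓ : ℕ) (v : Factors) : List ℕ :=
  (List.range ℓ).reverse.flatMap fun k => (v (k + 1)).sort (· ≥ ·)

/-- The decreasing factorizations `w^ℓ ⋯ w^1` of `w` with `ℓ` (possibly trivial) factors. The
lengths of the factors add up to `ℓ(w)` if and only if the concatenated word is reduced. -/
def decreasingFactorizations (n : ℕ) (w : Equiv.Perm (Fin n)) (ℓ : ℕ) : Set Factors :=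
  {v | (∀ k, ¬(1 ≤ k ∧ k ≤ ℓ) → v k = ∅) ∧ factorizationWord ℓ v ∈ reducedWords n w}

/-- The bracketing: the letters `b` of the first argument are treated in turn; `b` is paired with
the smallest `a > b` among the letters of the second argument that are still unpaired, if there is
one. The result consists of the unpaired letters on both sides. -/
def bracket : List ℕ → Finset ℕ → Finset ℕ × Finset ℕ
  | [], R => (∅, R)
  | b :: L, R =>
    if h : (R.filter fun a => b < a).Nonempty then
      bracket L (R.erase ((R.filter fun a => b < a).min' h))
    else
      (insert b (bracket L R).1, (bracket L R).2)

/-- `L_i`: the unpaired letters of `w^{i+1}` in the pairing of `w^{i+1} w^i`. -/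
def unpairedL (v : Factors) (i : ℕ) : Finset ℕ := (bracket ((v (i + 1)).sort (· ≥ ·)) (v i)).1

/-- `R_i`: the unpaired letters of `w^i` in the pairing of `w^{i+1} w^i`. -/
def unpairedR (v : Factors) (i : ℕ) : Finset ℕ := (bracket ((v (i + 1)).sort (· ≥ ·)) (v i)).2

/-- The raising operator: `b = min L_i` is removed from `w^{i+1}` and `b - t` is added to `w^i`,
where `t = min {j ≥ 0 | b - j - 1 ∉ cont(w^{i+1})}`. -/
noncomputable def factE (i : ℕ) (v : Factors) : Option Factors :=
  if h : (unpairedL v i).Nonempty then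
    let b := (unpairedL v i).min' h
    let t := sInf {j : ℕ | b - j - 1 ∉ v (i + 1)}
    some (Function.update (Function.update v (i + 1) ((v (i + 1)).erase b)) i
      (insert (b - t) (v i)))
  else none

/-- The lowering operator: `a = max R_i` is removed from `w^i` and `a + s` is added to `w^{i+1}`,
where `s = min {j ≥ 0 | a + j + 1 ∉ cont(w^i)}`. -/
noncomputable def factF (i : ℕ) (v : Factors) : Option Factors :=
  if h : (unpairedR v i).Nonempty then
    let a := (unpairedR v i).max' h
    let s := sInf {j : ℕ | a + j + 1 ∉ v i}
    some (Function.update (Function.update v (i + 1) (insert (a + s) (v (i + 1)))) i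
      ((v i).erase a))
  else none

/-- Weight and crystal operators on factorizations; `wt` is the sequence of the lengths of
`w^1, w^2, …`. -/
noncomputable def factCrystal : CrystalData Factors where
  wt v k := ((v k).card : ℤ)
  e := factE
  f := factF

/-- The factorization `(s_1)(s_2 s_1) ⋯ (s_{n-1} ⋯ s_2 s_1)`, that is `w^k = s_{n-k} ⋯ s_2 s_1` for
`1 ≤ k < n`; the remaining factors are trivial. -/
def staircaseFactorization (n : ℕ) : Factors :=
  fun k => if k = 0 then ∅ else Finset.Icc 1 (n - k)

/-- A word `i₁ i₂ ⋯ i_N` as the factorization `(s_{i₁})(s_{i₂}) ⋯ (s_{i_N})` with one letter in each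
factor, that is `w^k = s_{i_{N+1-k}}` for `1 ≤ k ≤ N`. -/
def wordFactorization (a : List ℕ) : Factors :=
  fun k => if 1 ≤ k ∧ k ≤ a.length then {a.getD (a.length - k) 0} else ∅

/-! ### The crystal `B(μ)` of semistandard tableaux -/

/-- Fillings: `T r c` is the entry in row `r` and column `c`, both numbered from `0`; row `0` is the
longest row (the bottom row in French notation), and the entry is `0` outside the shape. -/
abbrev Filling : Type := ℕ → ℕ → ℕ

/-- The semistandard tableaux of shape `μ` with entries in `{1, …, ℓ}`. -/
def tableaux (μ : YoungDiagram) (ℓ : ℕ) : Set Filling :=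
  {T | (∃ S : SemistandardYoungTableau μ, ∀ r c, S r c = T r c) ∧
    ∀ r c, (r, c) ∈ μ → 1 ≤ T r c ∧ T r c ≤ ℓ}

/-- The cells of `μ` in the order of the row reading word: from the shortest row to row `0`, and
from left to right in each row. -/
def readingCells (μ : YoungDiagram) : List (ℕ × ℕ) :=
  (List.range (μ.colLen 0)).reverse.flatMap fun r => (List.range (μ.rowLen r)).map fun c => (r, c)

/-- One step of the bracketing of the reading word, in which each `i + 1` is an opening and each `i`
a closing bracket. The state consists of the cells of the unpaired `i`'s and of the cells of the
`i + 1`'s that are not yet paired, in both lists the last one read first. -/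
def signatureStep (T : Filling) (i : ℕ) (p : List (ℕ × ℕ) × List (ℕ × ℕ)) (x : ℕ × ℕ) :
    List (ℕ × ℕ) × List (ℕ × ℕ) :=
  if T x.1 x.2 = i + 1 then (p.1, x :: p.2)
  else if T x.1 x.2 = i then
    match p.2 with
    | [] => (x :: p.1, [])
    | _ :: S => (p.1, S)
  else p

/-- The unpaired `i`'s and the unpaired `i + 1`'s of the reading word, the last ones first. -/
def signature (μ : YoungDiagram) (i : ℕ) (T : Filling) : List (ℕ × ℕ) × List (ℕ × ℕ) :=
  (readingCells μ).foldl (signatureStep T i) ([], [])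

/-- The filling `T` with the entry in the cell `x` replaced by `m`. -/
def setEntry (T : Filling) (x : ℕ × ℕ) (m : ℕ) : Filling :=
  fun r c => if (r, c) = x then m else T r c

/-- The raising operator changes the leftmost unpaired `i + 1` into `i`. -/
def tabE (μ : YoungDiagram) (i : ℕ) (T : Filling) : Option Filling :=
  (signature μ i T).2.getLast?.map fun x => setEntry T x i

/-- The lowering operator changes the rightmost unpaired `i` into `i + 1`. -/
def tabF (μ : YoungDiagram) (i : ℕ) (T : Filling) : Option Filling :=
  (signature μ i T).1.head?.map fun x => setEntry T x (i + 1)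

/-- Weight and crystal operators on tableaux of shape `μ`; the `k`-th coordinate of `wt` is the
number of entries `k`. -/
def tabCrystal (μ : YoungDiagram) : CrystalData Filling where
  wt T k := ((μ.cells.filter fun x => T x.1 x.2 = k).card : ℤ)
  e := tabE μ
  f := tabF μ

/-- The standard tableaux of shape `μ`: the numbers `1, …, |μ|` occur once each, and rows and
columns are strictly increasing. -/
def standardTableaux (μ : YoungDiagram) : Set Filling :=
  {T | (∀ r c, (r, c) ∉ μ → T r c = 0) ∧
    Set.BijOn (fun x : ℕ × ℕ => T x.1 x.2) (μ.cells : Set (ℕ × ℕ)) (Set.Icc 1 μ.card) ∧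
    (∀ r c c', c < c' → (r, c') ∈ μ → T r c < T r c') ∧
    (∀ r r' c, r < r' → (r', c) ∈ μ → T r c < T r' c)}

/-- The staircase shape `ρ = (n - 1, n - 2, …, 1)`: row `r` has the columns `c` with
`c < n - 1 - r`. -/
def staircase (n : ℕ) : YoungDiagram where
  cells := (Finset.range n ×ˢ Finset.range n).filter fun x => x.1 + x.2 + 1 < n
  isLowerSet := by
    intro x y hyx hx
    have h1 : y.1 ≤ x.1 := hyx.1
    have h2 : y.2 ≤ x.2 := hyx.2
    simp only [Finset.coe_filter, Finset.mem_product, Finset.mem_range, Set.mem_ofPred_eq] at hx ⊢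
    omega

/-! ### Edelman–Greene insertion -/

/-- Insertion of the letter `a` into a row (an increasing list): the new row, and the letter that is
bumped into the next row, if there is one. -/
def egInsertRow (a : ℕ) (row : List ℕ) : List ℕ × Option ℕ :=
  match row.find? fun b => a < b with
  | none => (row ++ [a], none)
  | some b =>
    if b = a + 1 ∧ a ∈ row then (row, some b)
    else (row.map fun x => if x = b then a else x, some b)

/-- Insertion of the letter `a` into a tableau, given by the list of its rows. -/
def egInsert (a : ℕ) : List (List ℕ) → List (List ℕ)
  | [] => [[a]]
  | row :: P =>
    match egInsertRow a row with
    | (row', none) => row' :: P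
    | (row', some b) => row' :: egInsert b P

/-- The insertion tableau after the first `k` factors `w^1, …, w^k`, each of them written in
increasing order, have been inserted in this order. -/
def egP (v : Factors) : ℕ → List (List ℕ)
  | 0 => []
  | k + 1 => ((v (k + 1)).sort (· ≤ ·)).foldl (fun P a => egInsert a P) (egP v k)

/-- The cell in row `r` and column `c` belongs to the shape of `P`. -/
def InShape (P : List (List ℕ)) (r c : ℕ) : Prop := c < (P.getD r []).length

instance (P : List (List ℕ)) (r c : ℕ) : Decidable (InShape P r c) :=
  inferInstanceAs (Decidable (c < (P.getD r []).length))

/-- The Edelman–Greene recording tableau of `w^k ⋯ w^1`: the cells that are added to the shape by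
the insertion of the factor `w^j` are filled with `j`. -/
def egQ (v : Factors) : ℕ → Filling
  | 0 => fun _ _ => 0
  | k + 1 => fun r c =>
    if InShape (egP v (k + 1)) r c ∧ ¬InShape (egP v k) r c then k + 1 else egQ v k r c

/-- The recording map on factorizations with `ℓ` factors. -/
def egRecording (ℓ : ℕ) (v : Factors) : Filling := egQ v ℓ

/-- The weight `(1, …, 1)` with `N` ones, followed by zeros. -/
def onesWeight (N : ℕ) : ℕ → ℤ := fun k => if 1 ≤ k ∧ k ≤ N then 1 else 0

end StanleyCrystal

open StanleyCrystal

/-! Let X and Y be the contents of w^i and w^{i+1}. Scan the letters upwards, closing with a letter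
of X before opening with the equal letter of Y, so that pairing is strict. `carrier X Y c` counts
the open letters; a letter of X is unpaired iff it meets carrier 0, and the final value `eps X Y` is
the number of unpaired letters of Y. Lowering the pair as often as possible gives (`lowX X Y`, `lowY
X Y`), which the same scan computes with one extra flag, `star`. Reducedness enters these pair
computations through `NoBlock`: a common block with free ends would allow a cancellation. A lowering
or raising step then preserves product and total length, and the two are inverse to each other.

The key observation is `rowFold_incWord`: Edelman–Greene insertion of a factor A into a row R is the
maximal lowering of the pair (R, A), with `lowX R A` bumped and `lowY R A` the new row. A row thus
behaves like an extra factor that travels through the factorization, and the letters it leaves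
behind form the factorization inserted into the next row.

Maximal lowerings at adjacent positions of a reduced triple satisfy the braid relation
(`BraidPairs.low_eq`), together with a relation between the numbers of unpaired letters
(`BraidPairs.eps_eq`). Both follow from an invariant of six scans run in parallel. There are three
consequences. Consecutive rows stay bracketed, so the shapes interlace and the recording tableau is
semistandard. A lowering operator either deletes one cell from the row after i factors or passes to
the bumped factors as a lowering operator (`FacSeq.fStep_row`). The unpaired counts in the
successive rows obey the recursion for open letters in the reading word of the tableau
(`FacSeq.rowEps_eq`). The last two show that the recording map commutes with the operators.

For the shape, row r (from 0) has letters strictly between r and n, hence at most n-1-r of them;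
total length N forces the staircase. That N is the maximal length is also seen in the crystal:
raising ends in a highest weight factorization, where maxima of successive nonempty factors strictly
drop, so ℓ(w) ≤ N; the reversal has N inversions. Equality leaves only the staircase factorization.
A highest weight tableau of a given shape is unique as well, so raising to highest weight, with the
sum of the entries as measure, gives bijectivity. The axioms for tableaux are transported from
factorizations, and weight (1^N) gives reduced words on one side and standard tableaux on the other.
-/

namespace StanleyCrystal

/-! ### The scanning automaton of a pair of sets -/

/-- The number of letters of `Y` that are still open when the bracketing of `X` (closing) and `Y`
(opening) has been scanned up to `c`, exclusively. -/
def carrier (X Y : Finset ℕ) : ℕ → ℕ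
  | 0 => 0
  | c + 1 => (carrier X Y c - if c ∈ X then 1 else 0) + if c ∈ Y then 1 else 0

/-- The scan is inside a block that starts at an unpaired letter of `X` and is contained in both
sets. -/
def star (X Y : Finset ℕ) : ℕ → Bool
  | 0 => false
  | c + 1 => decide (c ∈ X) && decide (c ∈ Y) && (carrier X Y c == 0 || star X Y c)

/-- The first factor after the maximal number of lowerings. -/
def lowX (X Y : Finset ℕ) : Finset ℕ := X.filter fun c => carrier X Y c ≠ 0

/-- The second factor after the maximal number of lowerings. -/
def lowY (X Y : Finset ℕ) : Finset ℕ :=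
  Y ∪ X.filter fun c => carrier X Y c = 0 ∨ star X Y c = true

/-- The two sets have no common block that is maximal in `X` at its upper end and in `Y` at its
lower end. -/
def NoBlock (X Y : Finset ℕ) : Prop :=
  ∀ a m, a ≤ m → (∀ c, a ≤ c → c ≤ m → c ∈ X ∧ c ∈ Y) → m + 1 ∈ X ∨ ∃ a', a' + 1 = a ∧ a' ∈ Y

theorem carrier_succ (X Y : Finset ℕ) (c : ℕ) :
    carrier X Y (c + 1) = (carrier X Y c - if c ∈ X then 1 else 0) + if c ∈ Y then 1 else 0 := rfl

theorem star_succ (X Y : Finset ℕ) (c : ℕ) :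
    star X Y (c + 1) = true ↔ c ∈ X ∧ c ∈ Y ∧ (carrier X Y c = 0 ∨ star X Y c = true) := by
  simp [star, and_assoc]

theorem mem_lowX {X Y : Finset ℕ} {c : ℕ} : c ∈ lowX X Y ↔ c ∈ X ∧ carrier X Y c ≠ 0 := by
  simp [lowX]

theorem mem_lowY {X Y : Finset ℕ} {c : ℕ} :
    c ∈ lowY X Y ↔ c ∈ Y ∨ c ∈ X ∧ (carrier X Y c = 0 ∨ star X Y c = true) := by
  simp [lowY]

/-- A flagged block begins with nothing open; each of its positions opens one letter and closes only
the one opened just before. -/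
theorem carrier_eq_one_of_star {X Y : Finset ℕ} {c : ℕ} (h : star X Y c = true) :
    carrier X Y c = 1 := by
  induction c with
  | zero => simp [star] at h
  | succ c ih =>
    obtain ⟨h1, h2, h3⟩ := (star_succ X Y c).1 h
    rw [carrier_succ, if_pos h1, if_pos h2]
    rcases h3 with h3 | h3
    · omega
    · have := ih h3; omega

theorem exists_block_of_star {X Y : Finset ℕ} {c : ℕ} (h : star X Y c = true) :
    ∃ a < c, carrier X Y a = 0 ∧ ∀ d, a ≤ d → d < c → d ∈ X ∧ d ∈ Y := by
  induction c with
  | zero => simp [star] at h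
  | succ c ih =>
    obtain ⟨h1, h2, h3⟩ := (star_succ X Y c).1 h
    rcases h3 with h3 | h3
    · refine ⟨c, by omega, h3, fun d hd hd' => ?_⟩
      obtain rfl : d = c := by omega
      exact ⟨h1, h2⟩
    · obtain ⟨a, ha, h0, hb⟩ := ih h3
      refine ⟨a, by omega, h0, fun d hd hd' => ?_⟩
      rcases Nat.lt_succ_iff_lt_or_eq.1 hd' with h | rfl
      · exact hb d hd h
      · exact ⟨h1, h2⟩

theorem notMem_of_carrier_succ_eq_zero {X Y : Finset ℕ} {c : ℕ} (h : carrier X Y (c + 1) = 0) :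
    c ∉ Y := by
  intro hc
  rw [carrier_succ, if_pos hc] at h
  omega

/-- The block behind the flag begins at carrier 0, so its lower neighbour is not in `Y`, and
`NoBlock` makes it continue in `X`. Hence a flagged run always finds a letter of `X` outside `Y` to
hand over to `lowY`. -/
theorem NoBlock.mem_of_star {X Y : Finset ℕ} (hN : NoBlock X Y) {c : ℕ} (h : star X Y c = true) :
    c ∈ X := by
  obtain ⟨a, ha, h0, hb⟩ := exists_block_of_star h
  obtain ⟨m, rfl⟩ : ∃ m, c = m + 1 := ⟨c - 1, by omega⟩
  rcases hN a m (by omega) (fun d hd hd' => hb d hd (by omega)) with h1 | ⟨a', rfl, ha'⟩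
  · exact h1
  · exact absurd ha' (notMem_of_carrier_succ_eq_zero h0)

theorem carrier_congr {X Y X' Y' : Finset ℕ} {c : ℕ}
    (h : ∀ d < c, (d ∈ X ↔ d ∈ X') ∧ (d ∈ Y ↔ d ∈ Y')) : carrier X Y c = carrier X' Y' c := by
  induction c with
  | zero => rfl
  | succ c ih =>
    rw [carrier_succ, carrier_succ, ih fun d hd => h d (by omega)]
    simp only [(h c (by omega)).1, (h c (by omega)).2]

theorem star_congr {X Y X' Y' : Finset ℕ} {c : ℕ}
    (h : ∀ d < c, (d ∈ X ↔ d ∈ X') ∧ (d ∈ Y ↔ d ∈ Y')) : star X Y c = star X' Y' c := by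
  induction c with
  | zero => rfl
  | succ c ih =>
    rw [Bool.eq_iff_iff, star_succ, star_succ, ih fun d hd => h d (by omega),
      carrier_congr (X := X) (Y := Y) fun d hd => h d (by omega),
      (h c (by omega)).1, (h c (by omega)).2]

/-! ### Lowering and raising a pair of sets -/

/-- `(X', Y')` arises from `(X, Y)` by the lowering operator, which removes `a` from `X` and adds
`m` to `Y`. -/
structure FMove (X Y X' Y' : Finset ℕ) (a m : ℕ) : Prop where
  mem : a ∈ X
  zero : carrier X Y a = 0
  last : ∀ d, a < d → d ∈ X → carrier X Y d ≠ 0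
  le : a ≤ m
  run : ∀ c, a ≤ c → c ≤ m → c ∈ X
  boundary : m + 1 ∉ X
  left_eq : X' = X.erase a
  right_eq : Y' = insert m Y

/-- `(X', Y')` arises from `(X, Y)` by the raising operator, which removes `b` from `Y` and adds
`a` to `X`. -/
structure EMove (X Y X' Y' : Finset ℕ) (a b : ℕ) : Prop where
  mem : b ∈ Y
  zero : carrier X Y b - (if b ∈ X then 1 else 0) = 0
  last : ∀ d, b < d → carrier X Y d - (if d ∈ X then 1 else 0) ≠ 0
  le : a ≤ b
  run : ∀ c, a ≤ c → c ≤ b → c ∈ Y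
  boundary : ∀ a', a' + 1 = a → a' ∉ Y
  left_eq : X' = insert a X
  right_eq : Y' = Y.erase b

/-! ### Scans before and after a single lowering. -/

namespace FMove
variable {X Y X' Y' : Finset ℕ} {a m : ℕ}

theorem pred_notMem (h : FMove X Y X' Y' a m) (a' : ℕ) (ha : a' + 1 = a) : a' ∉ Y := by
  subst ha
  exact notMem_of_carrier_succ_eq_zero h.zero

/-- No letter of `X` above `a` is unpaired, so something is open at every further letter of the run.
As nothing is open at `a`, only the letter of `Y` immediately below can provide it. -/
theorem block (h : FMove X Y X' Y' a m) (c : ℕ) (hc : a < c) (hm : c ≤ m) :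
    carrier X Y c = 1 ∧ c - 1 ∈ Y := by
  obtain ⟨j, rfl⟩ : ∃ j, c = a + j + 1 := ⟨c - a - 1, by omega⟩
  clear hc
  induction j with
  | zero =>
    have h1 := h.last (a + 0 + 1) (by omega) (h.run _ (by omega) hm)
    rw [carrier_succ, if_pos (by simpa using h.mem)] at h1 ⊢
    have h0 := h.zero
    simp only [Nat.add_zero, Nat.add_sub_cancel] at *
    split_ifs at * with h2 <;> simp_all
  | succ j ih =>
    obtain ⟨ih1, -⟩ := ih (by omega)
    have h1 := h.last (a + (j + 1) + 1) (by omega) (h.run _ (by omega) hm)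
    have h3 : a + (j + 1) ∈ X := h.run _ (by omega) (by omega)
    rw [carrier_succ, if_pos h3] at h1 ⊢
    rw [show a + (j + 1) = a + j + 1 by omega] at *
    rw [ih1] at h1 ⊢
    simp only [Nat.add_sub_cancel]
    split_ifs at * with h2 <;> simp_all

/-- Otherwise `[a, m]` would be a common block with both ends free. -/
theorem notMem (h : FMove X Y X' Y' a m) (hN : NoBlock X Y) : m ∉ Y := by
  intro hm
  have hb : ∀ c, a ≤ c → c ≤ m → c ∈ Y := by
    intro c h1 h2
    rcases eq_or_lt_of_le h2 with rfl | h3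
    · exact hm
    · simpa using (h.block (c + 1) (by omega) (by omega)).2
  rcases hN a m h.le (fun c h1 h2 => ⟨h.run c h1 h2, hb c h1 h2⟩) with h1 | ⟨a', h1, h2⟩
  · exact h.boundary h1
  · exact h.pred_notMem a' h1 h2

theorem carrier_eq_of_le (h : FMove X Y X' Y' a m) {c : ℕ} (hc : c ≤ a) :
    carrier X' Y' c = carrier X Y c := by
  have := h.le
  refine carrier_congr fun d hd => ?_
  rw [h.left_eq, h.right_eq, Finset.mem_erase, Finset.mem_insert]
  constructor
  · constructor
    · exact fun h => h.2
    · exact fun h => ⟨by omega, h⟩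
  · constructor
    · rintro (h | h)
      · omega
      · exact h
    · exact Or.inr

theorem carrier_eq_one (h : FMove X Y X' Y' a m) {c : ℕ} (hc : a < c) (hm : c ≤ m) :
    carrier X' Y' c = 1 := by
  obtain ⟨j, rfl⟩ : ∃ j, c = a + j + 1 := ⟨c - a - 1, by omega⟩
  clear hc
  have hY : a + j ∈ Y' := by
    rw [h.right_eq]
    exact Finset.mem_insert_of_mem (by simpa using (h.block (a + j + 1) (by omega) hm).2)
  induction j with
  | zero =>
    rw [add_zero] at hY ⊢
    rw [carrier_succ, if_pos hY, h.carrier_eq_of_le le_rfl, h.zero]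
    omega
  | succ j ih =>
    have hX : a + (j + 1) ∈ X' := by
      rw [h.left_eq]
      exact Finset.mem_erase_of_ne_of_mem (by omega) (h.run _ (by omega) (by omega))
    rw [carrier_succ, if_pos hY, if_pos hX, ← add_assoc, ih (by omega)]
    rw [h.right_eq]
    exact Finset.mem_insert_of_mem (by simpa using (h.block (a + j + 1) (by omega) (by omega)).2)

theorem carrier_succ_end (h : FMove X Y X' Y' a m) (hN : NoBlock X Y) :
    carrier X Y (m + 1) = 0 ∧ carrier X' Y' (m + 1) = 1 := by
  have hm := h.notMem hN
  have hle := h.le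
  have hY : m ∈ Y' := by rw [h.right_eq]; exact Finset.mem_insert_self _ _
  rw [carrier_succ, carrier_succ, if_neg hm, if_pos hY, if_pos (h.run m h.le le_rfl)]
  rcases eq_or_lt_of_le h.le with rfl | h3
  · rw [h.carrier_eq_of_le le_rfl, h.zero]
    omega
  · rw [h.carrier_eq_one h3 le_rfl, (h.block m h3 le_rfl).1,
      if_pos (by
        rw [h.left_eq]; exact Finset.mem_erase_of_ne_of_mem (by omega) (h.run m h.le le_rfl))]
    omega

theorem mem_iff_of_lt (h : FMove X Y X' Y' a m) {c : ℕ} (hc : m < c) :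
    (c ∈ X' ↔ c ∈ X) ∧ (c ∈ Y' ↔ c ∈ Y) := by
  have := h.le
  rw [h.left_eq, h.right_eq, Finset.mem_erase, Finset.mem_insert]
  constructor
  · exact ⟨fun h => h.2, fun h => ⟨by omega, h⟩⟩
  · exact ⟨fun h => h.resolve_left (by omega), Or.inr⟩

/-- Above `m` every letter of `X` already met a nonzero carrier, so no subtraction is truncated and
the surplus caused by the new letter `m` persists. -/
theorem carrier_eq_add_one (h : FMove X Y X' Y' a m) (hN : NoBlock X Y) {c : ℕ} (hc : m < c) :
    carrier X' Y' c = carrier X Y c + 1 := by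
  obtain ⟨j, rfl⟩ : ∃ j, c = m + 1 + j := ⟨c - m - 1, by omega⟩
  clear hc
  have hle := h.le
  induction j with
  | zero => have := h.carrier_succ_end hN; rw [add_zero]; omega
  | succ j ih =>
    rw [← add_assoc, carrier_succ, carrier_succ, ih]
    simp only [(h.mem_iff_of_lt (c := m + 1 + j) (by omega)).1,
      (h.mem_iff_of_lt (c := m + 1 + j) (by omega)).2]
    have := h.last (m + 1 + j) (by omega)
    split_ifs at * <;> simp_all <;> omega

/-- By the shift of the carrier, `m` becomes the last position at which nothing is open after
closing, and the run of `Y'` below `m` stops at `a`; these are the data by which the raising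
operator finds its letters. -/
theorem eMove (h : FMove X Y X' Y' a m) (hN : NoBlock X Y) : EMove X' Y' X Y a m := by
  have hle := h.le
  have hm := h.notMem hN
  refine ⟨by rw [h.right_eq]; exact Finset.mem_insert_self _ _, ?_, ?_, h.le, ?_, ?_, ?_, ?_⟩
  · rcases eq_or_lt_of_le h.le with rfl | h3
    · rw [h.carrier_eq_of_le le_rfl, h.zero]; simp
    · rw [h.carrier_eq_one h3 le_rfl,
        if_pos (by
          rw [h.left_eq]; exact Finset.mem_erase_of_ne_of_mem (by omega) (h.run m h.le le_rfl))]
  · intro d hd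
    rw [h.carrier_eq_add_one hN hd]
    simp only [(h.mem_iff_of_lt hd).1]
    have := h.last d (by omega)
    split_ifs with h1
    · have := this h1; omega
    · omega
  · intro c h1 h2
    rw [h.right_eq]
    rcases eq_or_lt_of_le h2 with rfl | h3
    · exact Finset.mem_insert_self _ _
    · exact Finset.mem_insert_of_mem (by simpa using (h.block (c + 1) (by omega) (by omega)).2)
  · intro a' ha'
    rw [h.right_eq, Finset.mem_insert]
    rintro (h1 | h1)
    · omega
    · exact h.pred_notMem a' ha' h1
  · rw [h.left_eq, Finset.insert_erase h.mem]
  · rw [h.right_eq, Finset.erase_insert hm]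

end FMove

/-! ### Scans before and after a single raising. -/

namespace EMove
variable {X Y X' Y' : Finset ℕ} {a b : ℕ}

/-- Descend from `b`: the letter of `Y` at `c` is open on arrival at `c + 1`, yet nothing is open
after closing there. So `c + 1` lies in `X`, and nothing else was open at `c`. -/
theorem block (h : EMove X Y X' Y' a b) (c : ℕ) (hc : a ≤ c) (hm : c ≤ b) :
    carrier X Y c - (if c ∈ X then 1 else 0) = 0 ∧ (a < c → carrier X Y c = 1 ∧ c ∈ X) := by
  obtain ⟨j, rfl⟩ : ∃ j, c = b - j := ⟨b - c, by omega⟩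
  have key : carrier X Y (b - j) - (if b - j ∈ X then 1 else 0) = 0 := by
    induction j with
    | zero => exact h.zero
    | succ j ih =>
      by_cases hj : b - (j + 1) = b - j
      · rw [hj]; exact ih (by omega) (by omega)
      have h1 := ih (by omega) (by omega)
      obtain ⟨e, he⟩ : ∃ e, b - j = e + 1 := ⟨b - j - 1, by omega⟩
      have he' : b - (j + 1) = e := by omega
      rw [he, carrier_succ, if_pos (h.run e (by omega) (by omega))] at h1
      rw [he']
      split_ifs at * <;> omega
  refine ⟨key, fun ha => ?_⟩
  obtain ⟨e, he⟩ : ∃ e, b - j = e + 1 := ⟨b - j - 1, by omega⟩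
  rw [he] at key ⊢
  rw [carrier_succ, if_pos (h.run e (by omega) (by omega))] at key ⊢
  split_ifs at key ⊢ <;> first | omega | simp_all

theorem carrier_end (h : EMove X Y X' Y' a b) : carrier X Y (b + 1) = 1 ∧ b + 1 ∉ X := by
  have h1 : carrier X Y (b + 1) = 1 := by
    rw [carrier_succ, if_pos h.mem, h.zero]
  refine ⟨h1, fun h2 => ?_⟩
  have := h.last (b + 1) (by omega)
  rw [h1, if_pos h2] at this
  omega

theorem notMem (h : EMove X Y X' Y' a b) (hN : NoBlock X Y) : a ∉ X := by
  intro ha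
  have hb : ∀ c, a ≤ c → c ≤ b → c ∈ X := by
    intro c h1 h2
    rcases eq_or_lt_of_le h1 with rfl | h3
    · exact ha
    · exact ((h.block c h1 h2).2 h3).2
  rcases hN a b h.le (fun c h1 h2 => ⟨hb c h1 h2, h.run c h1 h2⟩) with h1 | ⟨a', h1, h2⟩
  · exact h.carrier_end.2 h1
  · exact h.boundary a' h1 h2

theorem carrier_eq_of_le (h : EMove X Y X' Y' a b) {c : ℕ} (hc : c ≤ a) :
    carrier X' Y' c = carrier X Y c := by
  have := h.le
  refine carrier_congr fun d hd => ?_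
  rw [h.left_eq, h.right_eq, Finset.mem_erase, Finset.mem_insert]
  constructor
  · exact ⟨fun h => h.resolve_left (by omega), Or.inr⟩
  · exact ⟨fun h => h.2, fun h => ⟨by omega, h⟩⟩

theorem carrier_start (h : EMove X Y X' Y' a b) (hN : NoBlock X Y) : carrier X' Y' a = 0 := by
  rw [h.carrier_eq_of_le le_rfl]
  have := (h.block a le_rfl h.le).1
  rw [if_neg (h.notMem hN)] at this
  omega

theorem carrier_eq_one (h : EMove X Y X' Y' a b) (hN : NoBlock X Y) {c : ℕ} (hc : a < c)
    (hm : c ≤ b) : carrier X' Y' c = 1 := by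
  obtain ⟨j, rfl⟩ : ∃ j, c = a + j + 1 := ⟨c - a - 1, by omega⟩
  clear hc
  induction j with
  | zero =>
    have hY : a + 0 ∈ Y' := by
      rw [h.right_eq]
      exact Finset.mem_erase_of_ne_of_mem (by omega) (h.run _ (by omega) (by omega))
    rw [add_zero] at hY ⊢
    rw [carrier_succ, if_pos hY, h.carrier_start hN]
    omega
  | succ j ih =>
    have hX : a + (j + 1) ∈ X' := by
      rw [h.left_eq]
      exact Finset.mem_insert_of_mem ((h.block _ (by omega) (by omega)).2 (by omega)).2
    have hY : a + (j + 1) ∈ Y' := by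
      rw [h.right_eq]
      exact Finset.mem_erase_of_ne_of_mem (by omega) (h.run _ (by omega) (by omega))
    rw [carrier_succ, if_pos hY, if_pos hX, ← add_assoc, ih (by omega)]

theorem carrier_eq_sub_one (h : EMove X Y X' Y' a b) (hN : NoBlock X Y) {c : ℕ} (hc : b < c) :
    carrier X' Y' c + 1 = carrier X Y c := by
  obtain ⟨j, rfl⟩ : ∃ j, c = b + 1 + j := ⟨c - b - 1, by omega⟩
  clear hc
  have hle := h.le
  induction j with
  | zero =>
    have hY : b ∉ Y' := by rw [h.right_eq]; simp
    have hX : b ∈ X' := by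
      rw [h.left_eq]
      rcases eq_or_lt_of_le h.le with rfl | h3
      · exact Finset.mem_insert_self _ _
      · exact Finset.mem_insert_of_mem ((h.block _ h.le le_rfl).2 h3).2
    rw [add_zero, h.carrier_end.1, carrier_succ, if_neg hY, if_pos hX]
    rcases eq_or_lt_of_le h.le with rfl | h3
    · rw [h.carrier_start hN]
    · rw [h.carrier_eq_one hN h3 le_rfl]
  | succ j ih =>
    have h1 : (b + 1 + j ∈ X' ↔ b + 1 + j ∈ X) ∧ (b + 1 + j ∈ Y' ↔ b + 1 + j ∈ Y) := by
      rw [h.left_eq, h.right_eq, Finset.mem_erase, Finset.mem_insert]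
      constructor
      · exact ⟨fun h => h.resolve_left (by omega), Or.inr⟩
      · exact ⟨fun h => h.2, fun h => ⟨by omega, h⟩⟩
    rw [← add_assoc, carrier_succ, carrier_succ, ← ih]
    simp only [h1.1, h1.2]
    have := h.last (b + 1 + j) (by omega)
    rw [← ih] at this
    split_ifs at * <;> omega

theorem fMove (h : EMove X Y X' Y' a b) (hN : NoBlock X Y) : FMove X' Y' X Y a b := by
  have hle := h.le
  have ha := h.notMem hN
  have hrun : ∀ c, a ≤ c → c ≤ b → c ∈ X' := by
    intro c h1 h2
    rw [h.left_eq]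
    rcases eq_or_lt_of_le h1 with rfl | h3
    · exact Finset.mem_insert_self _ _
    · exact Finset.mem_insert_of_mem ((h.block c h1 h2).2 h3).2
  refine ⟨hrun a le_rfl h.le, h.carrier_start hN, ?_, h.le, hrun, ?_, ?_, ?_⟩
  · intro d hd hX
    rcases le_or_gt d b with h1 | h1
    · rw [h.carrier_eq_one hN hd h1]; omega
    · have h2 := h.carrier_eq_sub_one hN h1
      have h3 := h.last d h1
      rw [h.left_eq, Finset.mem_insert] at hX
      rw [if_pos (hX.resolve_left (by omega))] at h3
      omega
  · rw [h.left_eq, Finset.mem_insert]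
    rintro (h1 | h1)
    · omega
    · exact h.carrier_end.2 h1
  · rw [h.left_eq, Finset.erase_insert ha]
  · rw [h.right_eq, Finset.insert_erase h.mem]

end EMove

/-! ### The braid relation for the maximal lowerings -/

/-- The relation between the states of the six automata that compute the two sides of the braid
relation. -/
def BraidInv (k₁ k₂ k₄ k₃ k₅ k₆ : ℕ) : Bool → Bool → Bool → Bool → Bool → Bool → Prop
  | false, false, false, false, false, false =>
    k₃ = k₂ + (k₄ - k₁) ∧ k₅ = min k₁ k₄ ∧ k₆ = k₂ + (k₁ - k₄)
  | false, false, true, false, true, false =>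
    k₄ = 1 ∧ 1 ≤ k₁ ∧ k₅ = 1 ∧ k₃ = k₂ ∧ k₆ = k₁ + k₂
  | false, true, false, false, false, true =>
    k₂ = 1 ∧ k₁ ≤ k₄ ∧ k₃ = 1 + (k₄ - k₁) ∧ k₅ = k₁ ∧ k₆ = 1
  | false, true, false, true, false, false =>
    k₂ = 1 ∧ k₃ = 1 ∧ k₄ < k₁ ∧ k₅ = k₄ ∧ k₆ = k₁ - k₄
  | false, true, true, true, true, false =>
    k₂ = 1 ∧ k₄ = 1 ∧ k₃ = 1 ∧ k₅ = 1 ∧ k₆ = k₁ ∧ 1 ≤ k₁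
  | true, false, false, false, false, true =>
    k₁ = 1 ∧ k₂ = 0 ∧ k₄ = 0 ∧ k₃ = 0 ∧ k₅ = 0 ∧ k₆ = 1
  | true, false, false, false, true, false =>
    k₁ = 1 ∧ 1 ≤ k₄ ∧ k₃ = k₂ + (k₄ - 1) ∧ k₅ = 1 ∧ k₆ = k₂
  | true, false, true, false, true, true =>
    k₁ = 1 ∧ k₂ = 0 ∧ k₄ = 1 ∧ k₃ = 0 ∧ k₅ = 1 ∧ k₆ = 1
  | true, true, false, false, true, true =>
    k₁ = 1 ∧ k₂ = 1 ∧ 1 ≤ k₄ ∧ k₃ = k₄ ∧ k₅ = 1 ∧ k₆ = 1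
  | true, true, false, true, false, true =>
    k₁ = 1 ∧ k₂ = 1 ∧ k₄ = 0 ∧ k₃ = 1 ∧ k₅ = 0 ∧ k₆ = 1
  | true, true, true, true, true, true =>
    k₁ = 1 ∧ k₂ = 1 ∧ k₄ = 1 ∧ k₃ = 1 ∧ k₅ = 1 ∧ k₆ = 1
  | _, _, _, _, _, _ => False

/-- The output of the automaton on the first track. -/
def outX (k : ℕ) (x : Bool) : Bool := x && k != 0

/-- The output of the automaton on the second track. -/
def outY (k : ℕ) (s x y : Bool) : Bool := y || (x && (k == 0 || s))

/-- The next value of the carrier. -/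
def nextCarrier (k : ℕ) (x y : Bool) : ℕ := k - x.toNat + y.toNat

/-- The next value of the flag. -/
def nextStar (k : ℕ) (s x y : Bool) : Bool := x && y && (k == 0 || s)

set_option maxHeartbeats 4000000 in
-- Indices 1, 2, 4 are the scans on the left side of the braid relation, and 3, 5, 6 those on the
-- right. One more bit of each of `R`, `A`, `B` (here `r`, `a`, `b`) leads to another admissible
-- state and produces the same three output bits on both sides. The hypotheses `v₁`, …, `v₆` are the
-- consequences of `NoBlock` that rule out the other transitions.
theorem BraidInv.step {k₁ k₂ k₄ k₃ k₅ k₆ : ℕ} {s₁ s₂ s₄ s₃ s₅ s₆ : Bool}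
    (h : BraidInv k₁ k₂ k₄ k₃ k₅ k₆ s₁ s₂ s₄ s₃ s₅ s₆)
    {r a b a' r' b' r'' a₃ b₃ r₅ a₅ : Bool}
    (ha' : a' = outX k₁ r) (hr' : r' = outY k₁ s₁ r a)
    (hb' : b' = outX k₂ r') (hr'' : r'' = outY k₂ s₂ r' b)
    (ha₃ : a₃ = outX k₃ a) (hb₃ : b₃ = outY k₃ s₃ a b)
    (hr₅ : r₅ = outX k₅ r) (ha₅ : a₅ = outY k₅ s₅ r a₃)
    (v₁ : s₁ = true → r = true) (v₂ : s₂ = true → r' = true) (v₄ : s₄ = true → a' = true)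
    (v₃ : s₃ = true → a = true) (v₅ : s₅ = true → r = true) (v₆ : s₆ = true → a₅ = true) :
    BraidInv (nextCarrier k₁ r a) (nextCarrier k₂ r' b) (nextCarrier k₄ a' b')
      (nextCarrier k₃ a b) (nextCarrier k₅ r a₃) (nextCarrier k₆ a₅ b₃)
      (nextStar k₁ s₁ r a) (nextStar k₂ s₂ r' b) (nextStar k₄ s₄ a' b')
      (nextStar k₃ s₃ a b) (nextStar k₅ s₅ r a₃) (nextStar k₆ s₆ a₅ b₃) ∧
    outX k₄ a' = r₅ ∧ outY k₄ s₄ a' b' = outX k₆ a₅ ∧ r'' = outY k₆ s₆ a₅ b₃ := by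
  subst ha' hr' hb' hr'' ha₃ hb₃ hr₅ ha₅
  cases s₁ <;> cases s₂ <;> cases s₄ <;> cases s₃ <;> cases s₅ <;> cases s₆ <;>
    (try exact h.elim) <;> simp only [BraidInv] at h
  -- The outputs depend on a carrier only through its vanishing; after splitting each carrier into
  -- zero and successor, the rest is linear arithmetic.
  all_goals
    rcases k₁ with _ | k₁ <;> rcases k₂ with _ | k₂ <;> rcases k₄ with _ | k₄ <;>
    rcases k₃ with _ | k₃ <;> rcases k₅ with _ | k₅ <;> rcases k₆ with _ | k₆ <;>
    first
    | (exfalso; omega)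
    | (cases r <;> cases a <;> cases b <;>
        first
        | (exfalso; simp [outX, outY] at v₁ v₂ v₄ v₃ v₅ v₆; done)
        | (simp [BraidInv, outX, outY, nextCarrier, nextStar] <;> omega))

/-! ### The final value of the carrier -/

/-- A strict upper bound for the elements of two sets. -/
def letterBound (X Y : Finset ℕ) : ℕ := (X ∪ Y).sup id + 1

/-- The number of unpaired letters of `Y` in the bracketing of `X` and `Y`. -/
def eps (X Y : Finset ℕ) : ℕ := carrier X Y (letterBound X Y)

theorem lt_letterBound_left {X Y : Finset ℕ} {c : ℕ} (h : c ∈ X) : c < letterBound X Y :=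
  Nat.lt_succ_of_le (Finset.le_sup (f := id) (Finset.mem_union_left Y h))

theorem lt_letterBound_right {X Y : Finset ℕ} {c : ℕ} (h : c ∈ Y) : c < letterBound X Y :=
  Nat.lt_succ_of_le (Finset.le_sup (f := id) (Finset.mem_union_right X h))

theorem carrier_eq_of_ge {X Y : Finset ℕ} {M c : ℕ} (hX : ∀ x ∈ X, x < M) (hY : ∀ y ∈ Y, y < M)
    (hc : M ≤ c) : carrier X Y c = carrier X Y M := by
  induction c, hc using Nat.le_induction with
  | base => rfl
  | succ c hc ih =>
    rw [carrier_succ, if_neg fun h => absurd (hX c h) (by omega),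
      if_neg fun h => absurd (hY c h) (by omega), ih]
    omega

theorem carrier_eq_eps {X Y : Finset ℕ} {M : ℕ} (hX : ∀ x ∈ X, x < M) (hY : ∀ y ∈ Y, y < M) :
    carrier X Y M = eps X Y := by
  rcases le_total M (letterBound X Y) with h | h
  · exact (carrier_eq_of_ge hX hY h).symm
  · exact carrier_eq_of_ge (fun _ => lt_letterBound_left) (fun _ => lt_letterBound_right) h

theorem card_filter_lt_succ (S : Finset ℕ) (c : ℕ) :
    (S.filter (· < c + 1)).card = (S.filter (· < c)).card + if c ∈ S then 1 else 0 := by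
  split_ifs with h
  · rw [← Finset.card_insert_of_notMem (s := S.filter (· < c)) (a := c) (by simp)]
    congr 1
    ext x
    simp only [Finset.mem_filter, Finset.mem_insert]
    constructor
    · rintro ⟨h1, h2⟩
      rcases Nat.lt_succ_iff_lt_or_eq.1 h2 with h3 | h3
      · exact Or.inr ⟨h1, h3⟩
      · exact Or.inl h3
    · rintro (rfl | ⟨h1, h2⟩)
      · exact ⟨h, by omega⟩
      · exact ⟨h1, by omega⟩
  · rw [add_zero]
    congr 1
    ext x
    simp only [Finset.mem_filter]
    refine and_congr_right fun hx => ?_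
    have : x ≠ c := fun h' => h (h' ▸ hx)
    omega

theorem card_filter_lt_of_bound {S : Finset ℕ} {M : ℕ} (h : ∀ x ∈ S, x < M) :
    (S.filter (· < M)).card = S.card := by
  rw [Finset.filter_true_of_mem h]

/-- Each letter of `Y` read so far is still open or has been closed by a letter of `lowX`. -/
theorem carrier_add_card (X Y : Finset ℕ) (c : ℕ) :
    carrier X Y c + ((lowX X Y).filter (· < c)).card = (Y.filter (· < c)).card := by
  induction c with
  | zero => simp [carrier]
  | succ c ih =>
    rw [card_filter_lt_succ, card_filter_lt_succ, carrier_succ]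
    simp only [mem_lowX]
    split_ifs at * <;> simp_all <;> omega

theorem lowX_subset (X Y : Finset ℕ) : lowX X Y ⊆ X := Finset.filter_subset _ _

theorem eps_add_card (X Y : Finset ℕ) : eps X Y + (lowX X Y).card = Y.card := by
  have h := carrier_add_card X Y (letterBound X Y)
  rwa [card_filter_lt_of_bound fun x hx => lt_letterBound_left (lowX_subset _ _ hx),
    card_filter_lt_of_bound fun x => lt_letterBound_right] at h

theorem star_eq_false_of_bound {X Y : Finset ℕ} {M : ℕ} (hN : NoBlock X Y)
    (hX : ∀ x ∈ X, x < M) : star X Y M = false := by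
  rw [Bool.eq_false_iff]
  intro h
  exact lt_irrefl _ (hX _ (hN.mem_of_star h))

/-- In a flagged block one unpaired letter of `X` has been dropped and its replacement in `lowY` is
still to come; the flag records this debt of one. -/
theorem card_low_filter {X Y : Finset ℕ} (hN : NoBlock X Y) (c : ℕ) :
    ((lowX X Y).filter (· < c)).card + ((lowY X Y).filter (· < c)).card + (star X Y c).toNat =
      (X.filter (· < c)).card + (Y.filter (· < c)).card := by
  induction c with
  | zero => simp [star]
  | succ c ih =>
    have h1 := hN.mem_of_star (c := c)
    have h2 := carrier_eq_one_of_star (X := X) (Y := Y) (c := c)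
    simp only [card_filter_lt_succ, mem_lowX, mem_lowY]
    have h3 : (star X Y (c + 1)).toNat =
        if c ∈ X ∧ c ∈ Y ∧ (carrier X Y c = 0 ∨ star X Y c = true) then 1 else 0 := by
      split_ifs with h
      · rw [(star_succ X Y c).2 h]; rfl
      · rw [Bool.eq_false_iff.2 fun h' => h ((star_succ X Y c).1 h')]; rfl
    rw [h3]
    clear h3
    cases hs : star X Y c <;> rw [hs] at ih h1 h2 <;> by_cases hx : c ∈ X <;>
      by_cases hy : c ∈ Y <;> by_cases hk : carrier X Y c = 0 <;> simp [hx, hy, hk] at * <;> omega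

theorem card_low {X Y : Finset ℕ} (hN : NoBlock X Y) :
    (lowX X Y).card + (lowY X Y).card = X.card + Y.card := by
  have h := card_low_filter hN (letterBound X Y)
  have hY : ∀ y ∈ lowY X Y, y < letterBound X Y := by
    intro y hy
    rcases mem_lowY.1 hy with h | h
    · exact lt_letterBound_right h
    · exact lt_letterBound_left h.1
  rwa [card_filter_lt_of_bound fun x hx => lt_letterBound_left (lowX_subset _ _ hx),
    card_filter_lt_of_bound hY, card_filter_lt_of_bound fun x => lt_letterBound_left,
    card_filter_lt_of_bound fun x => lt_letterBound_right,
    star_eq_false_of_bound hN fun x => lt_letterBound_left] at h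

/-! ### Maximal lowerings and single lowerings -/

theorem star_eq_false_of_carrier {X Y : Finset ℕ} {a c : ℕ} (h0 : star X Y a = false) (hc : a ≤ c)
    (h : ∀ d, a ≤ d → d ∈ X → carrier X Y d ≠ 0) : star X Y c = false := by
  induction c, hc using Nat.le_induction with
  | base => exact h0
  | succ c hc ih =>
    rw [Bool.eq_false_iff]
    intro hs
    obtain ⟨h1, -, h2 | h2⟩ := (star_succ X Y c).1 hs
    · exact h c hc h1 h2
    · rw [ih] at h2; exact Bool.false_ne_true h2

theorem low_eq_self {X Y : Finset ℕ} (h : ∀ x ∈ X, carrier X Y x ≠ 0) :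
    lowX X Y = X ∧ lowY X Y = Y := by
  refine ⟨Finset.filter_true_of_mem h, ?_⟩
  ext c
  rw [mem_lowY]
  refine ⟨fun h' => h'.resolve_right ?_, Or.inl⟩
  rintro ⟨h1, h2 | h2⟩
  · exact h c h1 h2
  · rw [star_eq_false_of_carrier (a := 0) rfl (Nat.zero_le c) fun d _ => h d] at h2
    exact Bool.false_ne_true h2

/-- The removed letter was unpaired, and the paired letters above it still meet a nonzero carrier;
so the end of the string is the same from `(X, Y)` and from `(X', Y')`. -/
theorem FMove.lowX_eq {X Y X' Y' : Finset ℕ} {a m : ℕ} (h : FMove X Y X' Y' a m)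
    (hN : NoBlock X Y) : lowX X' Y' = lowX X Y := by
  ext c
  rw [mem_lowX, mem_lowX, h.left_eq, Finset.mem_erase, ← h.left_eq]
  rcases lt_trichotomy c a with hc | rfl | hc
  · rw [h.carrier_eq_of_le hc.le]
    constructor
    · exact fun h => ⟨h.1.2, h.2⟩
    · exact fun h => ⟨⟨hc.ne, h.1⟩, h.2⟩
  · have := h.zero
    tauto
  · have h2 : c ∈ X → carrier X Y c ≠ 0 := h.last c hc
    have h3 : carrier X' Y' c ≠ 0 := by
      rcases le_or_gt c m with h1 | h1
      · rw [h.carrier_eq_one hc h1]; omega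
      · rw [h.carrier_eq_add_one hN h1]; omega
    have h4 : c ≠ a := by omega
    tauto

/-- The scan replaces the unpaired `a` by exactly `m`: the flag, if it rises at all, rises at `a`
and falls at `m`. After the move nothing above `a` is unpaired or flagged. -/
theorem FMove.lowY_eq {X Y X' Y' : Finset ℕ} {a m : ℕ} (h : FMove X Y X' Y' a m)
    (hN : NoBlock X Y) : lowY X' Y' = lowY X Y := by
  have hle := h.le
  have hstar : ∀ c, a < c → c ≤ m → star X Y c = true := by
    intro c hc hm
    induction c, Nat.succ_le_of_lt hc using Nat.le_induction with
    | base =>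
      exact (star_succ X Y a).2 ⟨h.mem, by simpa using (h.block (a + 1) (by omega) hm).2,
        Or.inl h.zero⟩
    | succ c hc' ih =>
      refine (star_succ X Y c).2 ⟨h.run c (by omega) (by omega),
        by simpa using (h.block (c + 1) (by omega) hm).2, Or.inr (ih (by omega) (by omega))⟩
  have hstar2 : ∀ c, m < c → star X Y c = false := by
    intro c hc
    refine star_eq_false_of_carrier (a := m + 1) ?_ hc fun d hd => h.last d (by omega)
    rw [Bool.eq_false_iff]
    exact fun hs => h.notMem hN ((star_succ X Y m).1 hs).2.1
  have hcar : ∀ c, a < c → carrier X' Y' c ≠ 0 := by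
    intro c hc
    rcases le_or_gt c m with h1 | h1
    · rw [h.carrier_eq_one hc h1]; omega
    · rw [h.carrier_eq_add_one hN h1]; omega
  have hstar' : ∀ c, a < c → star X' Y' c = false := by
    intro c hc
    refine star_eq_false_of_carrier (a := a + 1) ?_ hc fun d hd _ => hcar d (by omega)
    rw [Bool.eq_false_iff]
    intro hs
    have := ((star_succ X' Y' a).1 hs).1
    rw [h.left_eq] at this
    simp at this
  have hst : star X' Y' a = star X Y a := by
    refine star_congr fun d hd => ?_
    rw [h.left_eq, h.right_eq, Finset.mem_erase, Finset.mem_insert]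
    exact ⟨⟨fun h => h.2, fun h => ⟨by omega, h⟩⟩, ⟨fun h => h.resolve_left (by omega), Or.inr⟩⟩
  ext c
  rw [mem_lowY, mem_lowY]
  rcases lt_trichotomy c a with hc | rfl | hc
  · have h1 : star X' Y' c = star X Y c := by
      refine star_congr fun d hd => ?_
      rw [h.left_eq, h.right_eq, Finset.mem_erase, Finset.mem_insert]
      exact ⟨⟨fun h => h.2, fun h => ⟨by omega, h⟩⟩, ⟨fun h => h.resolve_left (by omega), Or.inr⟩⟩
    rw [h.carrier_eq_of_le hc.le, h1, h.left_eq, h.right_eq, Finset.mem_erase, Finset.mem_insert]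
    have h2 : c ≠ a := by omega
    have h3 : c ≠ m := by omega
    tauto
  · have h1 : c ∈ Y' := by
      rw [h.right_eq, Finset.mem_insert]
      rcases eq_or_lt_of_le hle with h2 | h2
      · exact Or.inl h2
      · exact Or.inr (by simpa using (h.block (c + 1) (by omega) h2).2)
    have := h.mem
    have := h.zero
    tauto
  · have e1 := hcar c hc
    have e2 := hstar' c hc
    have e3 := h.last c hc
    rcases lt_trichotomy c m with h1 | rfl | h1
    · have : c ∈ Y := by simpa using (h.block (c + 1) (by omega) h1).2
      have : c ∈ Y' := by rw [h.right_eq]; exact Finset.mem_insert_of_mem this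
      tauto
    · have : c ∈ Y' := by rw [h.right_eq]; exact Finset.mem_insert_self _ _
      have := hstar c hc le_rfl
      have := h.run c hle le_rfl
      tauto
    · have e4 := hstar2 c h1
      rw [e2, e4, (h.mem_iff_of_lt h1).1, (h.mem_iff_of_lt h1).2]
      simp only [Bool.false_eq_true, or_false]
      tauto

theorem exists_fMove {X Y : Finset ℕ} (h : ∃ x ∈ X, carrier X Y x = 0) :
    ∃ a m X' Y', FMove X Y X' Y' a m := by
  obtain ⟨x, hx, h0⟩ := h
  have hne : (X.filter fun c => carrier X Y c = 0).Nonempty := ⟨x, by simp [hx, h0]⟩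
  obtain ⟨ha, hz⟩ := Finset.mem_filter.1 (Finset.max'_mem _ hne)
  set a := (X.filter fun c => carrier X Y c = 0).max' hne with hadef
  have hex : ∃ j, a + j + 1 ∉ X := by
    obtain ⟨M, hM⟩ := X.exists_nat_subset_range
    exact ⟨M, fun h => by have := Finset.mem_range.1 (hM h); omega⟩
  classical
  refine ⟨a, a + Nat.find hex, _, _, ha, hz, fun d hd hdX h0 => ?_, by omega, fun c h1 h2 => ?_,
    Nat.find_spec hex, rfl, rfl⟩
  · have hd2 : d ∈ X.filter fun c => carrier X Y c = 0 := Finset.mem_filter.2 ⟨hdX, h0⟩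
    have := Finset.le_max' _ d hd2
    omega
  · rcases eq_or_lt_of_le h1 with rfl | h3
    · exact ha
    · have := Nat.find_min hex (m := c - a - 1) (by omega)
      rw [not_not, show a + (c - a - 1) + 1 = c by omega] at this
      exact this

theorem FMove.unique {X Y X₁ Y₁ X₂ Y₂ : Finset ℕ} {a₁ m₁ a₂ m₂ : ℕ}
    (h₁ : FMove X Y X₁ Y₁ a₁ m₁) (h₂ : FMove X Y X₂ Y₂ a₂ m₂) :
    a₁ = a₂ ∧ m₁ = m₂ ∧ X₁ = X₂ ∧ Y₁ = Y₂ := by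
  have ha : a₁ = a₂ := by
    rcases lt_trichotomy a₁ a₂ with h | h | h
    · exact absurd h₂.zero (h₁.last _ h h₂.mem)
    · exact h
    · exact absurd h₁.zero (h₂.last _ h h₁.mem)
  subst ha
  have hm : m₁ = m₂ := by
    have := h₁.le
    have := h₂.le
    rcases lt_trichotomy m₁ m₂ with h | h | h
    · exact absurd (h₂.run (m₁ + 1) (by omega) h) h₁.boundary
    · exact h
    · exact absurd (h₁.run (m₂ + 1) (by omega) h) h₂.boundary
  subst hm
  exact ⟨rfl, rfl, h₁.left_eq.trans h₂.left_eq.symm, h₁.right_eq.trans h₂.right_eq.symm⟩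

theorem exists_eMove {X Y : Finset ℕ} (h : eps X Y ≠ 0) :
    ∃ a b X' Y', EMove X Y X' Y' a b := by
  classical
  set P : ℕ → Prop := fun c => carrier X Y c - (if c ∈ X then 1 else 0) = 0 with hP
  set M := letterBound X Y
  have hM : ∀ d, M ≤ d → ¬P d := by
    intro d hd
    have h1 : carrier X Y d = eps X Y :=
      carrier_eq_eps (fun x hx => (lt_letterBound_left hx).trans_le hd)
        (fun x hx => (lt_letterBound_right hx).trans_le hd)
    have h2 : d ∉ X := fun hx => absurd (lt_letterBound_left (Y := Y) hx) (by omega)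
    simp only [hP, h1, if_neg h2]
    omega
  have hP0 : P 0 := by simp [hP, carrier]
  -- Nothing is open at position 0, and beyond all letters the carrier stays at `eps X Y ≠ 0`; so
  -- there is a last position with nothing open after closing.
  obtain ⟨b, hb, hlast⟩ : ∃ b, P b ∧ ∀ d, b < d → ¬P d := by
    refine ⟨Nat.findGreatest P M, Nat.findGreatest_spec (Nat.zero_le _) hP0, fun d hd h => ?_⟩
    rcases le_or_gt M d with h1 | h1
    · exact hM d h1 h
    · exact absurd (Nat.le_findGreatest h1.le h) (by omega)
  have hbY : b ∈ Y := by
    by_contra hbY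
    refine hlast (b + 1) (by omega) ?_
    simp only [hP] at hb ⊢
    rw [carrier_succ, hb, if_neg hbY]
    omega
  have hex : ∃ a, a ≤ b ∧ ∀ c, a ≤ c → c ≤ b → c ∈ Y :=
    ⟨b, le_rfl, fun c h1 h2 => (le_antisymm h1 h2) ▸ hbY⟩
  obtain ⟨h1, h2⟩ := Nat.find_spec hex
  refine ⟨Nat.find hex, b, _, _, hbY, hb, hlast, h1, h2, ?_, rfl, rfl⟩
  intro a' ha' hY
  refine Nat.find_min hex (m := a') (by omega) ⟨by omega, fun c h3 h4 => ?_⟩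
  rcases eq_or_lt_of_le h3 with rfl | h5
  · exact hY
  · exact h2 c (by omega) h4

theorem EMove.eps_ne_zero {X Y X' Y' : Finset ℕ} {a b : ℕ} (h : EMove X Y X' Y' a b) :
    eps X Y ≠ 0 := by
  have h1 := h.last (letterBound X Y) (lt_letterBound_right h.mem)
  intro h0
  rw [eps] at h0
  omega

theorem EMove.unique {X Y X₁ Y₁ X₂ Y₂ : Finset ℕ} {a₁ b₁ a₂ b₂ : ℕ}
    (h₁ : EMove X Y X₁ Y₁ a₁ b₁) (h₂ : EMove X Y X₂ Y₂ a₂ b₂) :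
    a₁ = a₂ ∧ b₁ = b₂ ∧ X₁ = X₂ ∧ Y₁ = Y₂ := by
  have hb : b₁ = b₂ := by
    rcases lt_trichotomy b₁ b₂ with h | h | h
    · exact absurd h₂.zero (h₁.last _ h)
    · exact h
    · exact absurd h₁.zero (h₂.last _ h)
  subst hb
  have ha : a₁ = a₂ := by
    have := h₁.le
    have := h₂.le
    rcases lt_trichotomy a₁ a₂ with h | h | h
    · exact absurd (h₁.run (a₂ - 1) (by omega) (by omega)) (h₂.boundary _ (by omega))
    · exact h
    · exact absurd (h₂.run (a₁ - 1) (by omega) (by omega)) (h₁.boundary _ (by omega))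
  subst ha
  exact ⟨rfl, rfl, h₁.left_eq.trans h₂.left_eq.symm, h₁.right_eq.trans h₂.right_eq.symm⟩

theorem FMove.card_left {X Y X' Y' : Finset ℕ} {a m : ℕ} (h : FMove X Y X' Y' a m) :
    X'.card + 1 = X.card := by
  rw [h.left_eq, Finset.card_erase_add_one h.mem]

theorem FMove.card_right {X Y X' Y' : Finset ℕ} {a m : ℕ} (h : FMove X Y X' Y' a m)
    (hN : NoBlock X Y) : Y'.card = Y.card + 1 := by
  rw [h.right_eq, Finset.card_insert_of_notMem (h.notMem hN)]

theorem forall_carrier_ne_zero_iff {X Y : Finset ℕ} :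
    (∀ x ∈ X, carrier X Y x ≠ 0) ↔ (lowX X Y).card = X.card := by
  refine ⟨fun h => by rw [(low_eq_self h).1], fun h x hx => ?_⟩
  rw [← Finset.eq_of_subset_of_card_le (lowX_subset X Y) h.ge] at hx
  exact (mem_lowX.1 hx).2

theorem lowX_card_le (X Y : Finset ℕ) : (lowX X Y).card ≤ X.card :=
  Finset.card_le_card (lowX_subset X Y)

theorem decide_mem_lowX (X Y : Finset ℕ) (c : ℕ) :
    decide (c ∈ lowX X Y) = outX (carrier X Y c) (decide (c ∈ X)) := by
  rw [Bool.eq_iff_iff]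
  simp [mem_lowX, outX]

theorem decide_mem_lowY (X Y : Finset ℕ) (c : ℕ) :
    decide (c ∈ lowY X Y) =
      outY (carrier X Y c) (star X Y c) (decide (c ∈ X)) (decide (c ∈ Y)) := by
  rw [Bool.eq_iff_iff]
  simp [mem_lowY, outY]

theorem carrier_succ_eq_nextCarrier (X Y : Finset ℕ) (c : ℕ) :
    carrier X Y (c + 1) = nextCarrier (carrier X Y c) (decide (c ∈ X)) (decide (c ∈ Y)) := by
  rw [carrier_succ, nextCarrier]
  by_cases h1 : c ∈ X <;> by_cases h2 : c ∈ Y <;> simp [h1, h2]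

theorem star_succ_eq_nextStar (X Y : Finset ℕ) (c : ℕ) :
    star X Y (c + 1) =
      nextStar (carrier X Y c) (star X Y c) (decide (c ∈ X)) (decide (c ∈ Y)) := rfl

/-- The six pairs that occur in the braid relation for `(R, A, B)` have no common blocks. -/
structure BraidPairs (R A B : Finset ℕ) : Prop where
  h₁ : NoBlock R A
  h₂ : NoBlock (lowY R A) B
  h₄ : NoBlock (lowX R A) (lowX (lowY R A) B)
  h₃ : NoBlock A B
  h₅ : NoBlock R (lowX A B)
  h₆ : NoBlock (lowY R (lowX A B)) (lowY A B)

namespace BraidPairs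
variable {R A B : Finset ℕ}

/-- The later scans read, at position `c`, the outputs of the earlier ones at the same position, so
a single induction on `c` runs all six. -/
theorem inv_and_out (h : BraidPairs R A B) (c : ℕ) :
    BraidInv (carrier R A c) (carrier (lowY R A) B c)
      (carrier (lowX R A) (lowX (lowY R A) B) c) (carrier A B c) (carrier R (lowX A B) c)
      (carrier (lowY R (lowX A B)) (lowY A B) c)
      (star R A c) (star (lowY R A) B c)
      (star (lowX R A) (lowX (lowY R A) B) c) (star A B c) (star R (lowX A B) c)
      (star (lowY R (lowX A B)) (lowY A B) c) ∧
    ∀ d < c,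
      (d ∈ lowX (lowX R A) (lowX (lowY R A) B) ↔ d ∈ lowX R (lowX A B)) ∧
      (d ∈ lowY (lowX R A) (lowX (lowY R A) B) ↔
        d ∈ lowX (lowY R (lowX A B)) (lowY A B)) ∧
      (d ∈ lowY (lowY R A) B ↔ d ∈ lowY (lowY R (lowX A B)) (lowY A B)) := by
  induction c with
  | zero => exact ⟨by simp [carrier, star, BraidInv], fun d hd => absurd hd (by omega)⟩
  | succ c ih =>
    obtain ⟨ih, ihout⟩ := ih
    have key := ih.step (decide_mem_lowX R A c) (decide_mem_lowY R A c)
      (decide_mem_lowX (lowY R A) B c) (decide_mem_lowY (lowY R A) B c)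
      (decide_mem_lowX A B c) (decide_mem_lowY A B c)
      (decide_mem_lowX R (lowX A B) c) (decide_mem_lowY R (lowX A B) c)
      (fun hs => decide_eq_true (h.h₁.mem_of_star hs))
      (fun hs => decide_eq_true (h.h₂.mem_of_star hs))
      (fun hs => decide_eq_true (h.h₄.mem_of_star hs))
      (fun hs => decide_eq_true (h.h₃.mem_of_star hs))
      (fun hs => decide_eq_true (h.h₅.mem_of_star hs))
      (fun hs => decide_eq_true (h.h₆.mem_of_star hs))
    simp only [← carrier_succ_eq_nextCarrier, ← star_succ_eq_nextStar, ← decide_mem_lowX,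
      ← decide_mem_lowY, decide_eq_decide] at key
    refine ⟨key.1, fun d hd => ?_⟩
    rcases Nat.lt_succ_iff_lt_or_eq.1 hd with h1 | rfl
    · exact ihout d h1
    · exact key.2

/-- With F₁ and F₂ the maximal lowerings of the first and of the last pair, this is F₁F₂F₁ = F₂F₁F₂
on `(R, A, B)`. The interplay of insertion and crystal operators rests on it. -/
theorem low_eq (h : BraidPairs R A B) :
    lowX (lowX R A) (lowX (lowY R A) B) = lowX R (lowX A B) ∧
    lowY (lowX R A) (lowX (lowY R A) B) = lowX (lowY R (lowX A B)) (lowY A B) ∧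
    lowY (lowY R A) B = lowY (lowY R (lowX A B)) (lowY A B) :=
  ⟨Finset.ext fun d => ((h.inv_and_out (d + 1)).2 d (by omega)).1,
    Finset.ext fun d => ((h.inv_and_out (d + 1)).2 d (by omega)).2.1,
    Finset.ext fun d => ((h.inv_and_out (d + 1)).2 d (by omega)).2.2⟩

/-- Beyond all letters every flag is down, and the first equation of the invariant in that state is
the claim. The truncated subtraction is genuine: it describes closing brackets meeting too few open
ones. -/
theorem eps_eq (h : BraidPairs R A B) :
    eps A B = eps (lowY R A) B + (eps (lowX R A) (lowX (lowY R A) B) - eps R A) := by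
  obtain ⟨M, hM⟩ := (R ∪ A ∪ B).exists_nat_subset_range
  have hR : ∀ x ∈ R, x < M := fun x hx => Finset.mem_range.1 (hM (by simp [hx]))
  have hA : ∀ x ∈ A, x < M := fun x hx => Finset.mem_range.1 (hM (by simp [hx]))
  have hB : ∀ x ∈ B, x < M := fun x hx => Finset.mem_range.1 (hM (by simp [hx]))
  have hX : ∀ {X Y : Finset ℕ}, (∀ x ∈ X, x < M) → ∀ x ∈ lowX X Y, x < M :=
    fun h x hx => h x (lowX_subset _ _ hx)
  have hY : ∀ {X Y : Finset ℕ}, (∀ x ∈ X, x < M) → (∀ x ∈ Y, x < M) →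
      ∀ x ∈ lowY X Y, x < M := by
    intro X Y h1 h2 x hx
    rcases mem_lowY.1 hx with h | h
    · exact h2 x h
    · exact h1 x h.1
  have key := (h.inv_and_out M).1
  rw [star_eq_false_of_bound h.h₁ hR, star_eq_false_of_bound h.h₂ (hY hR hA),
    star_eq_false_of_bound h.h₄ (hX hR), star_eq_false_of_bound h.h₃ hA,
    star_eq_false_of_bound h.h₅ hR, star_eq_false_of_bound h.h₆ (hY hR (hX hA)),
    carrier_eq_eps hR hA, carrier_eq_eps (hY hR hA) hB, carrier_eq_eps (hX hR) (hX (hY hR hA)),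
    carrier_eq_eps hA hB] at key
  exact key.1

end BraidPairs

/-! ### Words in the symmetric group -/

theorem simpleTransposition_mul_self (n i : ℕ) :
    simpleTransposition n i * simpleTransposition n i = 1 := by
  unfold simpleTransposition
  split_ifs
  · exact Equiv.swap_mul_self _ _
  · exact one_mul 1

theorem simpleTransposition_comm (n : ℕ) {i j : ℕ} (h : i + 1 < j) :
    Commute (simpleTransposition n i) (simpleTransposition n j) := by
  unfold simpleTransposition
  split_ifs with h1 h2 h2
  · apply Equiv.Perm.Disjoint.commute
    rw [Equiv.Perm.disjoint_iff_disjoint_support, Equiv.Perm.support_swap (by simp; omega),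
      Equiv.Perm.support_swap (by simp; omega)]
    simp
    omega
  · exact Commute.one_right _
  · exact Commute.one_left _
  · exact Commute.one_left _

theorem simpleTransposition_braid {n i : ℕ} (h : 1 ≤ i) (h' : i + 1 < n) :
    simpleTransposition n i * simpleTransposition n (i + 1) * simpleTransposition n i =
      simpleTransposition n (i + 1) * simpleTransposition n i * simpleTransposition n (i + 1) := by
  unfold simpleTransposition
  rw [dif_pos ⟨h, by omega⟩, dif_pos ⟨by omega, h'⟩]
  simp only [Nat.add_sub_cancel]
  set p : Fin n := ⟨i - 1, by omega⟩ with hp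
  set q : Fin n := ⟨i, by omega⟩ with hq
  set r : Fin n := ⟨i + 1, h'⟩ with hr
  have hpq : p ≠ q := by rw [hp, hq, Ne, Fin.mk.injEq]; omega
  have hpr : p ≠ r := by rw [hp, hr, Ne, Fin.mk.injEq]; omega
  have hqr : r ≠ q := by simp [hq, hr]
  rw [Equiv.swap_mul_swap_mul_swap hpq hpr, Equiv.swap_comm p q, Equiv.swap_comm q r,
    Equiv.swap_mul_swap_mul_swap hqr hpr.symm, Equiv.swap_comm]

/-- All letters of `a` are indices of simple transpositions of `S_n`. -/
def InRange (n : ℕ) (a : List ℕ) : Prop := ∀ i ∈ a, 1 ≤ i ∧ i < n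

/-- The permutation with the word `a`. -/
def permOf (n : ℕ) (a : List ℕ) : Equiv.Perm (Fin n) := (a.map (simpleTransposition n)).prod

/-- The word `a` is reduced. -/
def IsRed (n : ℕ) (a : List ℕ) : Prop :=
  InRange n a ∧ ∀ b, InRange n b → permOf n b = permOf n a → a.length ≤ b.length

theorem mem_reducedWords_iff {n : ℕ} {w : Equiv.Perm (Fin n)} {a : List ℕ} :
    a ∈ reducedWords n w ↔ IsRed n a ∧ permOf n a = w := by
  constructor
  · rintro ⟨⟨h1, h2⟩, h3⟩
    refine ⟨⟨h1, fun b hb hb' => ?_⟩, h2⟩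
    rw [h3]
    exact Nat.sInf_le ⟨b, ⟨hb, hb'.trans h2⟩, rfl⟩
  · rintro ⟨⟨h1, h2⟩, rfl⟩
    refine ⟨⟨h1, rfl⟩, le_antisymm ?_ (Nat.sInf_le ⟨a, ⟨h1, rfl⟩, rfl⟩)⟩
    refine le_csInf ⟨_, a, ⟨h1, rfl⟩, rfl⟩ ?_
    rintro k ⟨b, ⟨hb1, hb2⟩, rfl⟩
    exact h2 b hb1 hb2

theorem permOf_append (n : ℕ) (a b : List ℕ) : permOf n (a ++ b) = permOf n a * permOf n b := by
  simp [permOf]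

theorem inRange_append {n : ℕ} {a b : List ℕ} :
    InRange n (a ++ b) ↔ InRange n a ∧ InRange n b := by
  simp only [InRange, List.mem_append]
  exact ⟨fun h => ⟨fun i hi => h i (Or.inl hi), fun i hi => h i (Or.inr hi)⟩,
    fun h i hi => hi.elim (h.1 i) (h.2 i)⟩

theorem IsRed.replace {n : ℕ} {l₁ a b l₂ : List ℕ} (h : IsRed n (l₁ ++ a ++ l₂))
    (hb : InRange n b) (hp : permOf n b = permOf n a) (hl : b.length = a.length) :
    IsRed n (l₁ ++ b ++ l₂) := by
  obtain ⟨h1, h2⟩ := h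
  rw [inRange_append, inRange_append] at h1
  refine ⟨inRange_append.2 ⟨inRange_append.2 ⟨h1.1.1, hb⟩, h1.2⟩, fun c hc hc' => ?_⟩
  rw [permOf_append, permOf_append, hp, ← permOf_append, ← permOf_append] at hc'
  have := h2 c hc hc'
  simp only [List.length_append] at *
  omega

theorem IsRed.length_le {n : ℕ} {l₁ a b l₂ : List ℕ} (h : IsRed n (l₁ ++ a ++ l₂))
    (hb : InRange n b) (hp : permOf n b = permOf n a) : a.length ≤ b.length := by
  obtain ⟨h1, h2⟩ := h
  rw [inRange_append, inRange_append] at h1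
  have := h2 (l₁ ++ b ++ l₂) (inRange_append.2 ⟨inRange_append.2 ⟨h1.1.1, hb⟩, h1.2⟩)
    (by rw [permOf_append, permOf_append, hp, ← permOf_append, ← permOf_append])
  simp only [List.length_append] at this
  omega

theorem IsRed.segment {n : ℕ} {l₁ a l₂ : List ℕ} (h : IsRed n (l₁ ++ a ++ l₂)) : IsRed n a := by
  refine ⟨?_, fun b hb hp => h.length_le hb hp⟩
  have := h.1
  rw [inRange_append, inRange_append] at this
  exact this.1.2

/-- The letters of a set in decreasing order. -/
def decWord (S : Finset ℕ) : List ℕ := S.sort (· ≥ ·)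

theorem mem_decWord {S : Finset ℕ} {i : ℕ} : i ∈ decWord S ↔ i ∈ S := Finset.mem_sort _

theorem length_decWord (S : Finset ℕ) : (decWord S).length = S.card := Finset.length_sort _

theorem decWord_empty : decWord ∅ = [] := Finset.sort_empty _

theorem decWord_union {S T : Finset ℕ} (h : ∀ x ∈ S, ∀ y ∈ T, y < x) :
    decWord (S ∪ T) = decWord S ++ decWord T := by
  have hd : Disjoint S T := Finset.disjoint_left.2 fun x hx hx' => lt_irrefl _ (h x hx x hx')
  have hp : (decWord (S ∪ T)).Perm (decWord S ++ decWord T) := by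
    refine (List.perm_ext_iff_of_nodup (Finset.sort_nodup _ _) ?_).2 ?_
    rotate_left
    · intro i
      change i ∈ decWord (S ∪ T) ↔ _
      rw [List.mem_append, mem_decWord, mem_decWord, mem_decWord, Finset.mem_union]
    · refine List.nodup_append.2 ⟨Finset.sort_nodup _ _, Finset.sort_nodup _ _, ?_⟩
      intro a ha b hb
      exact (h a (mem_decWord.1 ha) b (mem_decWord.1 hb)).ne'
  refine List.Perm.eq_of_sortedGE (Finset.sortedGT_sort _).sortedGE ?_ hp
  refine List.Pairwise.sortedGE (List.pairwise_append.2
    ⟨Finset.pairwise_sort _ _, Finset.pairwise_sort _ _, fun a ha b hb => ?_⟩)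
  exact (h a (mem_decWord.1 ha) b (mem_decWord.1 hb)).le

theorem decWord_singleton (i : ℕ) : decWord {i} = [i] := Finset.sort_singleton _ _

/-- The decreasing element with content `S`. -/
def decPerm (n : ℕ) (S : Finset ℕ) : Equiv.Perm (Fin n) := permOf n (decWord S)

theorem decPerm_union (n : ℕ) {S T : Finset ℕ} (h : ∀ x ∈ S, ∀ y ∈ T, y < x) :
    decPerm n (S ∪ T) = decPerm n S * decPerm n T := by
  rw [decPerm, decWord_union h, permOf_append]; rfl

theorem decPerm_comm (n : ℕ) {S T : Finset ℕ} (h : ∀ x ∈ S, ∀ y ∈ T, y + 1 < x) :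
    Commute (decPerm n S) (decPerm n T) := by
  refine Commute.list_prod_left _ _ fun x hx => Commute.list_prod_right _ _ fun y hy => ?_
  obtain ⟨i, hi, rfl⟩ := List.mem_map.1 hx
  obtain ⟨j, hj, rfl⟩ := List.mem_map.1 hy
  exact (simpleTransposition_comm n (h i (mem_decWord.1 hi) j (mem_decWord.1 hj))).symm

theorem decPerm_Ico_succ (n : ℕ) {a m : ℕ} (h : a ≤ m) :
    decPerm n (Finset.Ico a (m + 1)) = simpleTransposition n m * decPerm n (Finset.Ico a m) := by
  have : Finset.Ico a (m + 1) = {m} ∪ Finset.Ico a m := by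
    ext x; simp only [Finset.mem_Ico, Finset.mem_union, Finset.mem_singleton]; omega
  rw [this, decPerm_union n (by simp), decPerm, decWord_singleton]
  simp [permOf]

theorem decPerm_Ico_self (n a : ℕ) : decPerm n (Finset.Ico a a) = 1 := by
  rw [Finset.Ico_self, decPerm, decWord_empty]; rfl

/-- The element s_m ⋯ s_a is a cycle, and conjugation by it shifts the index of s_i by one: the
braid relation acts at i, commutation everywhere else. -/
theorem simpleTransposition_mul_decPerm_Ico {n a i m : ℕ} (ha : 1 ≤ a) (hi : a ≤ i) (hm : i < m)
    (hn : m < n) :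
    simpleTransposition n i * decPerm n (Finset.Ico a (m + 1)) =
      decPerm n (Finset.Ico a (m + 1)) * simpleTransposition n (i + 1) := by
  induction m, Nat.succ_le_of_lt hm using Nat.le_induction with
  | base =>
    have hc : Commute (decPerm n (Finset.Ico a i)) (simpleTransposition n (i + 1)) := by
      refine Commute.list_prod_left _ _ fun x hx => ?_
      obtain ⟨j, hj, rfl⟩ := List.mem_map.1 hx
      have := (Finset.mem_Ico.1 (mem_decWord.1 hj)).2
      exact simpleTransposition_comm n (by omega)
    rw [decPerm_Ico_succ n (by omega), decPerm_Ico_succ n hi, mul_assoc, mul_assoc, hc.eq]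
    simp only [← mul_assoc]
    rw [simpleTransposition_braid (by omega) hn]
  | succ m hm' ih =>
    rw [decPerm_Ico_succ n (by omega : a ≤ m + 1), ← mul_assoc,
      (simpleTransposition_comm n (by omega : i + 1 < m + 1)).eq, mul_assoc,
      ih (by omega) (by omega), mul_assoc]

/-- The previous shift applied letter by letter; this is the group identity behind a single
lowering. -/
theorem decPerm_Ico_mul_Ico {n a m : ℕ} (ha : 1 ≤ a) (hm : a ≤ m) (hn : m < n) :
    decPerm n (Finset.Ico a m) * decPerm n (Finset.Ico a (m + 1)) =
      decPerm n (Finset.Ico a (m + 1)) * decPerm n (Finset.Ico (a + 1) (m + 1)) := by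
  have key : ∀ k, a ≤ k → k ≤ m → decPerm n (Finset.Ico a k) * decPerm n (Finset.Ico a (m + 1)) =
      decPerm n (Finset.Ico a (m + 1)) * decPerm n (Finset.Ico (a + 1) (k + 1)) := by
    intro k hk hkm
    induction k, hk using Nat.le_induction with
    | base => rw [decPerm_Ico_self, decPerm_Ico_self, one_mul, mul_one]
    | succ k hk ih =>
      rw [decPerm_Ico_succ n hk, decPerm_Ico_succ n (by omega : a + 1 ≤ k + 1), mul_assoc,
        ih (by omega), ← mul_assoc, simpleTransposition_mul_decPerm_Ico ha hk (by omega) hn,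
        mul_assoc]
  exact key m hm le_rfl

/-- After the shift the two letters s_m meet and cancel. This is the shortening that reducedness
forbids. -/
theorem decPerm_Ico_sq {n a m : ℕ} (ha : 1 ≤ a) (hm : a ≤ m) (hn : m < n) :
    decPerm n (Finset.Ico a (m + 1)) * decPerm n (Finset.Ico a (m + 1)) =
      decPerm n (Finset.Ico a m) * decPerm n (Finset.Ico (a + 1) (m + 1)) := by
  conv_lhs => rw [decPerm_Ico_succ n hm, mul_assoc, ← decPerm_Ico_succ n hm,
    decPerm_Ico_mul_Ico ha hm hn, ← mul_assoc, decPerm_Ico_succ n hm, ← mul_assoc,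
    simpleTransposition_mul_self, one_mul]

/-- A product of two decreasing elements with blocks in the middle. -/
theorem decPerm_mul_blocks (n : ℕ) {a m e₁ e₂ f₁ f₂ : ℕ} {U V S T : Finset ℕ} (ham : a ≤ m)
    (hU : ∀ x ∈ U, m < x) (hS : ∀ x ∈ S, m + 1 < x)
    (hV : ∀ x ∈ V, x + 1 < a) (hT : ∀ x ∈ T, x < a)
    (he : a ≤ e₁) (he' : e₂ ≤ m + 1) (hf : a ≤ f₁) (hf' : f₂ ≤ m + 1) :
    decPerm n (U ∪ (Finset.Ico e₁ e₂ ∪ V)) * decPerm n (S ∪ (Finset.Ico f₁ f₂ ∪ T)) =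
      decPerm n U * decPerm n S * (decPerm n (Finset.Ico e₁ e₂) * decPerm n (Finset.Ico f₁ f₂)) *
        (decPerm n V * decPerm n T) := by
  have c1 : Commute (decPerm n S) (decPerm n V) :=
    decPerm_comm n fun x hx y hy => by have := hS x hx; have := hV y hy; omega
  have c2 : Commute (decPerm n S) (decPerm n (Finset.Ico e₁ e₂)) :=
    decPerm_comm n fun x hx y hy => by have := hS x hx; have := Finset.mem_Ico.1 hy; omega
  have c3 : Commute (decPerm n (Finset.Ico f₁ f₂)) (decPerm n V) :=
    decPerm_comm n fun x hx y hy => by have := Finset.mem_Ico.1 hx; have := hV y hy; omega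
  rw [decPerm_union n (S := U), decPerm_union n (S := Finset.Ico e₁ e₂),
    decPerm_union n (S := S), decPerm_union n (S := Finset.Ico f₁ f₂)]
  · calc decPerm n U * (decPerm n (Finset.Ico e₁ e₂) * decPerm n V) *
          (decPerm n S * (decPerm n (Finset.Ico f₁ f₂) * decPerm n T))
        = decPerm n U * decPerm n (Finset.Ico e₁ e₂) * (decPerm n V * decPerm n S) *
          (decPerm n (Finset.Ico f₁ f₂) * decPerm n T) := by simp only [mul_assoc]
      _ = decPerm n U * (decPerm n (Finset.Ico e₁ e₂) * decPerm n S) *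
          (decPerm n V * decPerm n (Finset.Ico f₁ f₂)) * decPerm n T := by
            rw [← c1.eq]; simp only [mul_assoc]
      _ = _ := by rw [← c2.eq, ← c3.eq]; simp only [mul_assoc]
  · intro x hx y hy
    have := Finset.mem_Ico.1 hx; have := hT y hy; omega
  · intro x hx y hy
    have := hS x hx
    rcases Finset.mem_union.1 hy with h | h
    · have := Finset.mem_Ico.1 h; omega
    · have := hT y h; omega
  · intro x hx y hy
    have := Finset.mem_Ico.1 hx; have := hV y hy; omega
  · intro x hx y hy
    have := hU x hx
    rcases Finset.mem_union.1 hy with h | h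
    · have := Finset.mem_Ico.1 h; omega
    · have := hV y h; omega

theorem eq_union_blocks {S : Finset ℕ} {a e₁ e₂ m : ℕ} (h1 : ∀ c, m < c → c < a → c ∉ S)
    (h2 : ∀ c, a ≤ c → c ≤ m → (c ∈ S ↔ e₁ ≤ c ∧ c < e₂)) (he : a ≤ e₁) (he' : e₂ ≤ m + 1) :
    S = S.filter (m < ·) ∪ (Finset.Ico e₁ e₂ ∪ S.filter (· < a)) := by
  ext c
  simp only [Finset.mem_union, Finset.mem_filter, Finset.mem_Ico]
  have := h1 c
  have := h2 c
  constructor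
  · intro hc
    by_cases c1 : m < c
    · exact Or.inl ⟨hc, c1⟩
    · by_cases c2 : c < a
      · exact Or.inr (Or.inr ⟨hc, c2⟩)
      · exact Or.inr (Or.inl ((this (by omega) (by omega)).1 hc))
  · rintro (h | h | h)
    · exact h.1
    · exact (this (by omega) (by omega)).2 h
    · exact h.1

/-- Only the letters in `[a, m]` change. Those of `X` above and of `Y` below keep a gap from this
interval and commute past the middle, where `decPerm_Ico_mul_Ico` applies. -/
theorem FMove.decPerm_mul_eq {n : ℕ} {X Y X' Y' : Finset ℕ} {a m : ℕ} (h : FMove X Y X' Y' a m)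
    (hm : m ∉ Y) (hX : ∀ x ∈ X, 1 ≤ x ∧ x < n) :
    decPerm n Y' * decPerm n X' = decPerm n Y * decPerm n X := by
  have hle := h.le
  have hYb : ∀ c, a ≤ c → c < m → c ∈ Y := fun c h1 h2 => by
    simpa using (h.block (c + 1) (by omega) (by omega)).2
  have hYlt : ∀ x ∈ Y.filter (· < a), x + 1 < a := by
    intro x hx
    obtain ⟨hx1, hx2⟩ := Finset.mem_filter.1 hx
    have : x + 1 ≠ a := fun h' => h.pred_notMem x h' hx1
    omega
  have hXgt : ∀ x ∈ X.filter (m < ·), m + 1 < x := by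
    intro x hx
    obtain ⟨hx1, hx2⟩ := Finset.mem_filter.1 hx
    have : x ≠ m + 1 := fun h' => h.boundary (h' ▸ hx1)
    omega
  have eY : Y = Y.filter (m < ·) ∪ (Finset.Ico a m ∪ Y.filter (· < a)) :=
    eq_union_blocks (fun c h1 h2 => by omega) (fun c h1 h2 =>
      ⟨fun hc => ⟨h1, lt_of_le_of_ne h2 fun h' => hm (h' ▸ hc)⟩, fun hc => hYb c h1 hc.2⟩) le_rfl
      (by omega)
  have eX : X = X.filter (m < ·) ∪ (Finset.Ico a (m + 1) ∪ X.filter (· < a)) :=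
    eq_union_blocks (fun c h1 h2 => by omega) (fun c h1 h2 =>
      ⟨fun hc => ⟨h1, by omega⟩, fun hc => h.run c h1 h2⟩) le_rfl le_rfl
  have eY' : Y' = Y.filter (m < ·) ∪ (Finset.Ico a (m + 1) ∪ Y.filter (· < a)) := by
    rw [h.right_eq]
    conv_lhs => rw [eY]
    ext c
    simp only [Finset.mem_union, Finset.mem_insert, Finset.mem_Ico]
    have : a ≤ c ∧ c < m + 1 ↔ (a ≤ c ∧ c < m) ∨ c = m := by omega
    tauto
  have eX' : X' = X.filter (m < ·) ∪ (Finset.Ico (a + 1) (m + 1) ∪ X.filter (· < a)) := by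
    rw [h.left_eq]
    ext c
    simp only [Finset.mem_union, Finset.mem_erase, Finset.mem_Ico, Finset.mem_filter]
    have h1 := h.run c
    constructor
    · rintro ⟨h2, h3⟩
      by_cases c1 : m < c
      · exact Or.inl ⟨h3, c1⟩
      · by_cases c2 : c < a
        · exact Or.inr (Or.inr ⟨h3, c2⟩)
        · exact Or.inr (Or.inl ⟨by omega, by omega⟩)
    · rintro (h2 | h2 | h2)
      · exact ⟨by omega, h2.1⟩
      · exact ⟨by omega, h1 (by omega) (by omega)⟩
      · exact ⟨by omega, h2.1⟩
  have hU : ∀ x ∈ Y.filter (m < ·), m < x := fun x hx => (Finset.mem_filter.1 hx).2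
  have hT : ∀ x ∈ X.filter (· < a), x < a := fun x hx => (Finset.mem_filter.1 hx).2
  rw [eY', eX']
  conv_rhs => rw [eY, eX]
  have hmn := hX m (h.run m hle le_rfl)
  have han := hX a h.mem
  rw [decPerm_mul_blocks n hle hU hXgt hYlt hT le_rfl le_rfl (by omega) le_rfl,
    decPerm_mul_blocks n hle hU hXgt hYlt hT le_rfl (by omega) le_rfl le_rfl,
    decPerm_Ico_mul_Ico han.1 hle hmn.2]

/-- A common block with free ends can be isolated by commutations, and then `decPerm_Ico_sq` gives a
shorter word for the same element. -/
theorem noBlock_of_isRed {n : ℕ} {X Y : Finset ℕ} (h : IsRed n (decWord Y ++ decWord X)) :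
    NoBlock X Y := by
  intro a m hle hb
  by_contra hcon
  push Not at hcon
  obtain ⟨hm, ha⟩ := hcon
  have hYlt : ∀ x ∈ Y.filter (· < a), x + 1 < a := by
    intro x hx
    obtain ⟨hx1, hx2⟩ := Finset.mem_filter.1 hx
    have : x + 1 ≠ a := fun h' => ha x h' hx1
    omega
  have hXgt : ∀ x ∈ X.filter (m < ·), m + 1 < x := by
    intro x hx
    obtain ⟨hx1, hx2⟩ := Finset.mem_filter.1 hx
    have : x ≠ m + 1 := fun h' => hm (h' ▸ hx1)
    omega
  have hU : ∀ x ∈ Y.filter (m < ·), m < x := fun x hx => (Finset.mem_filter.1 hx).2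
  have hT : ∀ x ∈ X.filter (· < a), x < a := fun x hx => (Finset.mem_filter.1 hx).2
  have eY : Y = Y.filter (m < ·) ∪ (Finset.Ico a (m + 1) ∪ Y.filter (· < a)) :=
    eq_union_blocks (fun c h1 h2 => by omega) (fun c h1 h2 =>
      ⟨fun hc => ⟨h1, by omega⟩, fun hc => (hb c h1 h2).2⟩) le_rfl le_rfl
  have eX : X = X.filter (m < ·) ∪ (Finset.Ico a (m + 1) ∪ X.filter (· < a)) :=
    eq_union_blocks (fun c h1 h2 => by omega) (fun c h1 h2 =>
      ⟨fun hc => ⟨h1, by omega⟩, fun hc => (hb c h1 h2).1⟩) le_rfl le_rfl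
  have hr := h.1
  have hrX : ∀ x ∈ X, 1 ≤ x ∧ x < n := fun x hx =>
    hr x (List.mem_append_right _ (mem_decWord.2 hx))
  have hrY : ∀ x ∈ Y, 1 ≤ x ∧ x < n := fun x hx =>
    hr x (List.mem_append_left _ (mem_decWord.2 hx))
  have hmn := hrX m (hb m hle le_rfl).1
  have han := hrX a (hb a le_rfl hle).1
  set Y' := Y.filter (m < ·) ∪ (Finset.Ico a m ∪ Y.filter (· < a)) with hY'
  set X' := X.filter (m < ·) ∪ (Finset.Ico (a + 1) (m + 1) ∪ X.filter (· < a)) with hX'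
  have hX'sub : X' ⊆ X.erase a := by
    intro c hc
    simp only [hX', Finset.mem_union, Finset.mem_filter, Finset.mem_Ico] at hc
    rw [Finset.mem_erase]
    rcases hc with hc | hc | hc
    · exact ⟨by omega, hc.1⟩
    · exact ⟨by omega, (hb c (by omega) (by omega)).1⟩
    · exact ⟨by omega, hc.1⟩
  have hY'sub : Y' ⊆ Y := by
    intro c hc
    simp only [hY', Finset.mem_union, Finset.mem_filter, Finset.mem_Ico] at hc
    rcases hc with hc | hc | hc
    · exact hc.1
    · exact (hb c (by omega) (by omega)).2
    · exact hc.1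
  have hlt := h.2 (decWord Y' ++ decWord X') (inRange_append.2
    ⟨fun i hi => hrY i (hY'sub (mem_decWord.1 hi)),
      fun i hi => hrX i (Finset.mem_of_mem_erase (hX'sub (mem_decWord.1 hi)))⟩) (by
    rw [permOf_append, permOf_append]
    change decPerm n Y' * decPerm n X' = decPerm n Y * decPerm n X
    conv_rhs => rw [eY, eX]
    rw [decPerm_mul_blocks n hle hU hXgt hYlt hT le_rfl le_rfl le_rfl le_rfl,
      decPerm_mul_blocks n hle hU hXgt hYlt hT le_rfl (by omega) (by omega) le_rfl,
      decPerm_Ico_sq han.1 hle hmn.2])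
  have c1 := Finset.card_le_card hX'sub
  have c2 := Finset.card_le_card hY'sub
  have c3 := Finset.card_erase_add_one (hb a le_rfl hle).1
  rw [List.length_append, List.length_append, length_decWord, length_decWord, length_decWord,
    length_decWord] at hlt
  omega

/-! ### Reduced sequences of decreasing factors -/

/-- The word of a sequence of decreasing factors, in which the first factor is the rightmost. -/
def seqWord (l : List (Finset ℕ)) : List ℕ := l.reverse.flatMap decWord

/-- The sequence of decreasing factors is reduced. -/
def RedSeq (n : ℕ) (l : List (Finset ℕ)) : Prop := IsRed n (seqWord l)

theorem seqWord_append (l₁ l₂ : List (Finset ℕ)) :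
    seqWord (l₁ ++ l₂) = seqWord l₂ ++ seqWord l₁ := by
  simp [seqWord]

theorem seqWord_pair (X Y : Finset ℕ) : seqWord [X, Y] = decWord Y ++ decWord X := by
  simp [seqWord]

theorem RedSeq.segment {n : ℕ} {l₁ l l₂ : List (Finset ℕ)} (h : RedSeq n (l₁ ++ l ++ l₂)) :
    RedSeq n l := by
  rw [RedSeq, seqWord_append, seqWord_append, ← List.append_assoc] at h
  exact IsRed.segment h

theorem RedSeq.noBlock {n : ℕ} {X Y : Finset ℕ} (h : RedSeq n [X, Y]) : NoBlock X Y := by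
  rw [RedSeq, seqWord_pair] at h
  exact noBlock_of_isRed h

theorem RedSeq.mem {n : ℕ} {l : List (Finset ℕ)} (h : RedSeq n l) {X : Finset ℕ} (hX : X ∈ l)
    {x : ℕ} (hx : x ∈ X) : 1 ≤ x ∧ x < n :=
  h.1 x (List.mem_flatMap.2 ⟨X, List.mem_reverse.2 hX, mem_decWord.2 hx⟩)

/-- Two adjacent factors are replaced by two other factors of the same product and total size. -/
theorem RedSeq.replace_pair {n : ℕ} {l₁ l₂ : List (Finset ℕ)} {X Y X' Y' : Finset ℕ}
    (h : RedSeq n (l₁ ++ [X, Y] ++ l₂)) (hX : ∀ x ∈ X', 1 ≤ x ∧ x < n)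
    (hY : ∀ x ∈ Y', 1 ≤ x ∧ x < n) (hc : X'.card + Y'.card = X.card + Y.card)
    (hp : decPerm n Y' * decPerm n X' = decPerm n Y * decPerm n X) :
    RedSeq n (l₁ ++ [X', Y'] ++ l₂) ∧
      permOf n (seqWord (l₁ ++ [X', Y'] ++ l₂)) = permOf n (seqWord (l₁ ++ [X, Y] ++ l₂)) := by
  have e : ∀ X Y : Finset ℕ, seqWord (l₁ ++ [X, Y] ++ l₂) =
      seqWord l₂ ++ (decWord Y ++ decWord X) ++ seqWord l₁ := fun X Y => by
    simp only [seqWord_append, seqWord_pair, List.append_assoc]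
  rw [RedSeq, e] at h
  rw [RedSeq, e, e]
  refine ⟨h.replace ?_ ?_ ?_, ?_⟩
  · exact inRange_append.2
      ⟨fun i hi => hY i (mem_decWord.1 hi), fun i hi => hX i (mem_decWord.1 hi)⟩
  · rw [permOf_append, permOf_append]; exact hp
  · simp only [List.length_append, length_decWord]; omega
  · simp only [permOf_append]
    change _ * (decPerm n Y' * decPerm n X') * _ = _ * (decPerm n Y * decPerm n X) * _
    rw [hp]

theorem RedSeq.fMove {n : ℕ} {l₁ l₂ : List (Finset ℕ)} {X Y X' Y' : Finset ℕ} {a m : ℕ}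
    (h : RedSeq n (l₁ ++ [X, Y] ++ l₂)) (hF : FMove X Y X' Y' a m) :
    RedSeq n (l₁ ++ [X', Y'] ++ l₂) ∧
      permOf n (seqWord (l₁ ++ [X', Y'] ++ l₂)) = permOf n (seqWord (l₁ ++ [X, Y] ++ l₂)) := by
  have hN : NoBlock X Y := h.segment.noBlock
  have hX : ∀ x ∈ X, 1 ≤ x ∧ x < n := fun x hx => h.segment.mem (by simp) hx
  have hY : ∀ x ∈ Y, 1 ≤ x ∧ x < n := fun x hx => h.segment.mem (by simp) hx
  refine h.replace_pair ?_ ?_ ?_ (hF.decPerm_mul_eq (hF.notMem hN) hX)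
  · rw [hF.left_eq]; exact fun x hx => hX x (Finset.mem_of_mem_erase hx)
  · rw [hF.right_eq]
    intro x hx
    rcases Finset.mem_insert.1 hx with rfl | hx
    · exact hX _ (hF.run _ hF.le le_rfl)
    · exact hY x hx
  · have := hF.card_left
    have := hF.card_right hN
    omega

theorem RedSeq.eMove {n : ℕ} {l₁ l₂ : List (Finset ℕ)} {X Y X' Y' : Finset ℕ} {a b : ℕ}
    (h : RedSeq n (l₁ ++ [X, Y] ++ l₂)) (hE : EMove X Y X' Y' a b) :
    RedSeq n (l₁ ++ [X', Y'] ++ l₂) ∧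
      permOf n (seqWord (l₁ ++ [X', Y'] ++ l₂)) = permOf n (seqWord (l₁ ++ [X, Y] ++ l₂)) := by
  have hN : NoBlock X Y := h.segment.noBlock
  have hX : ∀ x ∈ X, 1 ≤ x ∧ x < n := fun x hx => h.segment.mem (by simp) hx
  have hY : ∀ x ∈ Y, 1 ≤ x ∧ x < n := fun x hx => h.segment.mem (by simp) hx
  have hX' : ∀ x ∈ X', 1 ≤ x ∧ x < n := by
    rw [hE.left_eq]
    intro x hx
    rcases Finset.mem_insert.1 hx with rfl | hx
    · exact hY _ (hE.run _ le_rfl hE.le)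
    · exact hX x hx
  have hF := hE.fMove hN
  refine h.replace_pair hX' ?_ ?_ (hF.decPerm_mul_eq ?_ hX').symm
  · rw [hE.right_eq]; exact fun x hx => hY x (Finset.mem_of_mem_erase hx)
  · rw [hE.left_eq, hE.right_eq, Finset.card_insert_of_notMem (hE.notMem hN)]
    have := Finset.card_erase_add_one hE.mem
    omega
  · rw [hE.right_eq]; simp

theorem RedSeq.low {n : ℕ} {l₁ l₂ : List (Finset ℕ)} {X Y : Finset ℕ}
    (h : RedSeq n (l₁ ++ [X, Y] ++ l₂)) : RedSeq n (l₁ ++ [lowX X Y, lowY X Y] ++ l₂) := by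
  obtain ⟨k, hk⟩ : ∃ k, k = X.card := ⟨_, rfl⟩
  induction k using Nat.strong_induction_on generalizing X Y with
  | _ k ih =>
    by_cases h0 : ∀ x ∈ X, carrier X Y x ≠ 0
    · rwa [(low_eq_self h0).1, (low_eq_self h0).2]
    · push Not at h0
      obtain ⟨a, m, X', Y', hF⟩ := exists_fMove h0
      have hN : NoBlock X Y := h.segment.noBlock
      have := ih X'.card (by have := hF.card_left; omega) (h.fMove hF).1 rfl
      rwa [hF.lowX_eq hN, hF.lowY_eq hN] at this

/-! ### Reduced pairs and triples -/

theorem RedSeq.card_low {n : ℕ} {X Y : Finset ℕ} (h : RedSeq n [X, Y]) :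
    (lowX X Y).card + (lowY X Y).card = X.card + Y.card :=
  StanleyCrystal.card_low h.noBlock

theorem RedSeq.card_lowY {n : ℕ} {X Y : Finset ℕ} (h : RedSeq n [X, Y]) :
    (lowY X Y).card = X.card + eps X Y := by
  have := h.card_low
  have := eps_add_card X Y
  omega

/-- A pair is recovered from the end of its string and its distance from that end, since each
lowering is undone by the raising operator. The size of the first set measures the distance. -/
theorem RedSeq.eq_of_low_eq {n : ℕ} {X Y X₂ Y₂ : Finset ℕ} (h : RedSeq n [X, Y])
    (h₂ : RedSeq n [X₂, Y₂]) (hX : lowX X Y = lowX X₂ Y₂) (hY : lowY X Y = lowY X₂ Y₂)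
    (hc : X.card = X₂.card) : X = X₂ ∧ Y = Y₂ := by
  obtain ⟨k, hk⟩ : ∃ k, k = X.card := ⟨_, rfl⟩
  induction k using Nat.strong_induction_on generalizing X Y X₂ Y₂ with
  | _ k ih =>
    by_cases h0 : ∀ x ∈ X, carrier X Y x ≠ 0
    · have h0' : ∀ x ∈ X₂, carrier X₂ Y₂ x ≠ 0 := by
        rw [forall_carrier_ne_zero_iff] at h0 ⊢
        rw [← hX, h0, hc]
      rw [(low_eq_self h0).1, (low_eq_self h0').1] at hX
      rw [(low_eq_self h0).2, (low_eq_self h0').2] at hY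
      exact ⟨hX, hY⟩
    · have h0' : ¬∀ x ∈ X₂, carrier X₂ Y₂ x ≠ 0 := by
        rw [forall_carrier_ne_zero_iff] at h0 ⊢
        rwa [← hX, ← hc]
      push Not at h0 h0'
      obtain ⟨a, m, X', Y', hF⟩ := exists_fMove h0
      obtain ⟨a₂, m₂, X₂', Y₂', hF₂⟩ := exists_fMove h0'
      have c1 := hF.card_left
      have c2 := hF₂.card_left
      obtain ⟨rfl, rfl⟩ := ih X'.card (by omega)
        (RedSeq.fMove (l₁ := []) (l₂ := []) h hF).1 (RedSeq.fMove (l₁ := []) (l₂ := []) h₂ hF₂).1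
        (by rw [hF.lowX_eq h.noBlock, hF₂.lowX_eq h₂.noBlock, hX])
        (by rw [hF.lowY_eq h.noBlock, hF₂.lowY_eq h₂.noBlock, hY]) (by omega) rfl
      obtain ⟨-, -, e1, e2⟩ := (hF.eMove h.noBlock).unique (hF₂.eMove h₂.noBlock)
      exact ⟨e1, e2⟩

theorem RedSeq.fMove_of_low_eq {n : ℕ} {X Y X₂ Y₂ : Finset ℕ} (h : RedSeq n [X, Y])
    (h₂ : RedSeq n [X₂, Y₂]) (hX : lowX X Y = lowX X₂ Y₂) (hY : lowY X Y = lowY X₂ Y₂)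
    (hc : X.card = X₂.card + 1) : ∃ a m, FMove X Y X₂ Y₂ a m := by
  have h0 : ¬∀ x ∈ X, carrier X Y x ≠ 0 := by
    rw [forall_carrier_ne_zero_iff, hX]
    have := lowX_card_le X₂ Y₂
    omega
  push Not at h0
  obtain ⟨a, m, X', Y', hF⟩ := exists_fMove h0
  have c1 := hF.card_left
  obtain ⟨rfl, rfl⟩ := RedSeq.eq_of_low_eq (RedSeq.fMove (l₁ := []) (l₂ := []) h hF).1 h₂
    (by rw [hF.lowX_eq h.noBlock, hX]) (by rw [hF.lowY_eq h.noBlock, hY]) (by omega)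
  exact ⟨a, m, hF⟩

/-! ### Consequences of the braid relation for reduced triples. -/

section Triple
variable {n : ℕ} {R A B : Finset ℕ}

theorem RedSeq.left_pair (h : RedSeq n [R, A, B]) : RedSeq n [R, A] :=
  RedSeq.segment (l₁ := []) (l₂ := [B]) h

theorem RedSeq.right_pair (h : RedSeq n [R, A, B]) : RedSeq n [A, B] :=
  RedSeq.segment (l₁ := [R]) (l₂ := []) h

theorem RedSeq.low_left (h : RedSeq n [R, A, B]) : RedSeq n [lowX R A, lowY R A, B] :=
  RedSeq.low (l₁ := []) (l₂ := [B]) h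

theorem RedSeq.low_right (h : RedSeq n [R, A, B]) : RedSeq n [R, lowX A B, lowY A B] :=
  RedSeq.low (l₁ := [R]) (l₂ := []) h

/-- Maximal lowerings keep a sequence reduced, so each pair on either side of the braid relation is
adjacent in some reduced triple. -/
theorem RedSeq.braidPairs (h : RedSeq n [R, A, B]) : BraidPairs R A B where
  h₁ := h.left_pair.noBlock
  h₂ := h.low_left.right_pair.noBlock
  h₄ := h.low_left.low_right.left_pair.noBlock
  h₃ := h.right_pair.noBlock
  h₅ := h.low_right.left_pair.noBlock
  h₆ := h.low_right.low_left.right_pair.noBlock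

/-- Lowering `(A, B)` does not change its maximal lowering, hence not the right side of the braid
relation, hence not the left. So the bumped pair stays on its string. As `eps A B` grows by one,
`eps_eq` and the cardinalities decide between two outcomes: the bumped pair is unchanged and the row
loses a letter, or the bumped pair is lowered once. -/
theorem RedSeq.insert_fMove (h : RedSeq n [R, A, B]) {A₂ B₂ : Finset ℕ} {a m : ℕ}
    (hF : FMove A B A₂ B₂ a m) :
    lowY (lowY R A₂) B₂ = lowY (lowY R A) B ∧
    ((eps (lowX R A) (lowX (lowY R A) B) < eps R A ∧ lowX R A₂ = lowX R A ∧
        lowX (lowY R A₂) B₂ = lowX (lowY R A) B ∧ (lowY R A₂).card + 1 = (lowY R A).card) ∨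
      (eps R A ≤ eps (lowX R A) (lowX (lowY R A) B) ∧
        (∃ a' m', FMove (lowX R A) (lowX (lowY R A) B) (lowX R A₂) (lowX (lowY R A₂) B₂) a' m') ∧
        (lowY R A₂).card = (lowY R A).card)) := by
  have h₂ : RedSeq n [R, A₂, B₂] := (RedSeq.fMove (l₁ := [R]) (l₂ := []) h hF).1
  have hb := h.braidPairs
  have hb₂ := h₂.braidPairs
  have eX := hF.lowX_eq h.right_pair.noBlock
  have eY := hF.lowY_eq h.right_pair.noBlock
  obtain ⟨b1, b2, b3⟩ := hb.low_eq
  obtain ⟨b1', b2', b3'⟩ := hb₂.low_eq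
  rw [eX] at b1' b2' b3'
  rw [eY] at b2' b3'
  have p := h.low_left.low_right.left_pair
  have p₂ := h₂.low_left.low_right.left_pair
  -- The bumped pairs before and after the lowering have the same end of string.
  have q1 := b1.trans b1'.symm
  have q2 := b2.trans b2'.symm
  have e1 := hb.eps_eq
  have e2 := hb₂.eps_eq
  have c1 := hF.card_left
  have c2 := hF.card_right h.right_pair.noBlock
  have s1 := eps_add_card A B
  have s2 := eps_add_card A₂ B₂
  rw [eX] at s2
  have s3 := eps_add_card R A
  have s4 := eps_add_card R A₂
  have s5 := eps_add_card (lowY R A) B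
  have s6 := eps_add_card (lowY R A₂) B₂
  have s7 := eps_add_card (lowX R A) (lowX (lowY R A) B)
  have s8 := eps_add_card (lowX R A₂) (lowX (lowY R A₂) B₂)
  have t1 := p.card_low
  have t2 := p₂.card_low
  have t3 := h.left_pair.card_low
  have t4 := h₂.left_pair.card_low
  rw [← q1] at s8 t2
  rw [← q2] at t2
  refine ⟨b3'.trans b3.symm, ?_⟩
  by_cases hlt : eps (lowX R A) (lowX (lowY R A) B) < eps R A
  · left
    obtain ⟨r1, r2⟩ := p.eq_of_low_eq p₂ q1 q2 (by omega)
    exact ⟨hlt, r1.symm, r2.symm, by omega⟩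
  · right
    exact ⟨by omega, p.fMove_of_low_eq p₂ q1 q2 (by omega), by omega⟩

/-- If the letters of the upper row `R` are bracketed with letters of the lower row `A`, then this
stays so when the factor `B` is inserted into both rows; and the shapes interlace. -/
theorem RedSeq.insert_rows (h : RedSeq n [R, A, B]) (h0 : ∀ x ∈ R, carrier R A x ≠ 0) :
    (∀ x ∈ lowY R (lowX A B),
      carrier (lowY R (lowX A B)) (lowY A B) x ≠ 0) ∧
    (lowY R (lowX A B)).card ≤ A.card := by
  have hb := h.braidPairs
  obtain ⟨eX, eY⟩ := low_eq_self h0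
  have b2 := hb.low_eq.2.1
  have e1 := hb.eps_eq
  -- Since `(R, A)` is already at the end of its string, the first F₁ in F₁F₂F₁ is trivial.
  -- Comparison with F₂F₁F₂ shows that the last F₂, which acts on the two new rows, is trivial too;
  -- and in `eps_eq` the truncated difference vanishes.
  rw [eX, eY] at b2 e1
  constructor
  · rw [forall_carrier_ne_zero_iff, ← b2]
  · have s1 := eps_add_card R A
    rw [eX] at s1
    have := h.low_right.left_pair.card_lowY
    omega

end Triple

/-! ### Insertion of a sequence of factors, row by row -/

/-- The first row after the insertion of `k` factors. -/
def rowSet (v : Factors) : ℕ → Finset ℕ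
  | 0 => ∅
  | k + 1 => lowY (rowSet v k) (v (k + 1))

/-- The factors that are inserted into the next row. -/
def bumped (v : Factors) : Factors
  | 0 => ∅
  | k + 1 => lowX (rowSet v k) (v (k + 1))

/-- The list of the first `k` factors. -/
def facList (v : Factors) (k : ℕ) : List (Finset ℕ) := (List.range k).map fun j => v (j + 1)

/-- A reduced sequence of `ℓ` factors. -/
structure FacSeq (n ℓ : ℕ) (v : Factors) : Prop where
  supp : ∀ k, ¬(1 ≤ k ∧ k ≤ ℓ) → v k = ∅
  red : RedSeq n (facList v ℓ)

theorem factorizationWord_eq (ℓ : ℕ) (v : Factors) :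
    factorizationWord ℓ v = seqWord (facList v ℓ) := by
  rw [factorizationWord, seqWord, facList, ← List.map_reverse, List.flatMap_map]
  rfl

theorem mem_decreasingFactorizations_iff {n ℓ : ℕ} {w : Equiv.Perm (Fin n)} {v : Factors} :
    v ∈ decreasingFactorizations n w ℓ ↔
      FacSeq n ℓ v ∧ permOf n (seqWord (facList v ℓ)) = w := by
  rw [decreasingFactorizations, Set.mem_ofPred_eq, factorizationWord_eq, mem_reducedWords_iff]
  exact ⟨fun h => ⟨⟨h.1, h.2.1⟩, h.2.2⟩, fun h => ⟨h.1.1, h.1.2, h.2⟩⟩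

theorem facList_succ (v : Factors) (k : ℕ) : facList v (k + 1) = facList v k ++ [v (k + 1)] := by
  simp [facList, List.range_succ]

theorem facList_congr {v v' : Factors} {k : ℕ} (h : ∀ j, 1 ≤ j → j ≤ k → v j = v' j) :
    facList v k = facList v' k := by
  refine List.map_congr_left fun j hj => h _ (by omega) ?_
  have := List.mem_range.1 hj
  omega

theorem facList_add (v : Factors) (j k : ℕ) :
    facList v (j + k) = facList v j ++ (List.range k).map fun t => v (j + t + 1) := by
  induction k with
  | zero => simp
  | succ k ih => rw [← add_assoc, facList_succ, ih, List.range_succ]; simp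

/-- The row stands as an additional factor between the bumped factors and those still to be
inserted. Inserting the next factor is a maximal lowering of an adjacent pair, so reducedness
persists. -/
theorem RedSeq.insert_factors {n k : ℕ} {v : Factors} {t : List (Finset ℕ)}
    (h : RedSeq n (facList v k ++ t)) :
    RedSeq n (facList (bumped v) k ++ [rowSet v k] ++ t) := by
  induction k generalizing t with
  | zero =>
    have e : seqWord (facList (bumped v) 0 ++ [rowSet v 0] ++ t) = seqWord (facList v 0 ++ t) := by
      simp [seqWord, facList, rowSet, decWord_empty]
    rwa [RedSeq, e]
  | succ k ih =>
    rw [facList_succ, List.append_assoc] at h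
    have := ih h
    rw [List.append_assoc, ← List.append_assoc [rowSet v k]] at this
    rw [facList_succ]
    have := RedSeq.low (l₁ := facList (bumped v) k) (X := rowSet v k) (Y := v (k + 1)) (l₂ := t)
      (by simpa using this)
    simpa [bumped, rowSet] using this

theorem carrier_empty_right (X : Finset ℕ) (c : ℕ) : carrier X ∅ c = 0 := by
  induction c with
  | zero => rfl
  | succ c ih => rw [carrier_succ, ih]; simp

theorem lowX_empty_right (X : Finset ℕ) : lowX X ∅ = ∅ := by
  ext c; simp [mem_lowX, carrier_empty_right]

theorem lowX_empty_left (Y : Finset ℕ) : lowX ∅ Y = ∅ := by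
  ext c; simp [mem_lowX]

theorem lowY_empty_right (X : Finset ℕ) : lowY X ∅ = X := by
  ext c; simp [mem_lowY, carrier_empty_right]

theorem eps_empty_right (X : Finset ℕ) : eps X ∅ = 0 := carrier_empty_right _ _

/-! ### Rows arising from a reduced sequence of factors. -/

namespace FacSeq
variable {n ℓ : ℕ} {v : Factors}

theorem next (h : FacSeq n ℓ v) : FacSeq n ℓ (bumped v) := by
  constructor
  · intro k hk
    cases k with
    | zero => rfl
    | succ k =>
      rw [bumped, h.supp _ hk, lowX_empty_right]
  · have h1 : RedSeq n (facList v ℓ ++ []) := by simpa using h.red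
    have := h1.insert_factors
    rw [List.append_assoc] at this
    exact RedSeq.segment (l₁ := []) this

theorem bumped_iterate (h : FacSeq n ℓ v) (r : ℕ) : FacSeq n ℓ (bumped^[r] v) := by
  induction r with
  | zero => exact h
  | succ r ih => rw [Function.iterate_succ_apply']; exact ih.next

/-- The sequences that are reduced because they arise in the insertion process. -/
theorem red_initial (h : FacSeq n ℓ v) {k : ℕ} (hk : k < ℓ) :
    ∃ t, RedSeq n (facList v k ++ v (k + 1) :: t) ∧ (k + 1 < ℓ → ∃ t', t = v (k + 2) :: t') := by
  obtain ⟨d, rfl⟩ : ∃ d, ℓ = k + (d + 1) := ⟨ℓ - k - 1, by omega⟩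
  have h1 := h.red
  rw [facList_add, List.range_succ_eq_map] at h1
  refine ⟨_, h1, fun hd => ?_⟩
  obtain ⟨e, rfl⟩ : ∃ e, d = e + 1 := ⟨d - 1, by omega⟩
  rw [List.range_succ_eq_map]
  exact ⟨_, rfl⟩

theorem red_pair (h : FacSeq n ℓ v) (k : ℕ) (hk : k < ℓ) : RedSeq n [rowSet v k, v (k + 1)] := by
  obtain ⟨t, h1, -⟩ := h.red_initial hk
  have h2 := h1.insert_factors
  exact RedSeq.segment (l₁ := facList (bumped v) k) (l₂ := t) (by simpa using h2)

theorem red_triple (h : FacSeq n ℓ v) {k : ℕ} (hk : k + 1 < ℓ) :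
    RedSeq n [rowSet v k, v (k + 1), v (k + 2)] := by
  obtain ⟨t, h1, h2⟩ := h.red_initial (k := k) (by omega)
  obtain ⟨t', rfl⟩ := h2 hk
  have h3 := h1.insert_factors
  exact RedSeq.segment (l₁ := facList (bumped v) k) (l₂ := t') (by simpa using h3)

theorem red_rows (h : FacSeq n ℓ v) {k : ℕ} (hk : k < ℓ) :
    RedSeq n [rowSet (bumped v) k, rowSet v k, v (k + 1)] := by
  obtain ⟨t, h1, -⟩ := h.red_initial hk
  have h2 := h1.insert_factors
  rw [List.append_assoc] at h2
  have h3 := h2.insert_factors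
  exact RedSeq.segment (l₁ := facList (bumped (bumped v)) k) (l₂ := t)
    (by simpa using h3)

theorem eq_empty_of_le (h : FacSeq n ℓ v) {k : ℕ} (hk : ℓ ≤ k) : v (k + 1) = ∅ :=
  h.supp _ (by omega)

theorem rowSet_succ_of_le (h : FacSeq n ℓ v) {k : ℕ} (hk : ℓ ≤ k) :
    rowSet v (k + 1) = rowSet v k := by
  rw [rowSet, h.eq_empty_of_le hk, lowY_empty_right]

theorem card_rowSet_succ (h : FacSeq n ℓ v) (k : ℕ) :
    (rowSet v (k + 1)).card = (rowSet v k).card + eps (rowSet v k) (v (k + 1)) := by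
  rcases lt_or_ge k ℓ with hk | hk
  · exact (h.red_pair k hk).card_lowY
  · rw [h.rowSet_succ_of_le hk, h.eq_empty_of_le hk, eps_empty_right, add_zero]

theorem card_eq (h : FacSeq n ℓ v) (k : ℕ) :
    (v (k + 1)).card + (rowSet v k).card =
      (bumped v (k + 1)).card + (rowSet v (k + 1)).card := by
  rw [h.card_rowSet_succ k]
  have := eps_add_card (rowSet v k) (v (k + 1))
  rw [bumped]
  omega

/-- Column strictness of the insertion tableau in a form stable under insertion: the pair of
consecutive rows is at the end of its string, and `RedSeq.insert_rows` preserves this. -/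
theorem column_strict (h : FacSeq n ℓ v) (k : ℕ) :
    ∀ x ∈ rowSet (bumped v) k,
      carrier (rowSet (bumped v) k) (rowSet v k) x ≠ 0 := by
  induction k with
  | zero => simp [rowSet]
  | succ k ih =>
    rcases lt_or_ge k ℓ with hk | hk
    · exact ((h.red_rows hk).insert_rows ih).1
    · rwa [h.rowSet_succ_of_le hk, h.next.rowSet_succ_of_le hk]

/-- This is the interlacing of consecutive shapes: no factor creates two cells in one column of the
recording tableau. -/
theorem card_rowSet_bumped_le (h : FacSeq n ℓ v) (k : ℕ) :
    (rowSet (bumped v) (k + 1)).card ≤ (rowSet v k).card := by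
  rcases lt_or_ge k ℓ with hk | hk
  · exact ((h.red_rows hk).insert_rows (h.column_strict k)).2
  · rw [h.next.rowSet_succ_of_le hk]
    have h1 := h.column_strict k
    rw [forall_carrier_ne_zero_iff] at h1
    have := eps_add_card (rowSet (bumped v) k) (rowSet v k)
    omega

end FacSeq

theorem rowSet_eq_empty {v : Factors} {r k : ℕ} (h : ∀ j ≤ r, v j = ∅) (hk : k ≤ r) :
    rowSet v k = ∅ := by
  induction k with
  | zero => rfl
  | succ k ih => rw [rowSet, h _ hk, ih (by omega), lowY_empty_right]

/-- A factor bumps nothing out of an empty row, so each further row is reached at least one factor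
later. Inductions down the rows stop for this reason. -/
theorem bumped_iterate_eq_empty {v : Factors} (h0 : v 0 = ∅) (r : ℕ) :
    ∀ k ≤ r, bumped^[r] v k = ∅ := by
  induction r with
  | zero => intro k hk; rw [Nat.le_zero.1 hk]; exact h0
  | succ r ih =>
    intro k hk
    rw [Function.iterate_succ_apply']
    cases k with
    | zero => rfl
    | succ k => rw [bumped, rowSet_eq_empty ih (by omega), lowX_empty_left]

/-- The number of letters in row `r` after the insertion of `k` factors. -/
def rowCard (v : Factors) (r k : ℕ) : ℕ := (rowSet (bumped^[r] v) k).card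

theorem rowCard_bumped (v : Factors) (r k : ℕ) : rowCard (bumped v) r k = rowCard v (r + 1) k := by
  rw [rowCard, rowCard, Function.iterate_succ_apply]

/-- `v'` arises from `v` by the `i`-th lowering operator. -/
def FStep (i : ℕ) (v v' : Factors) : Prop :=
  (∃ a m, FMove (v i) (v (i + 1)) (v' i) (v' (i + 1)) a m) ∧
    ∀ k, k ≠ i → k ≠ i + 1 → v' k = v k

theorem facList_split (v : Factors) {i ℓ : ℕ} (h1 : 1 ≤ i) (h2 : i < ℓ) :
    facList v ℓ = facList v (i - 1) ++ [v i, v (i + 1)] ++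
      (List.range (ℓ - i - 1)).map fun t => v (i + 1 + t + 1) := by
  obtain ⟨j, rfl⟩ : ∃ j, i = j + 1 := ⟨i - 1, by omega⟩
  obtain ⟨d, rfl⟩ : ∃ d, ℓ = j + 2 + d := ⟨ℓ - j - 2, by omega⟩
  rw [facList_add, facList_succ, facList_succ]
  simp only [Nat.add_sub_cancel, List.append_assoc, List.cons_append, List.nil_append]
  rw [show j + 2 + d - (j + 1) - 1 = d by omega]

theorem facList_split_congr {v v' : Factors} {i ℓ : ℕ} (h1 : 1 ≤ i) (h2 : i < ℓ)
    (h : ∀ k, k ≠ i → k ≠ i + 1 → v' k = v k) :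
    facList v' ℓ = facList v (i - 1) ++ [v' i, v' (i + 1)] ++
      (List.range (ℓ - i - 1)).map fun t => v (i + 1 + t + 1) := by
  rw [facList_split v' h1 h2, facList_congr (v' := v) fun j _ hj' => h j (by omega) (by omega)]
  congr 1
  exact List.map_congr_left fun t _ => h _ (by omega) (by omega)

theorem FacSeq.fStep {n ℓ i : ℕ} {v v' : Factors} (h : FacSeq n ℓ v) (h1 : 1 ≤ i) (h2 : i < ℓ)
    (hF : FStep i v v') :
    FacSeq n ℓ v' ∧ permOf n (seqWord (facList v' ℓ)) = permOf n (seqWord (facList v ℓ)) := by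
  obtain ⟨⟨a, m, hF⟩, hk⟩ := hF
  have hr := h.red
  rw [facList_split v h1 h2] at hr ⊢
  rw [facList_split_congr h1 h2 hk]
  have := hr.fMove hF
  refine ⟨⟨fun k hk' => ?_, ?_⟩, this.2⟩
  · rw [hk k (by omega) (by omega)]; exact h.supp k hk'
  · rw [facList_split_congr h1 h2 hk]; exact this.1

theorem FacSeq.eStep {n ℓ i : ℕ} {v v' : Factors} (h : FacSeq n ℓ v) (h1 : 1 ≤ i) (h2 : i < ℓ)
    {a b : ℕ} (hE : EMove (v i) (v (i + 1)) (v' i) (v' (i + 1)) a b)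
    (hk : ∀ k, k ≠ i → k ≠ i + 1 → v' k = v k) :
    FacSeq n ℓ v' ∧ permOf n (seqWord (facList v' ℓ)) = permOf n (seqWord (facList v ℓ)) := by
  have hr := h.red
  rw [facList_split v h1 h2] at hr ⊢
  rw [facList_split_congr h1 h2 hk]
  have := hr.eMove hE
  refine ⟨⟨fun k hk' => ?_, ?_⟩, this.2⟩
  · rw [hk k (by omega) (by omega)]; exact h.supp k hk'
  · rw [facList_split_congr h1 h2 hk]; exact this.1

theorem FacSeq.noBlock {n ℓ i : ℕ} {v : Factors} (h : FacSeq n ℓ v) (h1 : 1 ≤ i) (h2 : i < ℓ) :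
    NoBlock (v i) (v (i + 1)) := by
  have hr := h.red
  rw [facList_split v h1 h2] at hr
  exact hr.segment.noBlock

theorem rowSet_congr {v v' : Factors} {k : ℕ} (h : ∀ j, 1 ≤ j → j ≤ k → v' j = v j) :
    rowSet v' k = rowSet v k := by
  induction k with
  | zero => rfl
  | succ k ih =>
    rw [rowSet, rowSet, ih fun j hj hj' => h j hj (by omega), h (k + 1) (by omega) le_rfl]

/-- The effect of a lowering operator on the insertion into the first row. -/
theorem FacSeq.fStep_row {n ℓ i : ℕ} {v v' : Factors} (h : FacSeq n ℓ v) (h1 : 1 ≤ i) (h2 : i < ℓ)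
    (hF : FStep i v v') :
    (eps (bumped v i) (bumped v (i + 1)) < eps (rowSet v (i - 1)) (v i) ∧ bumped v' = bumped v ∧
      (rowSet v' i).card + 1 = (rowSet v i).card ∧
      ∀ k, k ≠ i → (rowSet v' k).card = (rowSet v k).card) ∨
    (eps (rowSet v (i - 1)) (v i) ≤ eps (bumped v i) (bumped v (i + 1)) ∧
      FStep i (bumped v) (bumped v') ∧ ∀ k, (rowSet v' k).card = (rowSet v k).card) := by
  obtain ⟨j, rfl⟩ : ∃ j, i = j + 1 := ⟨i - 1, by omega⟩
  obtain ⟨⟨a, m, hF⟩, hk⟩ := hF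
  simp only [Nat.add_sub_cancel]
  have hlow : ∀ k ≤ j, rowSet v' k = rowSet v k := fun k hkj =>
    rowSet_congr fun t _ ht' => hk t (by omega) (by omega)
  have key := (h.red_triple (k := j) h2).insert_fMove hF
  have e0 := hlow j le_rfl
  have r1 : rowSet v (j + 1) = lowY (rowSet v j) (v (j + 1)) := rfl
  have r1' : rowSet v' (j + 1) = lowY (rowSet v j) (v' (j + 1)) := by rw [rowSet, e0]
  have b1 : bumped v (j + 1) = lowX (rowSet v j) (v (j + 1)) := rfl
  have b1' : bumped v' (j + 1) = lowX (rowSet v j) (v' (j + 1)) := by rw [bumped, e0]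
  have b2 : bumped v (j + 1 + 1) = lowX (rowSet v (j + 1)) (v (j + 1 + 1)) := rfl
  have b2' : bumped v' (j + 1 + 1) = lowX (rowSet v' (j + 1)) (v' (j + 1 + 1)) := rfl
  have r2 : rowSet v (j + 1 + 1) = lowY (rowSet v (j + 1)) (v (j + 1 + 1)) := rfl
  have r2' : rowSet v' (j + 1 + 1) = lowY (rowSet v' (j + 1)) (v' (j + 1 + 1)) := rfl
  rw [show j + 2 = j + 1 + 1 from rfl, ← r1, ← r1', ← b1, ← b1', ← b2, ← b2', ← r2, ← r2'] at key
  obtain ⟨k1, k2⟩ := key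
  have hhigh : ∀ d, rowSet v' (j + 1 + 1 + d) = rowSet v (j + 1 + 1 + d) := by
    intro d
    induction d with
    | zero => exact k1
    | succ d ih =>
      rw [← add_assoc, rowSet, rowSet, ih, hk (j + 1 + 1 + d + 1) (by omega) (by omega)]
  have hrow : ∀ k, k ≠ j + 1 → rowSet v' k = rowSet v k := by
    intro k hkj
    rcases lt_or_gt_of_ne hkj with h3 | h3
    · exact hlow k (by omega)
    · obtain ⟨d, rfl⟩ : ∃ d, k = j + 1 + 1 + d := ⟨k - (j + 1 + 1), by omega⟩
      exact hhigh d
  have hbump : ∀ k, k ≠ j + 1 → k ≠ j + 1 + 1 → bumped v' k = bumped v k := by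
    intro k hk1 hk2
    cases k with
    | zero => rfl
    | succ k => rw [bumped, bumped, hk _ hk1 hk2, hrow k (by omega)]
  rcases k2 with ⟨c1, c2, c3, c4⟩ | ⟨c1, c2, c3⟩
  · refine Or.inl ⟨c1, funext fun k => ?_, c4, fun k hk => by rw [hrow k hk]⟩
    by_cases e1 : k = j + 1
    · rw [e1, c2]
    · by_cases e2 : k = j + 1 + 1
      · rw [e2, c3]
      · exact hbump k e1 e2
  · refine Or.inr ⟨c1, ⟨c2, hbump⟩, fun k => ?_⟩
    by_cases e1 : k = j + 1
    · rw [e1, c3]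
    · rw [hrow k e1]

/-- The number of unpaired letters of the factor `i + 1` in row `r`. -/
def rowEps (v : Factors) (i r : ℕ) : ℕ := eps (bumped^[r] v i) (bumped^[r] v (i + 1))

/-- This is `BraidPairs.eps_eq` for row `r` and the two factors inserted into it, with the other
values of `eps` read as increments of the row length. It is also the recursion for the open letters
i+1 when the recording tableau is read. -/
theorem FacSeq.rowEps_eq {n ℓ i : ℕ} {v : Factors} (h : FacSeq n ℓ v) (h1 : 1 ≤ i) (h2 : i < ℓ)
    (r : ℕ) :
    rowEps v i r = rowEps v i (r + 1) - (rowCard v r i - rowCard v r (i - 1)) +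
      (rowCard v r (i + 1) - rowCard v r i) := by
  have hr := h.bumped_iterate r
  obtain ⟨j, rfl⟩ : ∃ j, i = j + 1 := ⟨i - 1, by omega⟩
  have key := (hr.red_triple (k := j) h2).braidPairs.eps_eq
  have c1 := hr.card_rowSet_succ j
  have c2 := hr.card_rowSet_succ (j + 1)
  rw [rowEps, rowEps, Function.iterate_succ_apply', rowCard, rowCard, rowCard, c1, c2, c1]
  simp only [Nat.add_sub_cancel, Nat.add_sub_cancel_left]
  exact key.trans (add_comm _ _)

/-- A lowering operator removes one letter from one row, after `i` factors. -/
theorem FacSeq.fStep_rowCard {n ℓ i : ℕ} {v v' : Factors} (h : FacSeq n ℓ v) (h1 : 1 ≤ i)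
    (h2 : i < ℓ) (hF : FStep i v v') :
    ∃ r, (∀ s < r, rowCard v s i - rowCard v s (i - 1) ≤ rowEps v i (s + 1)) ∧
      rowEps v i (r + 1) < rowCard v r i - rowCard v r (i - 1) ∧
      (rowCard v' r i + 1 = rowCard v r i) ∧
      ∀ s k, (s = r → k ≠ i) → rowCard v' s k = rowCard v s k := by
  -- The lowering is followed from row to row until it deletes a cell. It must stop, because a
  -- lowered factor is nonempty while `bumped^[i] v i` is empty.
  have main : ∀ (d : ℕ) (v v' : Factors), FacSeq n ℓ v → FStep i v v' → bumped^[d] v i = ∅ →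
    ∃ r, (∀ s < r, rowCard v s i - rowCard v s (i - 1) ≤ rowEps v i (s + 1)) ∧
      rowEps v i (r + 1) < rowCard v r i - rowCard v r (i - 1) ∧
      (rowCard v' r i + 1 = rowCard v r i) ∧
      ∀ s k, (s = r → k ≠ i) → rowCard v' s k = rowCard v s k := by
    intro d
    induction d with
    | zero =>
      intro v v' hv hF he
      obtain ⟨⟨a, m, hM⟩, -⟩ := hF
      have := hM.mem
      rw [Function.iterate_zero, id] at he
      rw [he] at this
      simp at this
    | succ d ih =>
      intro v v' hv hF he
      have ha : rowCard v 0 i - rowCard v 0 (i - 1) = eps (rowSet v (i - 1)) (v i) := by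
        obtain ⟨j, rfl⟩ : ∃ j, i = j + 1 := ⟨i - 1, by omega⟩
        have := hv.card_rowSet_succ j
        simp only [rowCard, Function.iterate_zero, id, Nat.add_sub_cancel]
        omega
      rcases hv.fStep_row h1 h2 hF with ⟨c1, c2, c3, c4⟩ | ⟨c1, c2, c3⟩
      · refine ⟨0, fun s hs => by omega, by rw [ha]; exact c1, c3, fun s k hs => ?_⟩
        cases s with
        | zero => exact c4 k (hs rfl)
        | succ s => rw [← rowCard_bumped, ← rowCard_bumped, c2]
      · obtain ⟨r, q1, q2, q3, q4⟩ := ih _ _ hv.next c2 (by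
          rwa [Function.iterate_succ_apply] at he)
        have he : ∀ s, rowEps (bumped v) i s = rowEps v i (s + 1) := fun s => by
          rw [rowEps, rowEps, Function.iterate_succ_apply]
        simp only [rowCard_bumped, he] at q1 q2 q3 q4
        refine ⟨r + 1, fun s hs => ?_, q2, q3, fun s k hs => ?_⟩
        · cases s with
          | zero => rw [ha]; exact c1
          | succ s => exact q1 s (by omega)
        · cases s with
          | zero => exact c3 k
          | succ s => exact q4 s k fun hsr => hs (by omega)
  exact main i v v' h hF (bumped_iterate_eq_empty (h.supp 0 (by omega)) i i le_rfl)

/-- The hypothesis `h0` says that every letter of w^i is paired. Together with the recursion for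
`eps`, counting letters hands this property to the bumped factors, and the row contributes no
unpaired i. -/
theorem FacSeq.rowCard_le_of_card {n ℓ i : ℕ} {v : Factors} (h : FacSeq n ℓ v) (h1 : 1 ≤ i)
    (h2 : i < ℓ) (h0 : (v i).card + eps (v i) (v (i + 1)) = (v (i + 1)).card) :
    rowCard v 0 i - rowCard v 0 (i - 1) ≤ rowEps v i 1 ∧
      (bumped v i).card + eps (bumped v i) (bumped v (i + 1)) = (bumped v (i + 1)).card := by
  have e1 := h.rowEps_eq h1 h2 0
  obtain ⟨j, rfl⟩ : ∃ j, i = j + 1 := ⟨i - 1, by omega⟩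
  have c1 := h.card_eq j
  have c2 := h.card_eq (j + 1)
  have m1 := h.card_rowSet_succ j
  have m2 := h.card_rowSet_succ (j + 1)
  have hle := eps_add_card (bumped v (j + 1)) (bumped v (j + 1 + 1))
  have hle2 := lowX_card_le (bumped v (j + 1)) (bumped v (j + 1 + 1))
  simp only [rowCard, rowEps, Nat.add_sub_cancel, Function.iterate_zero, id,
    Function.iterate_one, zero_add] at *
  omega

/-- If the lowering operator gives `0`, then it does so in every row. -/
theorem FacSeq.rowCard_le_of_forall {n ℓ i : ℕ} {v : Factors} (h : FacSeq n ℓ v) (h1 : 1 ≤ i)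
    (h2 : i < ℓ) (h0 : ∀ x ∈ v i, carrier (v i) (v (i + 1)) x ≠ 0) (r : ℕ) :
    rowCard v r i - rowCard v r (i - 1) ≤ rowEps v i (r + 1) := by
  rw [forall_carrier_ne_zero_iff] at h0
  have h3 := eps_add_card (v i) (v (i + 1))
  rw [h0] at h3
  have h4 : (v i).card + eps (v i) (v (i + 1)) = (v (i + 1)).card := by omega
  clear h0 h3
  induction r generalizing v with
  | zero => exact (h.rowCard_le_of_card h1 h2 h4).1
  | succ r ih =>
    have := ih h.next (h.rowCard_le_of_card h1 h2 h4).2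
    rwa [rowCard_bumped, rowCard_bumped, rowEps, ← Function.iterate_succ_apply] at this

/-! ### The bracketing in terms of the carrier -/

/-- The value of the carrier after the letter `c` of the first set has been read. -/
def slack (X Y : Finset ℕ) (c : ℕ) : ℕ := carrier X Y c - if c ∈ X then 1 else 0

section BracketStep
variable {b : ℕ} {X Y : Finset ℕ}

/-- Adding a letter `b` to the second set that is larger than all its letters and remains
unpaired. -/
theorem carrier_insert_of_forall_le (hY : ∀ y ∈ Y, y < b) (hX : ∀ x ∈ X, x ≤ b) :
    (∀ c ≤ b, carrier X (insert b Y) c = carrier X Y c) ∧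
      ∀ c, b < c → carrier X (insert b Y) c = slack X Y b + 1 ∧ carrier X Y c = slack X Y b := by
  have h1 : ∀ c ≤ b, carrier X (insert b Y) c = carrier X Y c := fun c hc =>
    carrier_congr fun d hd => ⟨Iff.rfl, by rw [Finset.mem_insert]; exact or_iff_right (by omega)⟩
  have hb : b ∉ Y := fun h => lt_irrefl _ (hY b h)
  refine ⟨h1, fun c hc => ?_⟩
  induction c, Nat.succ_le_of_lt hc using Nat.le_induction with
  | base =>
    rw [carrier_succ, carrier_succ, h1 b le_rfl, if_pos (Finset.mem_insert_self b Y), if_neg hb,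
      slack]
    exact ⟨rfl, rfl⟩
  | succ c hc' ih =>
    obtain ⟨e1, e2⟩ := ih (by omega)
    have hcX : c ∉ X := fun h => by have := hX c h; omega
    have hcY : c ∉ Y := fun h => by have := hY c h; omega
    have hcY' : c ∉ insert b Y := by rw [Finset.mem_insert]; push Not; exact ⟨by omega, hcY⟩
    rw [carrier_succ, carrier_succ, e1, e2, if_neg hcX, if_neg hcY, if_neg hcY']
    exact ⟨rfl, rfl⟩

/-- Adding a letter `b` to the second set that is larger than all its letters and is paired with
`a`. -/
theorem carrier_insert_erase {a : ℕ} (hY : ∀ y ∈ Y, y < b) (ha : a ∈ X) (hba : b < a)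
    (hmin : ∀ x ∈ X, b < x → a ≤ x) :
    (∀ c ≤ b, carrier X (insert b Y) c = carrier (X.erase a) Y c) ∧
    (∀ c, b < c → c ≤ a → carrier X (insert b Y) c = slack (X.erase a) Y b + 1 ∧
      carrier (X.erase a) Y c = slack (X.erase a) Y b) ∧
    ∀ c, a < c → carrier X (insert b Y) c = carrier (X.erase a) Y c := by
  have hb : b ∉ Y := fun h => lt_irrefl _ (hY b h)
  have h1 : ∀ c ≤ b, carrier X (insert b Y) c = carrier (X.erase a) Y c := fun c hc =>
    carrier_congr fun d hd => ⟨by rw [Finset.mem_erase]; exact (and_iff_right (by omega)).symm,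
      by rw [Finset.mem_insert]; exact or_iff_right (by omega)⟩
  have h2 : ∀ c, b < c → c ≤ a → carrier X (insert b Y) c = slack (X.erase a) Y b + 1 ∧
      carrier (X.erase a) Y c = slack (X.erase a) Y b := by
    intro c hc hca
    induction c, Nat.succ_le_of_lt hc using Nat.le_induction with
    | base =>
      have : b ∈ X ↔ b ∈ X.erase a := by
        rw [Finset.mem_erase]; exact (and_iff_right (by omega)).symm
      rw [carrier_succ, carrier_succ, h1 b le_rfl, if_pos (Finset.mem_insert_self b Y), if_neg hb,
        slack]
      simp only [this]
      exact ⟨trivial, rfl⟩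
    | succ c hc' ih =>
      obtain ⟨e1, e2⟩ := ih (by omega) (by omega)
      have hcX : c ∉ X := fun h => by have := hmin c h (by omega); omega
      have hcX' : c ∉ X.erase a := fun h => hcX (Finset.mem_of_mem_erase h)
      have hcY : c ∉ Y := fun h => by have := hY c h; omega
      have hcY' : c ∉ insert b Y := by rw [Finset.mem_insert]; push Not; exact ⟨by omega, hcY⟩
      rw [carrier_succ, carrier_succ, e1, e2, if_neg hcX, if_neg hcY, if_neg hcY', if_neg hcX']
      exact ⟨rfl, rfl⟩
  refine ⟨h1, h2, fun c hc => ?_⟩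
  induction c, Nat.succ_le_of_lt hc using Nat.le_induction with
  | base =>
    obtain ⟨e1, e2⟩ := h2 a hba le_rfl
    have hcY : a ∉ Y := fun h => by have := hY a h; omega
    have hcY' : a ∉ insert b Y := by rw [Finset.mem_insert]; push Not; exact ⟨by omega, hcY⟩
    rw [carrier_succ, carrier_succ, e1, e2, if_pos ha, if_neg hcY, if_neg hcY',
      if_neg (Finset.notMem_erase a X)]
    rfl
  | succ c hc' ih =>
    have e1 : c ∈ X ↔ c ∈ X.erase a := by
      rw [Finset.mem_erase]; exact (and_iff_right (by omega)).symm
    have e2 : c ∈ insert b Y ↔ c ∈ Y := by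
      rw [Finset.mem_insert]; exact or_iff_right (by omega)
    rw [carrier_succ, carrier_succ, ih (by omega)]
    simp only [e1, e2]

end BracketStep

/-- The first letter treated is the largest; removing it with its partner alters the scan only
between the two. A letter `y` of `L` is unpaired iff the number of open letters never returns to its
level just before `y` was opened. -/
theorem mem_bracket {L : List ℕ} (hL : L.Pairwise (· > ·)) (X : Finset ℕ) :
    (∀ x, x ∈ (bracket L X).2 ↔ x ∈ X ∧ carrier X L.toFinset x = 0) ∧
    ∀ y, y ∈ (bracket L X).1 ↔
      y ∈ L ∧ ∀ d, y < d → slack X L.toFinset y < slack X L.toFinset d := by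
  induction L generalizing X with
  | nil => simp [bracket, carrier_empty_right]
  | cons b L ih =>
    obtain ⟨hb, hL⟩ := List.pairwise_cons.1 hL
    have hY : ∀ y ∈ L.toFinset, y < b := fun y hy => hb y (List.mem_toFinset.1 hy)
    rw [List.toFinset_cons]
    by_cases h : (X.filter fun a => b < a).Nonempty
    · rw [bracket, dif_pos h]
      set a := (X.filter fun a => b < a).min' h with ha
      obtain ⟨haX, hba⟩ := Finset.mem_filter.1 (Finset.min'_mem _ h)
      rw [← ha] at haX hba
      have hmin : ∀ x ∈ X, b < x → a ≤ x := fun x hx hbx =>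
        Finset.min'_le _ _ (Finset.mem_filter.2 ⟨hx, hbx⟩)
      obtain ⟨c1, c2, c3⟩ := carrier_insert_erase hY haX hba hmin
      obtain ⟨i1, i2⟩ := ih hL (X.erase a)
      have m1 : ∀ d, d ≠ a → (d ∈ X ↔ d ∈ X.erase a) := fun d hd => by
        rw [Finset.mem_erase]; exact (and_iff_right hd).symm
      constructor
      · intro x
        rw [i1]
        rcases lt_trichotomy x a with hx | rfl | hx
        · rw [← m1 x hx.ne]
          refine and_congr_right fun hxX => ?_
          have : x ≤ b := by
            by_contra hbx
            have := hmin x hxX (by omega)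
            omega
          rw [c1 x this]
        · rw [(c2 _ hba le_rfl).1]
          simp
        · rw [← m1 x hx.ne', c3 x hx]
      -- The extra open letter `b` is visible only strictly between `b` and `a`, as slack is
      -- measured after closing.
      · have s1 : ∀ d, d ≤ b ∨ a ≤ d → slack X (insert b L.toFinset) d =
            slack (X.erase a) L.toFinset d := by
          intro d hd
          rcases lt_trichotomy d a with hx | rfl | hx
          · simp only [slack, m1 d hx.ne, c1 d (by omega)]
          · simp [slack, (c2 a hba le_rfl).1, (c2 a hba le_rfl).2, haX]
          · simp only [slack, m1 d hx.ne', c3 d hx]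
        have s2 : ∀ d, b < d → d < a → slack X (insert b L.toFinset) d =
            slack (X.erase a) L.toFinset b + 1 ∧
            slack (X.erase a) L.toFinset d = slack (X.erase a) L.toFinset b := by
          intro d hd hd'
          have : d ∉ X := fun h => by have := hmin d h hd; omega
          have h' : d ∉ X.erase a := fun h => this (Finset.mem_of_mem_erase h)
          constructor
          · conv_lhs => rw [slack, (c2 d hd hd'.le).1, if_neg this]
            rfl
          · conv_lhs => rw [slack, (c2 d hd hd'.le).2, if_neg h']
            rfl
        have s3 : slack (X.erase a) L.toFinset a = slack (X.erase a) L.toFinset b := by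
          conv_lhs => rw [slack, (c2 a hba le_rfl).2, if_neg (Finset.notMem_erase a X)]
          rfl
        intro y
        rw [i2, List.mem_cons]
        constructor
        · rintro ⟨hyL, hy⟩
          have hyb := hb y hyL
          refine ⟨Or.inr hyL, fun d hd => ?_⟩
          rw [s1 y (by omega)]
          by_cases hdd : d ≤ b ∨ a ≤ d
          · rw [s1 d hdd]; exact hy d hd
          · have := hy b hyb
            have := (s2 d (by omega) (by omega)).1
            omega
        · rintro ⟨hyL, hy⟩
          have hyL' : y ∈ L := by
            rcases hyL with rfl | hyL
            · have := hy a hba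
              rw [s1 y (by omega), s1 a (by omega), s3] at this
              omega
            · exact hyL
          have hyb := hb y hyL'
          refine ⟨hyL', fun d hd => ?_⟩
          have e := s1 y (by omega)
          by_cases hdd : d ≤ b ∨ a ≤ d
          · rw [← s1 d hdd, ← e]; exact hy d hd
          · have := hy b hyb
            have := s1 b (by omega)
            have := (s2 d (by omega) (by omega)).2
            omega
    · rw [bracket, dif_neg h]
      have hX : ∀ x ∈ X, x ≤ b := fun x hx => by
        by_contra hbx
        exact h ⟨x, Finset.mem_filter.2 ⟨hx, by omega⟩⟩
      obtain ⟨c1, c2⟩ := carrier_insert_of_forall_le hY hX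
      obtain ⟨i1, i2⟩ := ih hL X
      have s1 : ∀ d ≤ b, slack X (insert b L.toFinset) d = slack X L.toFinset d := fun d hd => by
        rw [slack, slack, c1 d hd]
      have s2 : ∀ d, b < d → slack X (insert b L.toFinset) d = slack X L.toFinset b + 1 ∧
          slack X L.toFinset d = slack X L.toFinset b := by
        intro d hd
        have : d ∉ X := fun h => by have := hX d h; omega
        conv_lhs => rw [slack, (c2 d hd).1, if_neg this]
        refine ⟨rfl, ?_⟩
        conv_lhs => rw [slack, (c2 d hd).2, if_neg this]
        rfl
      constructor
      · intro x
        rw [i1]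
        refine and_congr_right fun hx => ?_
        rw [c1 x (hX x hx)]
      · intro y
        rw [Finset.mem_insert, i2, List.mem_cons]
        constructor
        · rintro (rfl | ⟨hyL, hy⟩)
          · refine ⟨Or.inl rfl, fun d hd => ?_⟩
            rw [s1 y le_rfl, (s2 d hd).1]
            omega
          · have hyb := hb y hyL
            refine ⟨Or.inr hyL, fun d hd => ?_⟩
            rw [s1 y (by omega)]
            rcases le_or_gt d b with hdb | hdb
            · rw [s1 d hdb]; exact hy d hd
            · rw [(s2 d hdb).1]
              have := hy b hyb
              omega
        · rintro ⟨rfl | hyL, hy⟩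
          · exact Or.inl rfl
          · have hyb := hb y hyL
            refine Or.inr ⟨hyL, fun d hd => ?_⟩
            have e := s1 y (by omega)
            rcases le_or_gt d b with hdb | hdb
            · rw [← s1 d hdb, ← e]; exact hy d hd
            · rw [(s2 d hdb).2, ← e, ← s1 b le_rfl]
              exact hy b hyb

theorem pairwise_decWord (S : Finset ℕ) : (decWord S).Pairwise (· > ·) :=
  (Finset.sortedGT_sort S).pairwise

theorem toFinset_decWord (S : Finset ℕ) : (decWord S).toFinset = S := Finset.sort_toFinset _ _

theorem mem_unpairedR {v : Factors} {i x : ℕ} :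
    x ∈ unpairedR v i ↔ x ∈ v i ∧ carrier (v i) (v (i + 1)) x = 0 := by
  have := (mem_bracket (pairwise_decWord (v (i + 1))) (v i)).1 x
  rwa [toFinset_decWord] at this

theorem mem_unpairedL {v : Factors} {i y : ℕ} :
    y ∈ unpairedL v i ↔
      y ∈ v (i + 1) ∧ ∀ d, y < d → slack (v i) (v (i + 1)) y < slack (v i) (v (i + 1)) d := by
  have := (mem_bracket (pairwise_decWord (v (i + 1))) (v i)).2 y
  rwa [toFinset_decWord, mem_decWord] at this

/-! ### The crystal operators on factorizations -/

theorem FStep.unique {i : ℕ} {v v₁ v₂ : Factors} (h₁ : FStep i v v₁) (h₂ : FStep i v v₂) :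
    v₁ = v₂ := by
  obtain ⟨⟨a₁, m₁, hF₁⟩, hk₁⟩ := h₁
  obtain ⟨⟨a₂, m₂, hF₂⟩, hk₂⟩ := h₂
  obtain ⟨-, -, e1, e2⟩ := hF₁.unique hF₂
  funext k
  by_cases h1 : k = i
  · rw [h1, e1]
  · by_cases h2 : k = i + 1
    · rw [h2, e2]
    · rw [hk₁ k h1 h2, hk₂ k h1 h2]

/-- `v'` arises from `v` by the `i`-th raising operator. -/
def EStep (i : ℕ) (v v' : Factors) : Prop :=
  (∃ a b, EMove (v i) (v (i + 1)) (v' i) (v' (i + 1)) a b) ∧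
    ∀ k, k ≠ i → k ≠ i + 1 → v' k = v k

theorem EStep.unique {i : ℕ} {v v₁ v₂ : Factors} (h₁ : EStep i v v₁) (h₂ : EStep i v v₂) :
    v₁ = v₂ := by
  obtain ⟨⟨a₁, m₁, hF₁⟩, hk₁⟩ := h₁
  obtain ⟨⟨a₂, m₂, hF₂⟩, hk₂⟩ := h₂
  obtain ⟨-, -, e1, e2⟩ := hF₁.unique hF₂
  funext k
  by_cases h1 : k = i
  · rw [h1, e1]
  · by_cases h2 : k = i + 1
    · rw [h2, e2]
    · rw [hk₁ k h1 h2, hk₂ k h1 h2]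

theorem factF_cases (i : ℕ) (v : Factors) :
    (∃ v', factF i v = some v' ∧ FStep i v v') ∨
      (factF i v = none ∧ ∀ x ∈ v i, carrier (v i) (v (i + 1)) x ≠ 0) := by
  unfold factF
  by_cases h : (unpairedR v i).Nonempty
  · left
    rw [dif_pos h]
    refine ⟨_, rfl, ?_⟩
    obtain ⟨ha, hz⟩ := mem_unpairedR.1 (Finset.max'_mem _ h)
    set a := (unpairedR v i).max' h with hadef
    have hne : {j : ℕ | a + j + 1 ∉ v i}.Nonempty := by
      obtain ⟨M, hM⟩ := (v i).exists_nat_subset_range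
      exact ⟨M, fun h => by have := Finset.mem_range.1 (hM h); omega⟩
    have hs := Nat.sInf_mem hne
    have hs' : ∀ j < sInf {j : ℕ | a + j + 1 ∉ v i}, a + j + 1 ∈ v i := fun j hj => by
      simpa using Nat.notMem_of_lt_sInf hj
    set s := sInf {j : ℕ | a + j + 1 ∉ v i}
    refine ⟨⟨a, a + s, ha, hz, fun d hd hdX h0 => ?_, by omega, fun c h1 h2 => ?_, hs, ?_, ?_⟩, ?_⟩
    · have := Finset.le_max' _ d (mem_unpairedR.2 ⟨hdX, h0⟩)
      omega
    · rcases eq_or_lt_of_le h1 with rfl | h3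
      · exact ha
      · have := hs' (c - a - 1) (by omega)
        rwa [show a + (c - a - 1) + 1 = c by omega] at this
    · simp
    · simp
    · intro k h1 h2
      simp [h1, h2]
  · right
    rw [dif_neg h]
    exact ⟨rfl, fun x hx h0 => h ⟨x, mem_unpairedR.2 ⟨hx, h0⟩⟩⟩

/-- Subtraction is truncated, so `b - j - 1` is 0 once `j + 1 ≥ b`; with `0 ∉ v (i + 1)` the infimum
is attained at some `t ≤ b`, and the run in w^{i+1} ends properly. -/
theorem factE_cases (i : ℕ) (v : Factors) (h0 : 0 ∉ v (i + 1)) :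
    (∃ v', factE i v = some v' ∧ EStep i v v') ∨
      (factE i v = none ∧ eps (v i) (v (i + 1)) = 0) := by
  unfold factE
  by_cases heps : eps (v i) (v (i + 1)) = 0
  · right
    have h : ¬(unpairedL v i).Nonempty := by
      rintro ⟨y, hy⟩
      obtain ⟨h1, h2⟩ := mem_unpairedL.1 hy
      have := h2 _ (lt_letterBound_right (X := v i) h1)
      rw [eps] at heps
      rw [slack, slack, heps] at this
      omega
    rw [dif_neg h]
    exact ⟨rfl, heps⟩
  · left
    obtain ⟨a₀, b₀, X', Y', hE⟩ := exists_eMove heps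
    have hb0 : b₀ ∈ unpairedL v i := mem_unpairedL.2 ⟨hE.mem, fun d hd => by
      have h1 := hE.last d hd
      have h2 := hE.zero
      rw [slack, slack, h2]
      omega⟩
    have h : (unpairedL v i).Nonempty := ⟨b₀, hb0⟩
    rw [dif_pos h]
    refine ⟨_, rfl, ?_⟩
    have hb : (unpairedL v i).min' h = b₀ := by
      refine le_antisymm (Finset.min'_le _ _ hb0) ?_
      by_contra hlt
      have := (mem_unpairedL.1 (Finset.min'_mem _ h)).2 b₀ (by omega)
      have h2 := hE.zero
      rw [slack, slack, h2] at this
      omega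
    simp only [hb]
    have hne : {j : ℕ | b₀ - j - 1 ∉ v (i + 1)}.Nonempty := ⟨b₀, by simpa using h0⟩
    have hs := Nat.sInf_mem hne
    have hs' : ∀ j < sInf {j : ℕ | b₀ - j - 1 ∉ v (i + 1)}, b₀ - j - 1 ∈ v (i + 1) :=
      fun j hj => by simpa using Nat.notMem_of_lt_sInf hj
    have hsle : sInf {j : ℕ | b₀ - j - 1 ∉ v (i + 1)} ≤ b₀ := Nat.sInf_le (by simpa using h0)
    set t := sInf {j : ℕ | b₀ - j - 1 ∉ v (i + 1)}
    refine ⟨⟨b₀ - t, b₀, hE.mem, hE.zero, hE.last, by omega, fun c h1 h2 => ?_, fun a' ha' => ?_,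
      ?_, ?_⟩, ?_⟩
    · rcases eq_or_lt_of_le h2 with rfl | h3
      · exact hE.mem
      · have := hs' (b₀ - c - 1) (by omega)
        rwa [show b₀ - (b₀ - c - 1) - 1 = c by omega] at this
    · have : b₀ - t - 1 ∉ v (i + 1) := hs
      rwa [show b₀ - t - 1 = a' by omega] at this
    · simp
    · simp
    · intro k h1 h2
      simp [h1, h2]

theorem factF_eq_some_iff {i : ℕ} {v v' : Factors} : factF i v = some v' ↔ FStep i v v' := by
  rcases factF_cases i v with ⟨w, h1, h2⟩ | ⟨h1, h2⟩
  · rw [h1, Option.some_inj]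
    exact ⟨fun h => h ▸ h2, fun h => h2.unique h⟩
  · rw [h1]
    refine ⟨fun h => by simp at h, fun h => ?_⟩
    obtain ⟨⟨a, m, hF⟩, -⟩ := h
    exact absurd hF.zero (h2 a hF.mem)

theorem factE_eq_some_iff {i : ℕ} {v v' : Factors} (h0 : 0 ∉ v (i + 1)) :
    factE i v = some v' ↔ EStep i v v' := by
  rcases factE_cases i v h0 with ⟨w, h1, h2⟩ | ⟨h1, h2⟩
  · rw [h1, Option.some_inj]
    exact ⟨fun h => h ▸ h2, fun h => h2.unique h⟩
  · rw [h1]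
    refine ⟨fun h => by simp at h, fun h => ?_⟩
    obtain ⟨⟨a, m, hE⟩, -⟩ := h
    exact absurd h2 hE.eps_ne_zero

theorem factF_eq_none_iff {i : ℕ} {v : Factors} :
    factF i v = none ↔ ∀ x ∈ v i, carrier (v i) (v (i + 1)) x ≠ 0 := by
  rcases factF_cases i v with ⟨w, h1, ⟨a, m, hF⟩, -⟩ | ⟨h1, h2⟩
  · rw [h1]
    exact ⟨fun h => by simp at h, fun h => absurd hF.zero (h a hF.mem)⟩
  · exact ⟨fun _ => h2, fun _ => h1⟩

theorem factE_eq_none_iff {i : ℕ} {v : Factors} (h0 : 0 ∉ v (i + 1)) :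
    factE i v = none ↔ eps (v i) (v (i + 1)) = 0 := by
  rcases factE_cases i v h0 with ⟨w, h1, ⟨a, m, hE⟩, -⟩ | ⟨h1, h2⟩
  · rw [h1]
    exact ⟨fun h => by simp at h, fun h => absurd h hE.eps_ne_zero⟩
  · exact ⟨fun _ => h2, fun _ => h1⟩

/-! ### Edelman–Greene insertion in terms of the maximal lowerings -/

/-- The letters of a set in increasing order. -/
def incWord (S : Finset ℕ) : List ℕ := S.sort (· ≤ ·)

theorem mem_incWord {S : Finset ℕ} {i : ℕ} : i ∈ incWord S ↔ i ∈ S := Finset.mem_sort _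

theorem length_incWord (S : Finset ℕ) : (incWord S).length = S.card := Finset.length_sort _

theorem pairwise_incWord (S : Finset ℕ) : (incWord S).Pairwise (· < ·) :=
  (Finset.sortedLT_sort S).pairwise

theorem incWord_empty : incWord ∅ = [] := Finset.sort_empty _

theorem eq_incWord {l : List ℕ} {S : Finset ℕ} (hl : l.Pairwise (· < ·)) (h : ∀ i, i ∈ l ↔ i ∈ S) :
    l = incWord S := by
  have hS : S = l.toFinset := by ext i; rw [List.mem_toFinset, h]
  rw [hS]
  exact ((List.toFinset_sort (r := (· ≤ ·)) (hl.imp fun h => ne_of_lt h)).2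
    (hl.imp fun h => le_of_lt h)).symm

theorem incWord_insert {S : Finset ℕ} {a : ℕ} (h : ∀ x ∈ S, x < a) :
    incWord (insert a S) = incWord S ++ [a] := by
  refine (eq_incWord ?_ fun i => ?_).symm
  · refine List.pairwise_append.2 ⟨pairwise_incWord S, List.pairwise_singleton _ _, ?_⟩
    intro x hx y hy
    rw [List.mem_singleton.1 hy]
    exact h x (mem_incWord.1 hx)
  · rw [List.mem_append, mem_incWord, List.mem_singleton, Finset.mem_insert, or_comm]

theorem egInsertRow_of_forall_lt {S : Finset ℕ} {a : ℕ} (h : ∀ x ∈ S, x < a) :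
    egInsertRow a (incWord S) = (incWord (insert a S), none) := by
  have : (incWord S).find? (fun b => decide (a < b)) = none := by
    rw [List.find?_eq_none]
    intro x hx
    have := h x (mem_incWord.1 hx)
    simp only [decide_eq_true_eq]
    omega
  rw [egInsertRow, this, incWord_insert h]

theorem incWord_find {S : Finset ℕ} {a b : ℕ} (hb : b ∈ S) (hab : a < b)
    (hmin : ∀ x ∈ S, a < x → b ≤ x) :
    (incWord S).find? (fun b => decide (a < b)) = some b := by
  rw [List.find?_eq_some_iff_append]
  obtain ⟨l₁, l₂, hl⟩ := List.append_of_mem (mem_incWord.2 hb)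
  refine ⟨by simpa using hab, l₁, l₂, hl, fun x hx => ?_⟩
  have hp := pairwise_incWord S
  rw [hl] at hp
  have h1 := (List.pairwise_append.1 hp).2.2 x hx b (by simp)
  have h2 : x ∈ S := mem_incWord.1 (by rw [hl]; simp [hx])
  have := hmin x h2
  simp only [Bool.not_eq_true', decide_eq_false_iff_not]
  omega

theorem egInsertRow_of_mem {S : Finset ℕ} {a : ℕ} (ha : a ∈ S) (hb : a + 1 ∈ S) :
    egInsertRow a (incWord S) = (incWord S, some (a + 1)) := by
  rw [egInsertRow, incWord_find hb (by omega) fun x _ h => h]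
  simp only
  rw [if_pos ⟨trivial, mem_incWord.2 ha⟩]

theorem egInsertRow_of_notMem {S : Finset ℕ} {a b : ℕ} (ha : a ∉ S) (hb : b ∈ S) (hab : a < b)
    (hmin : ∀ x ∈ S, a < x → b ≤ x) :
    egInsertRow a (incWord S) = (incWord (insert a (S.erase b)), some b) := by
  rw [egInsertRow, incWord_find hb hab hmin]
  simp only
  rw [if_neg fun h => ha (mem_incWord.1 h.2)]
  congr 1
  refine eq_incWord ?_ fun i => ?_
  · rw [List.pairwise_map]
    refine (pairwise_incWord S).imp_of_mem fun {x y} hx hy hxy => ?_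
    have hx := mem_incWord.1 hx
    have hy := mem_incWord.1 hy
    have h1 := hmin y hy
    have h2 : x ≠ a := fun h => ha (h ▸ hx)
    have h3 : y ≠ a := fun h => ha (h ▸ hy)
    have h4 := hmin x hx
    split_ifs <;> omega
  · rw [List.mem_map, Finset.mem_insert, Finset.mem_erase]
    constructor
    · rintro ⟨x, hx, rfl⟩
      split_ifs with h
      · exact Or.inl rfl
      · exact Or.inr ⟨h, mem_incWord.1 hx⟩
    · rintro (rfl | ⟨h1, h2⟩)
      · exact ⟨b, mem_incWord.2 hb, if_pos rfl⟩
      · exact ⟨i, mem_incWord.2 h2, if_neg h1⟩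

/-- Insertion of a word into a row: the letters that are bumped, and the new row. -/
def rowFold (row : List ℕ) : List ℕ → List ℕ × List ℕ
  | [] => ([], row)
  | a :: A => ((egInsertRow a row).2.toList ++ (rowFold (egInsertRow a row).1 A).1,
      (rowFold (egInsertRow a row).1 A).2)

theorem rowFold_append_singleton (row A : List ℕ) (a : ℕ) :
    rowFold row (A ++ [a]) = ((rowFold row A).1 ++ (egInsertRow a (rowFold row A).2).2.toList,
      (egInsertRow a (rowFold row A).2).1) := by
  induction A generalizing row with
  | nil => simp [rowFold]
  | cons b A ih => simp [rowFold, ih]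

theorem egInsert_eq (a : ℕ) (P : List (List ℕ)) :
    (egInsert a P).headD [] = (egInsertRow a (P.headD [])).1 ∧
      (egInsert a P).tail =
        (egInsertRow a (P.headD [])).2.toList.foldl (fun P a => egInsert a P) P.tail := by
  cases P with
  | nil => simp [egInsert, egInsertRow]
  | cons row P =>
    simp only [egInsert, List.headD_cons, List.tail_cons]
    rcases h : egInsertRow a row with ⟨row', _ | b⟩ <;> simp

/-- Bumped letters enter the next row in the order in which they leave, so a word may be inserted
completely into one row before the next row is considered. -/
theorem foldl_egInsert (A : List ℕ) (P : List (List ℕ)) :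
    (A.foldl (fun P a => egInsert a P) P).headD [] = (rowFold (P.headD []) A).2 ∧
      (A.foldl (fun P a => egInsert a P) P).tail =
        (rowFold (P.headD []) A).1.foldl (fun P a => egInsert a P) P.tail := by
  induction A generalizing P with
  | nil => exact ⟨rfl, rfl⟩
  | cons a A ih =>
    obtain ⟨h1, h2⟩ := egInsert_eq a P
    rw [List.foldl_cons, (ih _).1, (ih _).2, h1, h2]
    simp [rowFold]

theorem NoBlock.of_insert {R A : Finset ℕ} {a : ℕ} (h : NoBlock R (insert a A))
    (ha : ∀ x ∈ A, x < a) : NoBlock R A := by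
  intro a₀ m hle hb
  rcases h a₀ m hle fun c h1 h2 => ⟨(hb c h1 h2).1, Finset.mem_insert_of_mem (hb c h1 h2).2⟩ with
    h1 | ⟨a', rfl, h2⟩
  · exact Or.inl h1
  · have := ha m (hb m hle le_rfl).2
    exact Or.inr ⟨a', rfl, (Finset.mem_insert.1 h2).resolve_left (by omega)⟩

/-! ### Enlarging the inserted factor by a new largest letter. -/

section InsertMax
variable {R A : Finset ℕ} {a : ℕ}

theorem carrier_insert_max_of_le {c : ℕ} (hc : c ≤ a) :
    carrier R (insert a A) c = carrier R A c ∧ star R (insert a A) c = star R A c := by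
  have : ∀ d < c, (d ∈ R ↔ d ∈ R) ∧ (d ∈ insert a A ↔ d ∈ A) := fun d hd =>
    ⟨Iff.rfl, by rw [Finset.mem_insert]; exact or_iff_right (by omega)⟩
  exact ⟨carrier_congr this, star_congr this⟩

theorem star_eq_false_of_gt (ha : ∀ x ∈ A, x < a) {c : ℕ} (hc : a < c) : star R A c = false := by
  rw [Bool.eq_false_iff]
  intro h
  obtain ⟨d, rfl⟩ : ∃ d, c = d + 1 := ⟨c - 1, by omega⟩
  have := ha d ((star_succ R A d).1 h).2.1
  omega

theorem carrier_insert_max_of_gt (ha : ∀ x ∈ A, x < a) {c : ℕ} (hc : a < c) :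
    ((∀ d, a < d → d < c → d ∈ R → carrier R A d ≠ 0) →
      carrier R (insert a A) c = carrier R A c + 1) ∧
    ((∃ d, a < d ∧ d < c ∧ d ∈ R ∧ carrier R A d = 0) →
      carrier R (insert a A) c = 0 ∧ carrier R A c = 0) := by
  have haA : a ∉ A := fun h => lt_irrefl _ (ha a h)
  induction c, Nat.succ_le_of_lt hc using Nat.le_induction with
  | base =>
    constructor
    · intro _
      rw [carrier_succ, carrier_succ, (carrier_insert_max_of_le le_rfl).1,
        if_pos (Finset.mem_insert_self a A), if_neg haA, add_zero]
    · rintro ⟨d, h1, h2, -⟩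
      omega
  | succ c hc' ih =>
    obtain ⟨i1, i2⟩ := ih (by omega)
    have hcA : c ∉ A := fun h => by have := ha c h; omega
    have hcA' : c ∉ insert a A := by rw [Finset.mem_insert]; push Not; exact ⟨by omega, hcA⟩
    rw [carrier_succ, carrier_succ, if_neg hcA, if_neg hcA', add_zero, add_zero]
    by_cases h : ∃ d, a < d ∧ d < c ∧ d ∈ R ∧ carrier R A d = 0
    · obtain ⟨e1, e2⟩ := i2 h
      obtain ⟨d, d1, d2, d3, d4⟩ := h
      exact ⟨fun h' => absurd d4 (h' d d1 (by omega) d3), fun _ => by rw [e1, e2]; simp⟩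
    · push Not at h
      rw [i1 fun d h1 h2 h3 => h d h1 h2 h3]
      constructor
      · intro h'
        have := h' c (by omega) (by omega)
        split_ifs with hcR
        · have := this hcR; omega
        · omega
      · rintro ⟨d, d1, d2, d3, d4⟩
        obtain rfl : d = c := by
          by_contra hne
          exact h d d1 (by omega) d3 d4
        rw [d4, if_pos d3]
        exact ⟨rfl, rfl⟩

/-- Insertion of one more letter, which is larger than all letters inserted before. -/
theorem egInsertRow_lowY (ha : ∀ x ∈ A, x < a) (hN : NoBlock R (insert a A)) :
    (egInsertRow a (incWord (lowY R A))).1 = incWord (lowY R (insert a A)) ∧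
      incWord (lowX R A) ++ (egInsertRow a (incWord (lowY R A))).2.toList =
        incWord (lowX R (insert a A)) := by
  have haA : a ∉ A := fun h => lt_irrefl _ (ha a h)
  have hle : ∀ c ≤ a, (c ∈ lowX R (insert a A) ↔ c ∈ lowX R A) ∧
      (c ≠ a → (c ∈ lowY R (insert a A) ↔ c ∈ lowY R A)) := by
    intro c hc
    obtain ⟨e1, e2⟩ := carrier_insert_max_of_le (R := R) (A := A) hc
    rw [mem_lowX, mem_lowX, mem_lowY, mem_lowY, e1, e2, Finset.mem_insert]
    exact ⟨Iff.rfl, fun h => by tauto⟩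
  have hgt : ∀ c, a < c → (c ∈ lowY R A ↔ c ∈ R ∧ carrier R A c = 0) := by
    intro c hc
    have : c ∉ A := fun h => by have := ha c h; omega
    rw [mem_lowY, star_eq_false_of_gt ha hc]
    simp [this]
  have hgt' : ∀ c, a < c → (c ∈ lowY R (insert a A) ↔
      c ∈ R ∧ (carrier R (insert a A) c = 0 ∨ star R (insert a A) c = true)) := by
    intro c hc
    have : c ∉ insert a A := by
      rw [Finset.mem_insert]; push Not; exact ⟨by omega, fun h => by have := ha c h; omega⟩
    rw [mem_lowY]
    simp [this]
  have hstar : ∀ c, a + 1 < c → star R (insert a A) c = false := fun c hc =>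
    star_eq_false_of_gt (a := a + 1) (fun x hx => by
      rcases Finset.mem_insert.1 hx with rfl | hx
      · omega
      · have := ha x hx; omega) hc
  have hself : a ∈ lowY R (insert a A) := mem_lowY.2 (Or.inl (Finset.mem_insert_self a A))
  obtain ⟨ea1, ea2⟩ := carrier_insert_max_of_le (R := R) (A := A) le_rfl
  -- If `a` lies in the current row as a letter of `R`, the flag rises and `NoBlock` puts `a + 1`
  -- into the row as well. This is the exceptional Edelman–Greene rule: the row is kept and `a + 1`
  -- is bumped.
  by_cases hsp : a ∈ R ∧ (carrier R A a = 0 ∨ star R A a = true)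
  · have haS : a ∈ lowY R A := mem_lowY.2 (Or.inr hsp)
    have hst : star R (insert a A) (a + 1) = true :=
      (star_succ R _ a).2 ⟨hsp.1, Finset.mem_insert_self a A, by rw [ea1, ea2]; exact hsp.2⟩
    have hR : a + 1 ∈ R := hN.mem_of_star hst
    have hk : carrier R A (a + 1) = 0 := by
      rw [carrier_succ, if_pos hsp.1, if_neg haA]
      rcases hsp.2 with h | h
      · omega
      · have := carrier_eq_one_of_star h; omega
    have hk' : carrier R (insert a A) (a + 1) = 1 := carrier_eq_one_of_star hst
    have hS : a + 1 ∈ lowY R A := (hgt _ (by omega)).2 ⟨hR, hk⟩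
    have hbig : ∀ c, a + 1 < c → carrier R (insert a A) c = 0 ∧ carrier R A c = 0 := fun c hc =>
      (carrier_insert_max_of_gt ha (by omega)).2 ⟨a + 1, by omega, hc, hR, hk⟩
    have eY : lowY R (insert a A) = lowY R A := by
      ext c
      rcases lt_trichotomy c a with hc | rfl | hc
      · exact (hle c hc.le).2 hc.ne
      · exact ⟨fun _ => haS, fun _ => hself⟩
      · rw [hgt c hc, hgt' c hc]
        rcases eq_or_lt_of_le (Nat.succ_le_of_lt hc) with rfl | hc'
        · exact ⟨fun _ => ⟨hR, hk⟩, fun _ => ⟨hR, Or.inr hst⟩⟩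
        · rw [(hbig c hc').1, (hbig c hc').2]
          simp
    have eX : lowX R (insert a A) = insert (a + 1) (lowX R A) := by
      ext c
      rw [Finset.mem_insert]
      rcases le_or_gt c a with hc | hc
      · rw [(hle c hc).1]
        exact (or_iff_right (by omega)).symm
      · rcases eq_or_lt_of_le (Nat.succ_le_of_lt hc) with rfl | hc'
        · exact ⟨fun _ => Or.inl rfl, fun _ => mem_lowX.2 ⟨hR, by rw [hk']; omega⟩⟩
        · rw [mem_lowX, mem_lowX, (hbig c hc').1, (hbig c hc').2]
          simp
          omega
    rw [egInsertRow_of_mem haS hS, eY, eX, incWord_insert]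
    · exact ⟨rfl, rfl⟩
    · intro x hx
      by_contra hlt
      rcases eq_or_lt_of_le (not_lt.1 hlt) with rfl | h
      · exact (mem_lowX.1 hx).2 hk
      · exact (mem_lowX.1 hx).2 (hbig x h).2
  · have haS : a ∉ lowY R A := by
      rw [mem_lowY]
      tauto
    have hst : ∀ c, a < c → star R (insert a A) c = false := by
      intro c hc
      rcases eq_or_lt_of_le (Nat.succ_le_of_lt hc) with rfl | hc'
      · rw [Bool.eq_false_iff]
        intro h
        obtain ⟨h1, -, h2⟩ := (star_succ R _ a).1 h
        rw [ea1, ea2] at h2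
        exact hsp ⟨h1, h2⟩
      · exact hstar c hc'
    have hgt'' : ∀ c, a < c → (c ∈ lowY R (insert a A) ↔
        c ∈ R ∧ carrier R (insert a A) c = 0) := by
      intro c hc
      rw [hgt' c hc, hst c hc]
      simp
    -- Ordinary insertion: the bumped letter is the first unpaired letter of `R` above `a`, which
    -- now closes the newly opened `a`. Without such a letter `a` stays open and is appended.
    by_cases hex : ∃ y ∈ lowY R A, a < y
    · have hne : ((lowY R A).filter (a < ·)).Nonempty := by
        obtain ⟨y, hy1, hy2⟩ := hex
        exact ⟨y, Finset.mem_filter.2 ⟨hy1, hy2⟩⟩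
      obtain ⟨y, hyS, hay, hmin⟩ : ∃ y ∈ lowY R A, a < y ∧ ∀ x ∈ lowY R A, a < x → y ≤ x := by
        obtain ⟨h1, h2⟩ := Finset.mem_filter.1 (Finset.min'_mem _ hne)
        exact ⟨_, h1, h2, fun x hx hax => Finset.min'_le _ _ (Finset.mem_filter.2 ⟨hx, hax⟩)⟩
      obtain ⟨hyR, hy0⟩ := (hgt y hay).1 hyS
      have hbelow : ∀ c, a < c → c ≤ y → carrier R (insert a A) c = carrier R A c + 1 := by
        intro c hc hcy
        refine (carrier_insert_max_of_gt ha hc).1 fun d hd hdc hdR h0 => ?_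
        have := hmin d ((hgt d hd).2 ⟨hdR, h0⟩) hd
        omega
      have habove : ∀ c, y < c → carrier R (insert a A) c = 0 ∧ carrier R A c = 0 := fun c hc =>
        (carrier_insert_max_of_gt ha (by omega)).2 ⟨y, hay, hc, hyR, hy0⟩
      have eY : lowY R (insert a A) = insert a ((lowY R A).erase y) := by
        ext c
        rw [Finset.mem_insert, Finset.mem_erase]
        rcases lt_trichotomy c a with hc | rfl | hc
        · rw [(hle c hc.le).2 hc.ne]
          have : c ≠ y := by omega
          have : c ≠ a := by omega
          tauto
        · exact ⟨fun _ => Or.inl rfl, fun _ => hself⟩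
        · rw [hgt'' c hc, hgt c hc]
          have hca : c ≠ a := by omega
          rcases lt_trichotomy c y with hcy | rfl | hcy
          · have h1 := hbelow c hc hcy.le
            have h2 : ¬(c ∈ R ∧ carrier R A c = 0) := fun h => by
              have := hmin c ((hgt c hc).2 h) hc
              omega
            have h3 : ¬carrier R (insert a A) c = 0 := by omega
            tauto
          · have h1 := hbelow c hc le_rfl
            have h3 : ¬carrier R (insert a A) c = 0 := by omega
            tauto
          · obtain ⟨h1, h2⟩ := habove c hcy
            have : c ≠ y := by omega
            rw [h1, h2]
            tauto
      have eX : lowX R (insert a A) = insert y (lowX R A) := by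
        ext c
        rw [Finset.mem_insert]
        rcases le_or_gt c a with hc | hc
        · rw [(hle c hc).1]
          exact (or_iff_right (by omega)).symm
        · rw [mem_lowX, mem_lowX]
          rcases lt_trichotomy c y with hcy | rfl | hcy
          · have h1 := hbelow c hc hcy.le
            have h2 : ¬(c ∈ R ∧ carrier R A c = 0) := fun h => by
              have := hmin c ((hgt c hc).2 h) hc
              omega
            have h3 : ¬carrier R (insert a A) c = 0 := by omega
            have : c ≠ y := by omega
            tauto
          · have h1 := hbelow c hc le_rfl
            have h3 : ¬carrier R (insert a A) c = 0 := by omega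
            tauto
          · obtain ⟨h1, h2⟩ := habove c hcy
            have : c ≠ y := by omega
            tauto
      rw [egInsertRow_of_notMem haS hyS hay hmin, eY, eX, incWord_insert (S := lowX R A)]
      · exact ⟨rfl, rfl⟩
      · intro x hx
        by_contra hlt
        rcases eq_or_lt_of_le (not_lt.1 hlt) with rfl | h
        · exact (mem_lowX.1 hx).2 hy0
        · exact (mem_lowX.1 hx).2 (habove x h).2
    · push Not at hex
      have hall : ∀ c, a < c → carrier R (insert a A) c = carrier R A c + 1 := by
        intro c hc
        refine (carrier_insert_max_of_gt ha hc).1 fun d hd hdc hdR h0 => ?_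
        have := hex d ((hgt d hd).2 ⟨hdR, h0⟩)
        omega
      have hnone : ∀ c, a < c → ¬(c ∈ R ∧ carrier R A c = 0) := fun c hc h => by
        have := hex c ((hgt c hc).2 h)
        omega
      have eY : lowY R (insert a A) = insert a (lowY R A) := by
        ext c
        rw [Finset.mem_insert]
        rcases lt_trichotomy c a with hc | rfl | hc
        · rw [(hle c hc.le).2 hc.ne]
          have : c ≠ a := by omega
          tauto
        · exact ⟨fun _ => Or.inl rfl, fun _ => hself⟩
        · rw [hgt'' c hc, hgt c hc]
          have := hall c hc
          have := hnone c hc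
          have hca : c ≠ a := by omega
          have h3 : ¬carrier R (insert a A) c = 0 := by omega
          tauto
      have eX : lowX R (insert a A) = lowX R A := by
        ext c
        rcases le_or_gt c a with hc | hc
        · exact (hle c hc).1
        · rw [mem_lowX, mem_lowX]
          have := hall c hc
          have := hnone c hc
          have h3 : ¬carrier R (insert a A) c = 0 := by omega
          tauto
      rw [egInsertRow_of_forall_lt, eY, eX]
      · exact ⟨rfl, by simp⟩
      · intro x hx
        have := hex x hx
        exact lt_of_le_of_ne this fun h => haS (h ▸ hx)

end InsertMax

/-- Letters enter in increasing order, so each one is a new maximum of the part of `A` inserted so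
far. The equality identifies Edelman–Greene row insertion with maximal lowering. -/
theorem rowFold_incWord {R A : Finset ℕ} (hN : NoBlock R A) :
    rowFold (incWord R) (incWord A) = (incWord (lowX R A), incWord (lowY R A)) := by
  induction A using Finset.induction_on_max with
  | empty => rw [incWord_empty, lowX_empty_right, lowY_empty_right, rowFold, incWord_empty]
  | insert a A ha ih =>
    obtain ⟨h1, h2⟩ := egInsertRow_lowY ha hN
    rw [incWord_insert ha, rowFold_append_singleton, ih (hN.of_insert ha), h1, h2]

/-- The rows of the insertion tableau. -/
theorem FacSeq.egP_eq {n ℓ : ℕ} {v : Factors} (h : FacSeq n ℓ v) (k : ℕ) :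
    (egP v k).headD [] = incWord (rowSet v k) ∧ (egP v k).tail = egP (bumped v) k := by
  induction k with
  | zero => exact ⟨by simp [egP, rowSet, incWord_empty], rfl⟩
  | succ k ih =>
    have hN : NoBlock (rowSet v k) (v (k + 1)) := by
      rcases lt_or_ge k ℓ with hk | hk
      · exact (h.red_pair k hk).noBlock
      · rw [h.eq_empty_of_le hk]
        intro a m hle hb
        have := (hb a le_rfl hle).2
        simp at this
    obtain ⟨h1, h2⟩ := foldl_egInsert (incWord (v (k + 1))) (egP v k)
    rw [ih.1, rowFold_incWord hN] at h1 h2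
    rw [ih.2] at h2
    exact ⟨h1, h2⟩

theorem FacSeq.length_getD_egP {n ℓ : ℕ} {v : Factors} (h : FacSeq n ℓ v) (r k : ℕ) :
    ((egP v k).getD r []).length = rowCard v r k := by
  induction r generalizing v with
  | zero =>
    have : (egP v k).getD 0 [] = (egP v k).headD [] := by cases egP v k <;> rfl
    rw [this, (h.egP_eq k).1, length_incWord]
    rfl
  | succ r ih =>
    have : (egP v k).getD (r + 1) [] = (egP v k).tail.getD r [] := by cases egP v k <;> simp
    rw [this, (h.egP_eq k).2, ih h.next, rowCard_bumped]

/-! ### Tableaux in terms of the shapes of their entries -/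

/-- `G r k` is the number of entries at most `k` in row `r` of `T`. -/
structure IsPattern (μ : YoungDiagram) (T : Filling) (G : ℕ → ℕ → ℕ) : Prop where
  outside : ∀ r c, (r, c) ∉ μ → T r c = 0
  le : ∀ r k, G r k ≤ μ.rowLen r
  le_iff : ∀ r c k, (r, c) ∈ μ → (T r c ≤ k ↔ c < G r k)

/-- `G` describes a semistandard tableau of shape `μ` with entries in `{1, …, ℓ}`. -/
structure IsGT (μ : YoungDiagram) (ℓ : ℕ) (G : ℕ → ℕ → ℕ) : Prop where
  mono : ∀ r k, G r k ≤ G r (k + 1)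
  interlace : ∀ r k, G (r + 1) (k + 1) ≤ G r k
  zero : ∀ r, G r 0 = 0
  top : ∀ r, G r ℓ = μ.rowLen r

theorem IsPattern.ext {μ : YoungDiagram} {T T' : Filling} {G : ℕ → ℕ → ℕ} (h : IsPattern μ T G)
    (h' : IsPattern μ T' G) : T = T' := by
  funext r c
  by_cases hc : (r, c) ∈ μ
  · exact le_antisymm ((h.le_iff r c _ hc).2 ((h'.le_iff r c _ hc).1 le_rfl))
      ((h'.le_iff r c _ hc).2 ((h.le_iff r c _ hc).1 le_rfl))
  · rw [h.outside r c hc, h'.outside r c hc]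

theorem exists_pattern {μ : YoungDiagram} {ℓ : ℕ} {T : Filling} (hT : T ∈ tableaux μ ℓ) :
    ∃ G, IsPattern μ T G ∧ IsGT μ ℓ G := by
  classical
  obtain ⟨⟨S, hS⟩, hent⟩ := hT
  -- The count of entries at most `k` is the first column that leaves the shape or has a larger
  -- entry; rows increase weakly, so these entries form an initial segment.
  have hex : ∀ r k, ∃ g, ¬((r, g) ∈ μ ∧ T r g ≤ k) := fun r k =>
    ⟨μ.rowLen r, fun h => lt_irrefl _ (YoungDiagram.mem_iff_lt_rowLen.1 h.1)⟩
  have hlt : ∀ r k c, c < Nat.find (hex r k) ↔ (r, c) ∈ μ ∧ T r c ≤ k := by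
    intro r k c
    constructor
    · intro h
      simpa only [not_not] using Nat.find_min (hex r k) h
    · rintro ⟨h1, h2⟩
      by_contra h
      refine Nat.find_spec (hex r k) ⟨μ.up_left_mem le_rfl (not_lt.1 h) h1, ?_⟩
      refine le_trans ?_ h2
      rw [← hS, ← hS]
      exact S.row_weak_of_le (not_lt.1 h) h1
  have hle : ∀ r k, Nat.find (hex r k) ≤ μ.rowLen r := by
    intro r k
    by_contra h
    exact lt_irrefl _ (YoungDiagram.mem_iff_lt_rowLen.1 ((hlt r k _).1 (not_le.1 h)).1)
  refine ⟨fun r k => Nat.find (hex r k), ⟨fun r c hc => ?_, hle, fun r c k hc => ?_⟩,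
    ⟨fun r k => ?_, fun r k => ?_, fun r => ?_, fun r => ?_⟩⟩
  · rw [← hS]; exact S.zeros hc
  · rw [hlt]; exact (and_iff_right hc).symm
  · refine le_of_forall_lt fun c hc => ?_
    obtain ⟨h1, h2⟩ := (hlt _ _ _).1 hc
    exact (hlt _ _ _).2 ⟨h1, by omega⟩
  · refine le_of_forall_lt fun c hc => ?_
    obtain ⟨h1, h2⟩ := (hlt _ _ _).1 hc
    refine (hlt _ _ _).2 ⟨μ.up_left_mem (Nat.le_succ r) le_rfl h1, ?_⟩
    have := S.col_strict (show r < r + 1 by omega) h1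
    rw [hS, hS] at this
    omega
  · refine Nat.eq_zero_of_not_pos fun h => ?_
    obtain ⟨h1, h2⟩ := (hlt _ _ _).1 h
    have := (hent _ _ h1).1
    omega
  · refine le_antisymm (hle _ _) (le_of_forall_lt fun c hc => ?_)
    have h1 := YoungDiagram.mem_iff_lt_rowLen.2 hc
    exact (hlt _ _ _).2 ⟨h1, (hent _ _ h1).2⟩

theorem IsGT.mono_le {μ : YoungDiagram} {ℓ : ℕ} {G : ℕ → ℕ → ℕ} (h : IsGT μ ℓ G) (r : ℕ) {j k : ℕ}
    (hjk : j ≤ k) : G r j ≤ G r k :=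
  monotone_nat_of_le_succ (h.mono r) hjk

theorem IsGT.anti {μ : YoungDiagram} {ℓ : ℕ} {G : ℕ → ℕ → ℕ} (h : IsGT μ ℓ G) {r s : ℕ} (k : ℕ)
    (hrs : r ≤ s) : G s k ≤ G r k := by
  refine antitone_nat_of_succ_le (f := fun r => G r k) (fun r => ?_) hrs
  cases k with
  | zero => rw [h.zero, h.zero]
  | succ k => exact (h.interlace r k).trans (h.mono r k)

theorem IsPattern.mem_tableaux {μ : YoungDiagram} {ℓ : ℕ} {T : Filling} {G : ℕ → ℕ → ℕ}
    (hT : IsPattern μ T G) (hG : IsGT μ ℓ G) : T ∈ tableaux μ ℓ := by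
  have hpos : ∀ r c, (r, c) ∈ μ → 1 ≤ T r c := by
    intro r c hc
    by_contra h
    have := (hT.le_iff r c 0 hc).1 (by omega)
    rw [hG.zero] at this
    omega
  refine ⟨⟨⟨T, ?_, ?_, ?_⟩, fun _ _ => rfl⟩, fun r c hc => ⟨hpos r c hc, ?_⟩⟩
  · intro r c c' hcc hc'
    exact (hT.le_iff r c _ (μ.up_left_mem le_rfl hcc.le hc')).2
      (hcc.trans ((hT.le_iff r c' _ hc').1 le_rfl))
  · intro r r' c hrr hc
    have h1 := hpos r' c hc
    obtain ⟨k, hk⟩ : ∃ k, T r' c = k + 1 := ⟨T r' c - 1, by omega⟩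
    have h2 := (hT.le_iff r' c (k + 1) hc).1 hk.le
    have h3 := hG.anti (k + 1) (Nat.succ_le_of_lt hrr)
    have h4 := hG.interlace r k
    have h5 := (hT.le_iff r c k (μ.up_left_mem hrr.le le_rfl hc)).2 (by
      rw [Nat.succ_eq_add_one] at h3; omega)
    omega
  · intro r c hc
    exact hT.outside r c hc
  · rw [hT.le_iff r c ℓ hc, hG.top]
    exact YoungDiagram.mem_iff_lt_rowLen.1 hc

/-- The function `G` with the value at `(r, i)` replaced by `m`. -/
def setValue (G : ℕ → ℕ → ℕ) (r i m : ℕ) : ℕ → ℕ → ℕ :=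
  fun s k => if s = r ∧ k = i then m else G s k

theorem setValue_self (G : ℕ → ℕ → ℕ) (r i m : ℕ) : setValue G r i m r i = m := if_pos ⟨rfl, rfl⟩

theorem setValue_of_row_ne (G : ℕ → ℕ → ℕ) {r i m s k : ℕ} (h : s ≠ r) :
    setValue G r i m s k = G s k := if_neg fun h' => h h'.1

theorem setValue_of_ne (G : ℕ → ℕ → ℕ) {r i m s k : ℕ} (h : k ≠ i) :
    setValue G r i m s k = G s k := if_neg fun h' => h h'.2

theorem setValue_setValue (G : ℕ → ℕ → ℕ) {r i m m' : ℕ} (h : m' = G r i) :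
    setValue (setValue G r i m) r i m' = G := by
  funext s k
  unfold setValue
  split_ifs with h1
  · rw [h1.1, h1.2, h]
  · rfl

theorem setEntry_self (T : Filling) (r c m : ℕ) : setEntry T (r, c) m r c = m := if_pos rfl

theorem setEntry_of_ne (T : Filling) {r c m r' c' : ℕ} (h : (r', c') ≠ (r, c)) :
    setEntry T (r, c) m r' c' = T r' c' := if_neg h

/-! ### The effect of changing one entry on the pattern. -/

section Change
variable {μ : YoungDiagram} {T : Filling} {G : ℕ → ℕ → ℕ} {r i : ℕ}

/-- The last `i` of row `r` stands in column `G r i - 1`; only the number of entries at most `i` in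
this row drops. -/
theorem IsPattern.lower (hT : IsPattern μ T G) (hG : ∀ r k, G r k ≤ G r (k + 1)) (hi : 1 ≤ i)
    (h : G r (i - 1) < G r i) :
    IsPattern μ (setEntry T (r, G r i - 1) (i + 1)) (setValue G r i (G r i - 1)) := by
  have hmem : (r, G r i - 1) ∈ μ := YoungDiagram.mem_iff_lt_rowLen.2 (by
    have := hT.le r i; omega)
  have hm := monotone_nat_of_le_succ (hG r)
  refine ⟨fun r' c' hc => ?_, fun r' k => ?_, fun r' c' k hc => ?_⟩
  · have hne : (r', c') ≠ (r, G r i - 1) := fun h' => hc (by rw [h']; exact hmem)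
    rw [setEntry_of_ne T hne, hT.outside r' c' hc]
  · have := hT.le r' k
    unfold setValue
    split_ifs with h1
    · rw [← h1.1, ← h1.2]; omega
    · exact this
  · by_cases hx : (r', c') = (r, G r i - 1)
    · obtain ⟨rfl, rfl⟩ := Prod.mk.inj hx
      rw [setEntry_self]
      rcases lt_trichotomy k i with hk | rfl | hk
      · rw [setValue_of_ne G hk.ne]
        have : G r' k ≤ G r' (i - 1) := hm (by omega)
        omega
      · rw [setValue_self]; omega
      · rw [setValue_of_ne G hk.ne']
        have : G r' i ≤ G r' k := hm hk.le
        omega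
    · rw [setEntry_of_ne T hx, hT.le_iff r' c' k hc]
      by_cases h1 : r' = r ∧ k = i
      · obtain ⟨rfl, rfl⟩ := h1
        rw [setValue_self]
        have : c' ≠ G r' k - 1 := fun h' => hx (by rw [h'])
        omega
      · rw [setValue, if_neg h1]

theorem IsPattern.raise (hT : IsPattern μ T G) (hG : ∀ r k, G r k ≤ G r (k + 1))
    (h : G r i < G r (i + 1)) :
    IsPattern μ (setEntry T (r, G r i) i) (setValue G r i (G r i + 1)) := by
  have hmem : (r, G r i) ∈ μ := YoungDiagram.mem_iff_lt_rowLen.2 (by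
    have := hT.le r (i + 1); omega)
  have hm := monotone_nat_of_le_succ (hG r)
  refine ⟨fun r' c' hc => ?_, fun r' k => ?_, fun r' c' k hc => ?_⟩
  · have hne : (r', c') ≠ (r, G r i) := fun h' => hc (by rw [h']; exact hmem)
    rw [setEntry_of_ne T hne, hT.outside r' c' hc]
  · have := hT.le r (i + 1)
    have := hT.le r' k
    unfold setValue
    split_ifs with h1
    · rw [h1.1]; omega
    · assumption
  · by_cases hx : (r', c') = (r, G r i)
    · obtain ⟨rfl, rfl⟩ := Prod.mk.inj hx
      rw [setEntry_self]
      rcases lt_trichotomy k i with hk | rfl | hk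
      · rw [setValue_of_ne G hk.ne]
        have : G r' k ≤ G r' i := hm hk.le
        omega
      · rw [setValue_self]; omega
      · rw [setValue_of_ne G hk.ne']
        have : G r' (i + 1) ≤ G r' k := hm hk
        omega
    · rw [setEntry_of_ne T hx, hT.le_iff r' c' k hc]
      by_cases h1 : r' = r ∧ k = i
      · obtain ⟨rfl, rfl⟩ := h1
        rw [setValue_self]
        have : c' ≠ G r' k := fun h' => hx (by rw [h'])
        omega
      · rw [setValue, if_neg h1]

end Change

/-! ### The signature of a tableau -/

/-- The cells of row `r` from column `hi - 1` down to column `lo`. -/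
def descCells (r lo hi : ℕ) : List (ℕ × ℕ) :=
  ((List.range (hi - lo)).map fun t => (r, lo + t)).reverse

theorem descCells_eq_nil {r lo hi : ℕ} (h : hi ≤ lo) : descCells r lo hi = [] := by
  rw [descCells, Nat.sub_eq_zero_of_le h]; rfl

theorem descCells_succ {r lo hi : ℕ} (h : lo ≤ hi) :
    descCells r lo (hi + 1) = (r, hi) :: descCells r lo hi := by
  rw [descCells, descCells, show hi + 1 - lo = hi - lo + 1 by omega, List.range_succ]
  simp
  omega

theorem length_descCells (r lo hi : ℕ) : (descCells r lo hi).length = hi - lo := by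
  simp [descCells]

theorem head?_descCells_append {r lo hi : ℕ} (h : lo < hi) (l : List (ℕ × ℕ)) :
    (descCells r lo hi ++ l).head? = some (r, hi - 1) := by
  obtain ⟨k, rfl⟩ : ∃ k, hi = k + 1 := ⟨hi - 1, by omega⟩
  rw [descCells_succ (by omega)]
  rfl

theorem getLast?_descCells {r lo hi : ℕ} (h : lo < hi) :
    (descCells r lo hi).getLast? = some (r, lo) := by
  obtain ⟨k, hk⟩ : ∃ k, hi - lo = k + 1 := ⟨hi - lo - 1, by omega⟩
  rw [descCells, hk, List.getLast?_reverse, List.range_succ_eq_map]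
  simp

/-- The effect of reading a row on the state of the bracketing. -/
theorem foldl_signatureStep_row {T : Filling} {i r : ℕ} {α β γ : ℕ} (hi : 1 ≤ i) (hαβ : α ≤ β)
    (hβγ : β ≤ γ) (m : ℕ) (h : ∀ c < m, (T r c ≤ i - 1 ↔ c < α) ∧ (T r c ≤ i ↔ c < β) ∧
      (T r c ≤ i + 1 ↔ c < γ)) (U K : List (ℕ × ℕ)) :
    ((List.range m).map fun c => (r, c)).foldl (signatureStep T i) (U, K) =
      (descCells r (α + K.length) (min m β) ++ U,
        descCells r β (min m γ) ++ K.drop (min m β - α)) := by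
  induction m with
  | zero => simp [descCells_eq_nil]
  | succ m ih =>
    rw [List.range_succ, List.map_append, List.foldl_append, ih fun c hc => h c (by omega)]
    obtain ⟨h1, h2, h3⟩ := h m (by omega)
    simp only [List.map_cons, List.map_nil, List.foldl_cons, List.foldl_nil, signatureStep]
    rcases lt_or_ge m α with c1 | c1
    · have : T r m ≤ i - 1 := h1.2 c1
      rw [if_neg (by omega), if_neg (by omega), descCells_eq_nil, descCells_eq_nil,
        descCells_eq_nil, descCells_eq_nil, Nat.sub_eq_zero_of_le, Nat.sub_eq_zero_of_le] <;> omega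
    · rcases lt_or_ge m β with c2 | c2
      · have e1 : T r m = i := by have := h2.2 c2; omega
        rw [if_neg (by omega), if_pos e1, min_eq_left c2.le, min_eq_left (by omega : m ≤ γ),
          min_eq_left (by omega : m + 1 ≤ β), min_eq_left (by omega : m + 1 ≤ γ),
          descCells_eq_nil (by omega : m ≤ β), descCells_eq_nil (by omega : m + 1 ≤ β),
          List.nil_append, List.nil_append, show m + 1 - α = m - α + 1 by omega]
        -- The first `K.length` entries `i` of the row close letters left open by the rows read
        -- before; only later ones are unpaired.
        rcases lt_or_ge (m - α) K.length with c3 | c3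
        · rw [List.drop_eq_getElem_cons c3, descCells_eq_nil (by omega : m ≤ α + K.length),
            descCells_eq_nil (by omega : m + 1 ≤ α + K.length)]
        · rw [List.drop_eq_nil_of_le c3, List.drop_eq_nil_of_le (by omega : K.length ≤ m - α + 1),
            descCells_succ (by omega : α + K.length ≤ m)]
          rfl
      · rw [min_eq_right c2, min_eq_right (by omega : β ≤ m + 1)]
        rcases lt_or_ge m γ with c3 | c3
        · have e1 : T r m = i + 1 := by have := h3.2 c3; omega
          rw [if_pos e1, min_eq_left c3.le, min_eq_left (by omega : m + 1 ≤ γ), descCells_succ c2]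
          rfl
        · have e1 : ¬T r m ≤ i + 1 := fun h' => by have := h3.1 h'; omega
          rw [if_neg (by omega), if_neg (by omega), min_eq_right c3,
            min_eq_right (by omega : γ ≤ m + 1)]

theorem rowLen_eq_zero {μ : YoungDiagram} {r : ℕ} (h : μ.colLen 0 ≤ r) : μ.rowLen r = 0 := by
  by_contra h0
  have h1 := YoungDiagram.mem_iff_lt_rowLen.2 (Nat.pos_of_ne_zero h0)
  have := YoungDiagram.mem_iff_lt_colLen.1 h1
  omega

/-- The states of the bracketing after the rows from the top to row `r` have been read. -/
theorem IsPattern.exists_states {μ : YoungDiagram} {T : Filling} {G : ℕ → ℕ → ℕ} {i : ℕ}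
    (hT : IsPattern μ T G) (hG : ∀ r k, G r k ≤ G r (k + 1)) (hi : 1 ≤ i) :
    ∃ U K : ℕ → List (ℕ × ℕ), signature μ i T = (U 0, K 0) ∧
      (∃ h, ∀ r, h ≤ r → U r = [] ∧ K r = []) ∧
      (∀ r, U r = descCells r (G r (i - 1) + (K (r + 1)).length) (G r i) ++ U (r + 1)) ∧
      ∀ r, K r = descCells r (G r i) (G r (i + 1)) ++ (K (r + 1)).drop (G r i - G r (i - 1)) := by
  set h := μ.colLen 0 with hh
  set st : ℕ → List (ℕ × ℕ) × List (ℕ × ℕ) := fun r =>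
    ((List.range (h - r)).reverse.flatMap fun t =>
      (List.range (μ.rowLen (r + t))).map fun c => (r + t, c)).foldl (signatureStep T i) ([], [])
    with hst
  have htop : ∀ r, h ≤ r → st r = ([], []) := by
    intro r hr
    simp only [hst]
    rw [Nat.sub_eq_zero_of_le hr]
    rfl
  have hstep : ∀ r, st r = (descCells r (G r (i - 1) + (st (r + 1)).2.length) (G r i) ++
      (st (r + 1)).1, descCells r (G r i) (G r (i + 1)) ++
      (st (r + 1)).2.drop (G r i - G r (i - 1))) := by
    intro r
    rcases lt_or_ge r h with hr | hr
    · have e : st r = ((List.range (μ.rowLen r)).map fun c => (r, c)).foldl (signatureStep T i)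
          (st (r + 1)) := by
        simp only [hst]
        rw [show h - r = h - (r + 1) + 1 by omega, List.range_succ_eq_map, List.reverse_cons,
          List.flatMap_append, List.foldl_append, ← List.map_reverse, List.flatMap_map]
        have hf : (fun t => (List.range (μ.rowLen (r + Nat.succ t))).map fun c =>
            (r + Nat.succ t, c)) = fun t => (List.range (μ.rowLen (r + 1 + t))).map fun c =>
            (r + 1 + t, c) := by
          funext t
          rw [show r + Nat.succ t = r + 1 + t by omega]
        rw [hf, List.flatMap_singleton, add_zero]
      have hm := monotone_nat_of_le_succ (hG r)
      have e2 := foldl_signatureStep_row (T := T) (i := i) (r := r) hi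
        (hm (by omega : i - 1 ≤ i)) (hG r i) (μ.rowLen r) (fun c hc => by
          have hmem := YoungDiagram.mem_iff_lt_rowLen.2 hc
          exact ⟨hT.le_iff r c _ hmem, hT.le_iff r c _ hmem, hT.le_iff r c _ hmem⟩)
        (st (r + 1)).1 (st (r + 1)).2
      rw [min_eq_right (hT.le r i), min_eq_right (hT.le r (i + 1))] at e2
      rw [e]
      exact e2
    · have h0 : ∀ k, G r k = 0 := fun k => by
        have := hT.le r k
        rw [rowLen_eq_zero (by omega)] at this
        omega
      rw [htop r hr, htop (r + 1) (by omega), h0, h0, h0]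
      simp [descCells_eq_nil]
  refine ⟨fun r => (st r).1, fun r => (st r).2, ?_, ⟨h, fun r hr => by simp [htop r hr]⟩,
    fun r => congrArg Prod.fst (hstep r), fun r => congrArg Prod.snd (hstep r)⟩
  simp only [hst, signature, readingCells, zero_add, Nat.sub_zero, hh]

/-- `K r` is the number of unpaired letters `i + 1` after the rows from the top to row `r` have been
read. -/
structure IsOpenCount (G : ℕ → ℕ → ℕ) (i : ℕ) (K : ℕ → ℕ) : Prop where
  step : ∀ r, K r = K (r + 1) - (G r i - G r (i - 1)) + (G r (i + 1) - G r i)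
  top : ∃ h, ∀ r, h ≤ r → K r = 0

theorem IsOpenCount.unique {G : ℕ → ℕ → ℕ} {i : ℕ} {K K' : ℕ → ℕ} (hK : IsOpenCount G i K)
    (hK' : IsOpenCount G i K') : K = K' := by
  obtain ⟨h, hh⟩ := hK.top
  obtain ⟨h', hh'⟩ := hK'.top
  have main : ∀ d r, max h h' ≤ r + d → K r = K' r := by
    intro d
    induction d with
    | zero => intro r hr; rw [hh r (by omega), hh' r (by omega)]
    | succ d ih => intro r hr; rw [hK.step, hK'.step, ih (r + 1) (by omega)]
  exact funext fun r => main (max h h') r (by omega)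

section Operators
variable {μ : YoungDiagram} {T : Filling} {G : ℕ → ℕ → ℕ} {i : ℕ} {K : ℕ → ℕ}

/-- The states of the bracketing, with the number of open letters given by `K`. -/
theorem IsPattern.exists_states_of_openCount (hT : IsPattern μ T G)
    (hG : ∀ r k, G r k ≤ G r (k + 1)) (hi : 1 ≤ i) (hK : IsOpenCount G i K) :
    ∃ U L : ℕ → List (ℕ × ℕ), signature μ i T = (U 0, L 0) ∧
      (∃ h, ∀ r, h ≤ r → U r = []) ∧ (∀ r, (L r).length = K r) ∧
      (∀ r, U r = descCells r (G r (i - 1) + K (r + 1)) (G r i) ++ U (r + 1)) ∧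
      ∀ r, L r = descCells r (G r i) (G r (i + 1)) ++ (L (r + 1)).drop (G r i - G r (i - 1)) := by
  obtain ⟨U, L, h1, ⟨h, h2⟩, h3, h4⟩ := hT.exists_states hG hi
  have e : (fun r => (L r).length) = K := by
    refine IsOpenCount.unique ⟨fun r => ?_, h, fun r hr => by rw [(h2 r hr).2]; rfl⟩ hK
    rw [h4 r, List.length_append, length_descCells, List.length_drop]
    omega
  have e' : ∀ r, (L r).length = K r := fun r => congrFun e r
  refine ⟨U, L, h1, ⟨h, fun r hr => (h2 r hr).1⟩, e', fun r => ?_, h4⟩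
  rw [h3 r, e']

/-- Row 0 is read last, so the rightmost unpaired `i` lies in the smallest row with more entries `i`
than open letters reaching it, and it is the last `i` there. -/
theorem IsPattern.tabF_eq (hT : IsPattern μ T G) (hG : ∀ r k, G r k ≤ G r (k + 1)) (hi : 1 ≤ i)
    (hK : IsOpenCount G i K) {r : ℕ} (h1 : ∀ s < r, G s i - G s (i - 1) ≤ K (s + 1))
    (h2 : K (r + 1) < G r i - G r (i - 1)) :
    tabF μ i T = some (setEntry T (r, G r i - 1) (i + 1)) := by
  obtain ⟨U, L, e1, -, e3, e4, e5⟩ := hT.exists_states_of_openCount hG hi hK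
  have hU : ∀ s ≤ r, U 0 = U s := by
    intro s hs
    induction s with
    | zero => rfl
    | succ s ih =>
      rw [ih (by omega), e4 s, descCells_eq_nil (by have := h1 s (by omega); omega)]
      rfl
  rw [tabF, e1]
  simp only
  rw [hU r le_rfl, e4 r, head?_descCells_append (by omega)]
  rfl

theorem IsPattern.tabF_eq_none (hT : IsPattern μ T G) (hG : ∀ r k, G r k ≤ G r (k + 1))
    (hi : 1 ≤ i) (hK : IsOpenCount G i K) (h1 : ∀ s, G s i - G s (i - 1) ≤ K (s + 1)) :
    tabF μ i T = none := by
  obtain ⟨U, L, e1, ⟨h, e2⟩, e3, e4, e5⟩ := hT.exists_states_of_openCount hG hi hK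
  have hU : ∀ s, U 0 = U s := by
    intro s
    induction s with
    | zero => rfl
    | succ s ih =>
      rw [ih, e4 s, descCells_eq_nil (by have := h1 s; omega)]
      rfl
  rw [tabF, e1]
  simp only
  rw [hU h, e2 h le_rfl]
  rfl

theorem getLast?_append_drop {l l' : List (ℕ × ℕ)} {a : ℕ} (h : a < l'.length) :
    (l ++ l'.drop a).getLast? = l'.getLast? := by
  rw [List.getLast?_append_of_ne_nil _ (by
    intro h'
    have := congrArg List.length h'
    rw [List.length_drop, List.length_nil] at this
    omega), List.getLast?_drop, if_neg (by omega)]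

/-- The leftmost unpaired `i + 1` is the bottom of the stack. Row `r` closes everything inherited,
so the bottom becomes its first `i + 1`; the rows `s < r` have too few entries `i` to reach it. -/
theorem IsPattern.tabE_eq (hT : IsPattern μ T G) (hG : ∀ r k, G r k ≤ G r (k + 1)) (hi : 1 ≤ i)
    (hK : IsOpenCount G i K) {r : ℕ} (h1 : ∀ s < r, G s i - G s (i - 1) < K (s + 1))
    (h2 : K (r + 1) ≤ G r i - G r (i - 1)) (h3 : G r i < G r (i + 1)) :
    tabE μ i T = some (setEntry T (r, G r i) i) := by
  obtain ⟨U, L, e1, -, e3, e4, e5⟩ := hT.exists_states_of_openCount hG hi hK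
  have hL : ∀ s ≤ r, (L 0).getLast? = (L s).getLast? := by
    intro s hs
    induction s with
    | zero => rfl
    | succ s ih =>
      rw [ih (by omega), e5 s, getLast?_append_drop (by rw [e3]; exact h1 s (by omega))]
  rw [tabE, e1]
  simp only
  rw [hL r le_rfl, e5 r, List.drop_eq_nil_of_le (by rw [e3]; exact h2), List.append_nil,
    getLast?_descCells h3]
  rfl

theorem IsPattern.tabE_eq_none (hT : IsPattern μ T G) (hG : ∀ r k, G r k ≤ G r (k + 1))
    (hi : 1 ≤ i) (hK : IsOpenCount G i K) (h0 : K 0 = 0) : tabE μ i T = none := by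
  obtain ⟨U, L, e1, -, e3, e4, e5⟩ := hT.exists_states_of_openCount hG hi hK
  rw [tabE, e1]
  simp only
  rw [List.eq_nil_of_length_eq_zero ((e3 0).trans h0)]
  rfl

theorem IsPattern.exists_openCount (hT : IsPattern μ T G) (hG : ∀ r k, G r k ≤ G r (k + 1))
    (hi : 1 ≤ i) : ∃ K, IsOpenCount G i K := by
  obtain ⟨U, L, h1, ⟨h, h2⟩, h3, h4⟩ := hT.exists_states hG hi
  refine ⟨fun r => (L r).length, fun r => ?_, h, fun r hr => by rw [(h2 r hr).2]; rfl⟩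
  rw [h4 r, List.length_append, length_descCells, List.length_drop]
  omega

end Operators

/-! ### The crystal operators on tableaux -/

section TableauCrystal
variable {μ : YoungDiagram} {ℓ i : ℕ} {T T' : Filling}

theorem tabF_eq_some_cases {G : ℕ → ℕ → ℕ} {K : ℕ → ℕ} (hT : IsPattern μ T G)
    (hG : ∀ r k, G r k ≤ G r (k + 1)) (hi : 1 ≤ i) (hK : IsOpenCount G i K)
    (h : tabF μ i T = some T') :
    ∃ r, (∀ s < r, G s i - G s (i - 1) ≤ K (s + 1)) ∧ K (r + 1) < G r i - G r (i - 1) ∧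
      T' = setEntry T (r, G r i - 1) (i + 1) := by
  classical
  by_cases hex : ∃ r, K (r + 1) < G r i - G r (i - 1)
  · have h1 : ∀ s < Nat.find hex, G s i - G s (i - 1) ≤ K (s + 1) := fun s hs =>
      not_lt.1 (Nat.find_min hex hs)
    refine ⟨Nat.find hex, h1, Nat.find_spec hex, ?_⟩
    rw [hT.tabF_eq hG hi hK h1 (Nat.find_spec hex)] at h
    exact (Option.some.inj h).symm
  · push Not at hex
    rw [hT.tabF_eq_none hG hi hK hex] at h
    cases h

/-- Take the smallest row that closes all inherited letters. Letters are still open after it, by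
`h0` or by minimality, so it must contain an `i + 1`. -/
theorem exists_leftmost {G : ℕ → ℕ → ℕ} {K : ℕ → ℕ} (hK : IsOpenCount G i K) (h0 : K 0 ≠ 0) :
    ∃ r, (∀ s < r, G s i - G s (i - 1) < K (s + 1)) ∧ K (r + 1) ≤ G r i - G r (i - 1) ∧
      G r i < G r (i + 1) ∧ K r = G r (i + 1) - G r i := by
  classical
  have hex : ∃ r, K (r + 1) ≤ G r i - G r (i - 1) := by
    obtain ⟨h, hh⟩ := hK.top
    exact ⟨h, by rw [hh _ (by omega)]; omega⟩
  have h1 : ∀ s < Nat.find hex, G s i - G s (i - 1) < K (s + 1) := fun s hs =>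
    not_le.1 (Nat.find_min hex hs)
  have h2 := Nat.find_spec hex
  refine ⟨Nat.find hex, h1, h2, ?_⟩
  generalize Nat.find hex = r at h1 h2 ⊢
  have h3 := hK.step r
  have h4 : K r ≠ 0 := by
    cases r with
    | zero => exact h0
    | succ s => have := h1 s (by omega); omega
  omega

theorem tabE_eq_some_cases {G : ℕ → ℕ → ℕ} {K : ℕ → ℕ} (hT : IsPattern μ T G)
    (hG : ∀ r k, G r k ≤ G r (k + 1)) (hi : 1 ≤ i) (hK : IsOpenCount G i K)
    (h : tabE μ i T = some T') :
    ∃ r, (∀ s < r, G s i - G s (i - 1) < K (s + 1)) ∧ K (r + 1) ≤ G r i - G r (i - 1) ∧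
      G r i < G r (i + 1) ∧ K r = G r (i + 1) - G r i ∧ T' = setEntry T (r, G r i) i := by
  have h0 : K 0 ≠ 0 := fun h0 => by
    rw [hT.tabE_eq_none hG hi hK h0] at h
    cases h
  obtain ⟨r, h1, h2, h3, h4⟩ := exists_leftmost hK h0
  refine ⟨r, h1, h2, h3, h4, ?_⟩
  rw [hT.tabE_eq hG hi hK h1 h2 h3] at h
  exact (Option.some.inj h).symm

/-- The drop of the sum of the entries is the measure for the inductions that raise to highest
weight. -/
theorem tabE_mem (hT : T ∈ tableaux μ ℓ) (hi : 1 ≤ i) (hi' : i < ℓ) (h : tabE μ i T = some T') :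
    T' ∈ tableaux μ ℓ ∧ tabF μ i T' = some T ∧
      ∑ x ∈ μ.cells, T' x.1 x.2 < ∑ x ∈ μ.cells, T x.1 x.2 := by
  obtain ⟨G, hP, hG⟩ := exists_pattern hT
  obtain ⟨K, hK⟩ := hP.exists_openCount hG.mono hi
  obtain ⟨r, h1, h2, h3, h4, rfl⟩ := tabE_eq_some_cases hP hG.mono hi hK h
  have hP' := hP.raise hG.mono h3
  set G' := setValue G r i (G r i + 1) with hG'
  have v1 : G' r i = G r i + 1 := setValue_self _ _ _ _
  have v2 : ∀ s k, s ≠ r → G' s k = G s k := fun s k => setValue_of_row_ne G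
  have v3 : ∀ s k, k ≠ i → G' s k = G s k := fun s k => setValue_of_ne G
  have v4 : ∀ s k, G s k ≤ G' s k := fun s k => by
    by_cases hs : s = r
    · by_cases hk : k = i
      · rw [hs, hk, v1]; omega
      · rw [v3 s k hk]
    · rw [v2 s k hs]
  have hGT : IsGT μ ℓ G' := by
    refine ⟨fun s k => ?_, fun s k => ?_, fun s => ?_, fun s => ?_⟩
    · by_cases hk : k = i
      · subst hk
        rw [v3 s (k + 1) (by omega)]
        by_cases hs : s = r
        · rw [hs, v1]; omega
        · rw [v2 s k hs]; exact hG.mono s k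
      · rw [v3 s k hk]
        exact (hG.mono s k).trans (v4 _ _)
    · by_cases hs : s + 1 = r ∧ k + 1 = i
      -- The only critical inequality. Row `s` has fewer entries `i` than there are open letters in
      -- row `s + 1`, and these are bounded by interlacing; hence its entries below `i` extend
      -- beyond column `G (s + 1) i`.
      · obtain ⟨rfl, rfl⟩ := hs
        rw [v1, v3 s k (by omega)]
        have b1 := h1 s (by omega)
        have b2 := hG.interlace s (k + 1)
        have b3 := hG.mono s k
        rw [Nat.add_sub_cancel] at b1
        omega
      · rw [show G' (s + 1) (k + 1) = G (s + 1) (k + 1) from if_neg hs]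
        exact (hG.interlace s k).trans (v4 _ _)
    · rw [v3 s 0 (by omega)]; exact hG.zero s
    · rw [v3 s ℓ (by omega)]; exact hG.top s
  -- One open letter disappears in row `r`, and all rows read afterwards inherit one fewer.
  have hK' : IsOpenCount G' i fun s => if s ≤ r then K s - 1 else K s := by
    refine ⟨fun s => ?_, ?_⟩
    · have b1 := hK.step s
      rw [v3 s (i - 1) (by omega), v3 s (i + 1) (by omega)]
      have b2 := hG.mono s i
      have b3 := hG.mono_le s (by omega : i - 1 ≤ i)
      rcases lt_trichotomy s r with hs | rfl | hs
      · rw [if_pos hs.le, if_pos (by omega), v2 s i hs.ne]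
        have := h1 s hs
        omega
      · rw [if_pos le_rfl, if_neg (by omega), v1]
        omega
      · rw [if_neg (by omega), if_neg (by omega), v2 s i hs.ne']
        exact b1
    · obtain ⟨h, hh⟩ := hK.top
      exact ⟨h, fun s hs => by rw [hh s hs]; split_ifs <;> rfl⟩
  have hF := hP'.tabF_eq hGT.mono hi hK' (r := r) (fun s hs => by
    rw [if_pos (by omega), v2 s i hs.ne, v2 s (i - 1) hs.ne]
    have := h1 s hs
    omega) (by
    rw [if_neg (by omega), v1, v3 r (i - 1) (by omega)]
    have := hG.mono_le r (by omega : i - 1 ≤ i)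
    omega)
  have hL := hP'.lower hGT.mono hi (r := r) (by
    rw [v1, v3 r (i - 1) (by omega)]
    have := hG.mono_le r (by omega : i - 1 ≤ i)
    omega)
  rw [hG', setValue_setValue _ (by rw [← hG', v1]; omega), ← hG'] at hL
  refine ⟨hP'.mem_tableaux hGT, by rw [hF, hL.ext hP], ?_⟩
  have hmem : (r, G r i) ∈ μ := YoungDiagram.mem_iff_lt_rowLen.2 (by
    have := hP.le r (i + 1); omega)
  have hlt : i < T r (G r i) := by
    have := hP.le_iff r (G r i) i hmem
    omega
  refine Finset.sum_lt_sum (fun x _ => ?_) ⟨(r, G r i), (YoungDiagram.mem_cells _).2 hmem, ?_⟩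
  · by_cases hx : (x.1, x.2) = (r, G r i)
    · obtain ⟨e1, e2⟩ := Prod.mk.inj hx
      rw [e1, e2, setEntry_self]
      exact hlt.le
    · rw [setEntry_of_ne T hx]
  · rw [setEntry_self]
    exact hlt

theorem tabE_of_tabF (hT : T ∈ tableaux μ ℓ) (hi : 1 ≤ i) (h : tabF μ i T = some T') :
    tabE μ i T' = some T := by
  obtain ⟨G, hP, hG⟩ := exists_pattern hT
  obtain ⟨K, hK⟩ := hP.exists_openCount hG.mono hi
  obtain ⟨r, h1, h2, rfl⟩ := tabF_eq_some_cases hP hG.mono hi hK h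
  have hP' := hP.lower hG.mono hi (r := r) (by omega)
  set G' := setValue G r i (G r i - 1) with hG'
  have v1 : G' r i = G r i - 1 := setValue_self _ _ _ _
  have v2 : ∀ s k, s ≠ r → G' s k = G s k := fun s k => setValue_of_row_ne G
  have v3 : ∀ s k, k ≠ i → G' s k = G s k := fun s k => setValue_of_ne G
  have hmono : ∀ s k, G' s k ≤ G' s (k + 1) := by
    intro s k
    by_cases hs : s = r
    · subst hs
      by_cases hk : k = i
      · subst hk
        rw [v1, v3 s (k + 1) (by omega)]
        have := hG.mono s k
        omega
      · rw [v3 s k hk]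
        by_cases hk' : k + 1 = i
        · subst hk'
          rw [v1]
          rw [Nat.add_sub_cancel] at h2
          omega
        · rw [v3 s (k + 1) hk']
          exact hG.mono s k
    · rw [v2 s k hs, v2 s (k + 1) hs]
      exact hG.mono s k
  have hK' : IsOpenCount G' i fun s => if s ≤ r then K s + 1 else K s := by
    refine ⟨fun s => ?_, ?_⟩
    · have b1 := hK.step s
      rw [v3 s (i - 1) (by omega), v3 s (i + 1) (by omega)]
      have b2 := hG.mono s i
      have b3 := hG.mono_le s (by omega : i - 1 ≤ i)
      rcases lt_trichotomy s r with hs | rfl | hs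
      · rw [if_pos hs.le, if_pos (by omega), v2 s i hs.ne]
        have := h1 s hs
        omega
      · rw [if_pos le_rfl, if_neg (by omega), v1]
        omega
      · rw [if_neg (by omega), if_neg (by omega), v2 s i hs.ne']
        exact b1
    · obtain ⟨h, hh⟩ := hK.top
      exact ⟨max h (r + 1), fun s hs => by
        rw [if_neg (by omega), hh s (by omega)]⟩
  have hE := hP'.tabE_eq hmono hi hK' (r := r) (fun s hs => by
    rw [if_pos (by omega), v2 s i hs.ne, v2 s (i - 1) hs.ne]
    have := h1 s hs
    omega) (by
    rw [if_neg (by omega), v1, v3 r (i - 1) (by omega)]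
    omega) (by
    rw [v1, v3 r (i + 1) (by omega)]
    have := hG.mono r i
    omega)
  have hR := hP'.raise hmono (r := r) (i := i) (by
    rw [v1, v3 r (i + 1) (by omega)]
    have := hG.mono r i
    omega)
  rw [hG', setValue_setValue _ (by rw [← hG', v1]; omega), ← hG'] at hR
  rw [hE, hR.ext hP]

/-- Row `r` is constantly `r + 1`. Column strictness gives the lower bound on its entries; the upper
bound comes by going up from row 0, since a row without entries `i` leaves the open letters `i + 1`
of the next row unpaired. -/
theorem highestWeight_pattern {G : ℕ → ℕ → ℕ} (hP : IsPattern μ T G) (hG : IsGT μ ℓ G)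
    (h : IsHighestWeight ℓ (tabCrystal μ) T) (r k : ℕ) :
    G r k = if k ≤ r then 0 else μ.rowLen r := by
  have hzero : ∀ k r, k ≤ r → G r k = 0 := by
    intro k
    induction k with
    | zero => exact fun r _ => hG.zero r
    | succ k ih =>
      intro r hr
      obtain ⟨s, rfl⟩ : ∃ s, r = s + 1 := ⟨r - 1, by omega⟩
      have := hG.interlace s k
      rw [ih s (by omega)] at this
      omega
  have hK : ∀ i, ∃ K, 1 ≤ i → IsOpenCount G i K := by
    intro i
    by_cases hi : 1 ≤ i
    · obtain ⟨K, hK⟩ := hP.exists_openCount hG.mono hi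
      exact ⟨K, fun _ => hK⟩
    · exact ⟨fun _ => 0, fun h => absurd h hi⟩
  choose K hK using hK
  -- If row `r` has no entry `i` and nothing is open after it, then nothing was open before it, so
  -- the next row has no `i + 1`.
  have hK0 : ∀ r i, r < i → i < ℓ → K i r = 0 ∧ G r (i + 1) = G r i := by
    intro r
    induction r with
    | zero =>
      intro i hi hi'
      have h0 : K i 0 = 0 := by
        by_contra h0
        obtain ⟨r, h1, h2, h3, -⟩ := exists_leftmost (hK i hi) h0
        have := hP.tabE_eq hG.mono hi (hK i hi) h1 h2 h3
        have h' : tabE μ i T = none := h i hi hi'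
        rw [h'] at this
        cases this
      have := (hK i hi).step 0
      have := hG.mono 0 i
      omega
    | succ r ih =>
      intro i hi hi'
      have b1 := (ih i (by omega) hi').1
      have b2 := (ih (i - 1) (by omega) (by omega)).2
      have b3 := (hK i (by omega)).step r
      have b4 := (hK i (by omega)).step (r + 1)
      have b5 := hG.mono (r + 1) i
      rw [Nat.sub_add_cancel (by omega)] at b2
      omega
  split_ifs with hk
  · exact hzero k r hk
  · rcases le_or_gt ℓ k with hkl | hkl
    · have := hG.mono_le r hkl
      rw [hG.top] at this
      exact le_antisymm (hP.le r k) this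
    · have : ∀ d, k + d ≤ ℓ → G r (k + d) = G r k := by
        intro d
        induction d with
        | zero => exact fun _ => rfl
        | succ d ih =>
          intro hd
          rw [← ih (by omega)]
          exact (hK0 r (k + d) (by omega) (by omega)).2
      rw [← this (ℓ - k) (by omega), show k + (ℓ - k) = ℓ by omega, hG.top]

theorem highestWeight_tableau_unique (hT : T ∈ tableaux μ ℓ) (hT' : T' ∈ tableaux μ ℓ)
    (h : IsHighestWeight ℓ (tabCrystal μ) T) (h' : IsHighestWeight ℓ (tabCrystal μ) T') :
    T = T' := by
  obtain ⟨G, hP, hG⟩ := exists_pattern hT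
  obtain ⟨G', hP', hG'⟩ := exists_pattern hT'
  have e : G = G' := by
    funext r k
    rw [highestWeight_pattern hP hG h, highestWeight_pattern hP' hG' h']
  subst e
  exact hP.ext hP'

end TableauCrystal

/-! ### The crystal of decreasing factorizations -/

section FactorizationCrystal
variable {n ℓ i : ℕ} {w : Equiv.Perm (Fin n)} {v v' : Factors}

theorem FacSeq.mem (h : FacSeq n ℓ v) {k x : ℕ} (hx : x ∈ v k) : 1 ≤ x ∧ x < n := by
  have hk : 1 ≤ k ∧ k ≤ ℓ := by
    by_contra hk
    rw [h.supp k hk] at hx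
    simp at hx
  refine h.red.mem (X := v k) ?_ hx
  refine List.mem_map.2 ⟨k - 1, List.mem_range.2 (by omega), ?_⟩
  rw [Nat.sub_add_cancel hk.1]

theorem FacSeq.zero_notMem (h : FacSeq n ℓ v) (k : ℕ) : 0 ∉ v k := fun h0 => by
  have := (h.mem h0).1
  omega

theorem FStep.symm (hF : FStep i v v') (hN : NoBlock (v i) (v (i + 1))) : EStep i v' v := by
  obtain ⟨⟨a, m, h⟩, hk⟩ := hF
  exact ⟨⟨a, m, h.eMove hN⟩, fun k h1 h2 => (hk k h1 h2).symm⟩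

theorem EStep.symm (hE : EStep i v v') (hN : NoBlock (v i) (v (i + 1))) : FStep i v' v := by
  obtain ⟨⟨a, m, h⟩, hk⟩ := hE
  exact ⟨⟨a, m, h.fMove hN⟩, fun k h1 h2 => (hk k h1 h2).symm⟩

theorem FStep.card (hF : FStep i v v') (hN : NoBlock (v i) (v (i + 1))) (k : ℕ) :
    (v' k).card + (if k = i then 1 else 0) = (v k).card + if k = i + 1 then 1 else 0 := by
  obtain ⟨⟨a, m, h⟩, hk⟩ := hF
  by_cases h1 : k = i
  · rw [if_pos h1, if_neg (by omega), h1]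
    exact h.card_left
  · by_cases h2 : k = i + 1
    · rw [if_neg h1, if_pos h2, h2]
      exact h.card_right hN
    · rw [if_neg h1, if_neg h2, hk k h1 h2]

theorem factF_mem (hv : v ∈ decreasingFactorizations n w ℓ) (hi : 1 ≤ i) (hi' : i < ℓ)
    (h : factF i v = some v') : v' ∈ decreasingFactorizations n w ℓ ∧ factE i v' = some v := by
  rw [mem_decreasingFactorizations_iff] at hv ⊢
  rw [factF_eq_some_iff] at h
  obtain ⟨h1, h2⟩ := hv.1.fStep hi hi' h
  refine ⟨⟨h1, h2.trans hv.2⟩, ?_⟩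
  rw [factE_eq_some_iff (h1.zero_notMem _)]
  exact h.symm (hv.1.noBlock hi hi')

theorem factE_mem (hv : v ∈ decreasingFactorizations n w ℓ) (hi : 1 ≤ i) (hi' : i < ℓ)
    (h : factE i v = some v') : v' ∈ decreasingFactorizations n w ℓ ∧ factF i v' = some v := by
  rw [mem_decreasingFactorizations_iff] at hv ⊢
  rw [factE_eq_some_iff (hv.1.zero_notMem _)] at h
  have h' := h.symm (hv.1.noBlock hi hi')
  obtain ⟨⟨a, b, hE⟩, hk⟩ := h
  obtain ⟨h1, h2⟩ := hv.1.eStep hi hi' hE hk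
  exact ⟨⟨h1, h2.trans hv.2⟩, factF_eq_some_iff.2 h'⟩

theorem factF_card (hv : v ∈ decreasingFactorizations n w ℓ) (hi : 1 ≤ i) (hi' : i < ℓ)
    (h : factF i v = some v') (k : ℕ) :
    (v' k).card + (if k = i then 1 else 0) = (v k).card + if k = i + 1 then 1 else 0 :=
  (factF_eq_some_iff.1 h).card ((mem_decreasingFactorizations_iff.1 hv).1.noBlock hi hi') k

theorem simpleRoot_apply (i k : ℕ) :
    simpleRoot i k = (if k = i then 1 else 0) - if k = i + 1 then 1 else 0 := by
  simp [simpleRoot, Pi.single_apply]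

theorem factF_wt (hv : v ∈ decreasingFactorizations n w ℓ) (hi : 1 ≤ i) (hi' : i < ℓ)
    (h : factF i v = some v') : factCrystal.wt v' = factCrystal.wt v - simpleRoot i := by
  funext k
  have := factF_card hv hi hi' h k
  rw [Pi.sub_apply, simpleRoot_apply]
  simp only [factCrystal]
  split_ifs at this ⊢ <;> omega

theorem isGreatest_iterOp {X : Type} {B : Set X} {g : X → Option X} {m : X → ℕ}
    (h0 : ∀ b ∈ B, g b = none → m b = 0)
    (h1 : ∀ b ∈ B, ∀ b', g b = some b' → b' ∈ B ∧ m b' + 1 = m b) {b : X} (hb : b ∈ B) :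
    IsGreatest {d | iterOp g d b ≠ none} (m b) := by
  have hnone : ∀ d, (fun o : Option X => o.bind g)^[d] none = none := fun d =>
    Function.iterate_fixed rfl d
  have main : ∀ d, ∀ b ∈ B, iterOp g d b ≠ none ↔ d ≤ m b := by
    intro d
    induction d with
    | zero => intro b _; simp [iterOp]
    | succ d ih =>
      intro b hb
      have e : iterOp g (d + 1) b = (fun o : Option X => o.bind g)^[d] (g b) := rfl
      rw [e]
      cases hg : g b with
      | none => rw [hnone, h0 b hb hg]; simp
      | some b' =>
        obtain ⟨hb', hm⟩ := h1 b hb b' hg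
        have := ih b' hb'
        rw [iterOp] at this
        rw [this]
        omega
  exact ⟨(main _ b hb).2 le_rfl, fun d hd => (main d b hb).1 hd⟩

theorem factF_low (hv : v ∈ decreasingFactorizations n w ℓ) (hi : 1 ≤ i) (hi' : i < ℓ)
    (h : factF i v = some v') :
    (lowX (v' i) (v' (i + 1))).card = (lowX (v i) (v (i + 1))).card := by
  obtain ⟨⟨a, m, hF⟩, -⟩ := factF_eq_some_iff.1 h
  rw [hF.lowX_eq ((mem_decreasingFactorizations_iff.1 hv).1.noBlock hi hi')]

/-- ε counts the unpaired letters of w^{i+1} and φ those of w^i. The set `lowX` is constant along a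
string, so both change by one with the sizes of the factors. -/
theorem factCrystal_isCrystal (hne : (decreasingFactorizations n w ℓ).Nonempty) :
    IsCrystal ℓ factCrystal (decreasingFactorizations n w ℓ) where
  nonempty := hne
  e_mem i hi hi' b hb b' h := (factE_mem hb hi hi' h).1
  f_mem i hi hi' b hb b' h := (factF_mem hb hi hi' h).1
  f_iff_e i hi hi' b hb b' hb' :=
    ⟨fun h => (factF_mem hb hi hi' h).2, fun h => (factE_mem hb' hi hi' h).2⟩
  wt_e i hi hi' b hb b' h := by
    obtain ⟨h1, h2⟩ := factE_mem hb hi hi' h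
    rw [factF_wt h1 hi hi' h2, sub_add_cancel]
  wt_f i hi hi' b hb b' h := factF_wt hb hi hi' h
  strings i hi hi' b hb := by
    refine ⟨eps (b i) (b (i + 1)), (b i).card - (lowX (b i) (b (i + 1))).card,
      isGreatest_iterOp (m := fun b : Factors => eps (b i) (b (i + 1))) (fun c hc h => ?_)
        (fun c hc c' h => ?_) hb,
      isGreatest_iterOp (m := fun b : Factors => (b i).card - (lowX (b i) (b (i + 1))).card)
        (fun c hc h => ?_) (fun c hc c' h => ?_) hb, ?_⟩
    · exact (factE_eq_none_iff
        ((mem_decreasingFactorizations_iff.1 hc).1.zero_notMem _)).1 h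
    · obtain ⟨h1, h2⟩ := factE_mem hc hi hi' h
      refine ⟨h1, ?_⟩
      have b1 := factF_low h1 hi hi' h2
      have b2 := factF_card h1 hi hi' h2 (i + 1)
      have b3 := eps_add_card (c i) (c (i + 1))
      have b4 := eps_add_card (c' i) (c' (i + 1))
      rw [if_neg (by omega), if_pos rfl] at b2
      omega
    · have := forall_carrier_ne_zero_iff.1 (factF_eq_none_iff.1 h)
      omega
    · refine ⟨(factF_mem hc hi hi' h).1, ?_⟩
      have b1 := factF_low hc hi hi' h
      have b2 := factF_card hc hi hi' h i
      have b3 := lowX_card_le (c' i) (c' (i + 1))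
      rw [if_neg (by omega : ¬i = i + 1), if_pos rfl] at b2
      omega
    · have b1 := lowX_card_le (b i) (b (i + 1))
      have b2 := eps_add_card (b i) (b (i + 1))
      simp only [factCrystal]
      omega

end FactorizationCrystal

/-! ### Transport along an isomorphism -/

theorem IsCrystal.iterOp_mem {X : Type} {B : Set X} {g : X → Option X}
    (h : ∀ b ∈ B, ∀ b', g b = some b' → b' ∈ B) (d : ℕ) {b b' : X} (hb : b ∈ B)
    (hd : iterOp g d b = some b') : b' ∈ B := by
  induction d generalizing b' with
  | zero => exact Option.some.inj hd ▸ hb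
  | succ d ih =>
    rw [iterOp, Function.iterate_succ_apply'] at hd
    obtain ⟨c, hc, hc'⟩ := Option.bind_eq_some_iff.1 hd
    exact h c (ih hc) b' hc'

theorem iterOp_map {X X' : Type} {B : Set X} {g : X → Option X} {g' : X' → Option X'} {Φ : X → X'}
    (h : ∀ b ∈ B, ∀ b', g b = some b' → b' ∈ B) (hΦ : ∀ b ∈ B, g' (Φ b) = (g b).map Φ) (d : ℕ)
    {b : X} (hb : b ∈ B) : iterOp g' d (Φ b) = (iterOp g d b).map Φ := by
  induction d with
  | zero => rfl
  | succ d ih =>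
    have e1 : iterOp g' (d + 1) (Φ b) = (iterOp g' d (Φ b)).bind g' :=
      Function.iterate_succ_apply' _ _ _
    have e2 : iterOp g (d + 1) b = (iterOp g d b).bind g := Function.iterate_succ_apply' _ _ _
    rw [e1, e2, ih]
    cases hc : iterOp g d b with
    | none => rfl
    | some c => exact hΦ c (IsCrystal.iterOp_mem h d hb hc)

/-- All axioms involve only the weight and the operators on the given set, so the tableau axioms
follow from those for factorizations. -/
theorem IsCrystalIso.isCrystal {X X' : Type} {ℓ : ℕ} {D : CrystalData X} {B : Set X}
    {D' : CrystalData X'} {B' : Set X'} {Φ : X → X'} (hΦ : IsCrystalIso ℓ D B D' B' Φ)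
    (hB : IsCrystal ℓ D B) : IsCrystal ℓ D' B' := by
  have hsurj : ∀ T ∈ B', ∃ b ∈ B, Φ b = T := fun T hT => hΦ.bijOn.surjOn hT
  have hE : ∀ i, 1 ≤ i → i < ℓ → ∀ b ∈ B, ∀ T, D'.e i (Φ b) = some T →
      ∃ b' ∈ B, D.e i b = some b' ∧ Φ b' = T := by
    intro i hi hi' b hb T h
    rw [hΦ.map_e i hi hi' b hb] at h
    obtain ⟨b', h1, h2⟩ := Option.map_eq_some_iff.1 h
    exact ⟨b', hB.e_mem i hi hi' b hb b' h1, h1, h2⟩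
  have hF : ∀ i, 1 ≤ i → i < ℓ → ∀ b ∈ B, ∀ T, D'.f i (Φ b) = some T →
      ∃ b' ∈ B, D.f i b = some b' ∧ Φ b' = T := by
    intro i hi hi' b hb T h
    rw [hΦ.map_f i hi hi' b hb] at h
    obtain ⟨b', h1, h2⟩ := Option.map_eq_some_iff.1 h
    exact ⟨b', hB.f_mem i hi hi' b hb b' h1, h1, h2⟩
  constructor
  · obtain ⟨b, hb⟩ := hB.nonempty
    exact ⟨Φ b, hΦ.bijOn.mapsTo hb⟩
  · intro i hi hi' T hT T' h
    obtain ⟨b, hb, rfl⟩ := hsurj T hT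
    obtain ⟨b', hb', -, rfl⟩ := hE i hi hi' b hb T' h
    exact hΦ.bijOn.mapsTo hb'
  · intro i hi hi' T hT T' h
    obtain ⟨b, hb, rfl⟩ := hsurj T hT
    obtain ⟨b', hb', -, rfl⟩ := hF i hi hi' b hb T' h
    exact hΦ.bijOn.mapsTo hb'
  · intro i hi hi' T hT T' hT'
    obtain ⟨b, hb, rfl⟩ := hsurj T hT
    obtain ⟨b', hb', rfl⟩ := hsurj T' hT'
    constructor
    · intro h
      obtain ⟨c, hc, h1, h2⟩ := hF i hi hi' b hb _ h
      rw [hΦ.bijOn.injOn hc hb' h2, hB.f_iff_e i hi hi' b hb b' hb'] at h1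
      rw [hΦ.map_e i hi hi' b' hb', h1]
      rfl
    · intro h
      obtain ⟨c, hc, h1, h2⟩ := hE i hi hi' b' hb' _ h
      rw [hΦ.bijOn.injOn hc hb h2, ← hB.f_iff_e i hi hi' b hb b' hb'] at h1
      rw [hΦ.map_f i hi hi' b hb, h1]
      rfl
  · intro i hi hi' T hT T' h
    obtain ⟨b, hb, rfl⟩ := hsurj T hT
    obtain ⟨b', hb', h1, rfl⟩ := hE i hi hi' b hb T' h
    rw [hΦ.map_wt b hb, hΦ.map_wt b' hb', hB.wt_e i hi hi' b hb b' h1]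
  · intro i hi hi' T hT T' h
    obtain ⟨b, hb, rfl⟩ := hsurj T hT
    obtain ⟨b', hb', h1, rfl⟩ := hF i hi hi' b hb T' h
    rw [hΦ.map_wt b hb, hΦ.map_wt b' hb', hB.wt_f i hi hi' b hb b' h1]
  · intro i hi hi' T hT
    obtain ⟨b, hb, rfl⟩ := hsurj T hT
    obtain ⟨ε, φ, h1, h2, h3⟩ := hB.strings i hi hi' b hb
    refine ⟨ε, φ, ?_, ?_, by rw [hΦ.map_wt b hb, h3]⟩
    · convert h1 using 1
      ext d
      rw [Set.mem_ofPred_eq, Set.mem_ofPred_eq,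
        iterOp_map (hB.e_mem i hi hi') (hΦ.map_e i hi hi') d hb, ne_eq, ne_eq,
        Option.map_eq_none_iff]
    · convert h2 using 1
      ext d
      rw [Set.mem_ofPred_eq, Set.mem_ofPred_eq,
        iterOp_map (hB.f_mem i hi hi') (hΦ.map_f i hi hi') d hb, ne_eq, ne_eq,
        Option.map_eq_none_iff]

/-! ### The recording tableau -/

section Recording
variable {n ℓ i : ℕ} {v v' : Factors}

theorem rowCard_zero (v : Factors) (r : ℕ) : rowCard v r 0 = 0 := rfl

namespace FacSeq

theorem rowCard_le_succ (h : FacSeq n ℓ v) (r k : ℕ) : rowCard v r k ≤ rowCard v r (k + 1) := by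
  have := (h.bumped_iterate r).card_rowSet_succ k
  rw [rowCard, rowCard]
  omega

theorem rowCard_mono (h : FacSeq n ℓ v) (r : ℕ) {j k : ℕ} (hjk : j ≤ k) :
    rowCard v r j ≤ rowCard v r k :=
  monotone_nat_of_le_succ (h.rowCard_le_succ r) hjk

theorem rowCard_of_le (h : FacSeq n ℓ v) (r : ℕ) {k : ℕ} (hk : ℓ ≤ k) :
    rowCard v r k = rowCard v r ℓ := by
  induction k, hk using Nat.le_induction with
  | base => rfl
  | succ k hk ih => rw [← ih, rowCard, rowCard, (h.bumped_iterate r).rowSet_succ_of_le hk]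

theorem rowCard_le_last (h : FacSeq n ℓ v) (r k : ℕ) : rowCard v r k ≤ rowCard v r ℓ := by
  rcases le_total k ℓ with hk | hk
  · exact h.rowCard_mono r hk
  · exact (h.rowCard_of_le r hk).le

theorem rowCard_interlace (h : FacSeq n ℓ v) (r k : ℕ) :
    rowCard v (r + 1) (k + 1) ≤ rowCard v r k := by
  rw [rowCard, Function.iterate_succ_apply']
  exact (h.bumped_iterate r).card_rowSet_bumped_le k

theorem card_iterate (h : FacSeq n ℓ v) (r k : ℕ) :
    (bumped^[r] v (k + 1)).card + rowCard v r k =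
      (bumped^[r + 1] v (k + 1)).card + rowCard v r (k + 1) := by
  rw [Function.iterate_succ_apply']
  exact (h.bumped_iterate r).card_eq k

/-- The size of a factor is the number of cells that it creates. -/
theorem card_eq_sum (h : FacSeq n ℓ v) {m k : ℕ} (hk : k + 1 ≤ m) :
    (v (k + 1)).card = ∑ r ∈ Finset.range m, (rowCard v r (k + 1) - rowCard v r k) := by
  have main : ∀ m, (v (k + 1)).card = (bumped^[m] v (k + 1)).card +
      ∑ r ∈ Finset.range m, (rowCard v r (k + 1) - rowCard v r k) := by
    intro m
    induction m with
    | zero => simp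
    | succ m ih =>
      have h1 := h.card_iterate m k
      have h2 := h.rowCard_le_succ m k
      rw [Finset.sum_range_succ, ih]
      omega
  -- The factor `k + 1` never reaches row `m ≥ k + 1`, so each of its letters has created a cell
  -- above in the list of rows.
  rw [main m, bumped_iterate_eq_empty (h.supp 0 (by omega)) m _ hk, Finset.card_empty, zero_add]

theorem sum_card_eq (h : FacSeq n ℓ v) {m : ℕ} (hm : ℓ ≤ m) :
    ∑ k ∈ Finset.range ℓ, (v (k + 1)).card = ∑ r ∈ Finset.range m, rowCard v r ℓ := by
  have e : ∀ k ∈ Finset.range ℓ, (v (k + 1)).card =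
      ∑ r ∈ Finset.range m, (rowCard v r (k + 1) - rowCard v r k) := fun k hk =>
    h.card_eq_sum (by have := Finset.mem_range.1 hk; omega)
  rw [Finset.sum_congr rfl e, Finset.sum_comm]
  refine Finset.sum_congr rfl fun r _ => ?_
  rw [Finset.sum_range_tsub (monotone_nat_of_le_succ (h.rowCard_le_succ r)), rowCard_zero,
    Nat.sub_zero]

theorem mem_rowSet (h : FacSeq n ℓ v) {x : ℕ} (hx : x ∈ rowSet v ℓ) : 1 ≤ x ∧ x < n := by
  have h1 : RedSeq n (facList v ℓ ++ []) := by rw [List.append_nil]; exact h.red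
  exact h1.insert_factors.mem (by simp) hx

/-- By `column_strict` every letter of a row has a strictly smaller letter in the preceding row, so
the lower bound rises by one per row. -/
theorem lt_of_mem_rowSet (h : FacSeq n ℓ v) (r : ℕ) : ∀ x ∈ rowSet (bumped^[r] v) ℓ, r < x := by
  induction r with
  | zero => exact fun x hx => (h.mem_rowSet hx).1
  | succ r ih =>
    intro x hx
    rw [Function.iterate_succ_apply'] at hx
    have h1 := (h.bumped_iterate r).column_strict ℓ x hx
    have h2 := carrier_add_card (rowSet (bumped (bumped^[r] v)) ℓ) (rowSet (bumped^[r] v) ℓ) x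
    have h3 : 0 < ((rowSet (bumped^[r] v) ℓ).filter (· < x)).card := by omega
    obtain ⟨y, hy⟩ := Finset.card_pos.1 h3
    rw [Finset.mem_filter] at hy
    have := ih y hy.1
    omega

theorem rowCard_le (h : FacSeq n ℓ v) (r : ℕ) : rowCard v r ℓ ≤ n - 1 - r := by
  have : rowSet (bumped^[r] v) ℓ ⊆ Finset.Ioo r n := fun x hx =>
    Finset.mem_Ioo.2 ⟨h.lt_of_mem_rowSet r x hx, ((h.bumped_iterate r).mem_rowSet hx).2⟩
  have := Finset.card_le_card this
  rw [Nat.card_Ioo] at this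
  rw [rowCard]
  omega

end FacSeq

theorem sum_staircase {n m : ℕ} (h : n ≤ m) :
    ∑ r ∈ Finset.range m, (n - 1 - r) = n.choose 2 := by
  have e : ∑ r ∈ Finset.range m, (n - 1 - r) = ∑ r ∈ Finset.range n, (n - 1 - r) := by
    refine (Finset.sum_subset (Finset.range_mono h) fun r _ hr => ?_).symm
    rw [Finset.mem_range] at hr
    omega
  rw [e, Finset.sum_range_reflect (fun r => r) n, Finset.sum_range_id, Nat.choose_two_right]

theorem mem_staircase {n r c : ℕ} : (r, c) ∈ staircase n ↔ r + c + 1 < n := by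
  rw [← YoungDiagram.mem_cells, staircase]
  simp only [Finset.mem_filter, Finset.mem_product, Finset.mem_range]
  omega

theorem rowLen_staircase (n r : ℕ) : (staircase n).rowLen r = n - 1 - r := by
  refine le_antisymm (le_of_forall_lt fun c hc => ?_) (le_of_forall_lt fun c hc => ?_)
  · rw [← YoungDiagram.mem_iff_lt_rowLen, mem_staircase] at hc
    omega
  · rw [← YoungDiagram.mem_iff_lt_rowLen, mem_staircase]
    omega

theorem length_seqWord (v : Factors) (ℓ : ℕ) :
    (seqWord (facList v ℓ)).length = ∑ k ∈ Finset.range ℓ, (v (k + 1)).card := by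
  induction ℓ with
  | zero => rfl
  | succ ℓ ih =>
    rw [facList_succ, seqWord_append, List.length_append, ih, Finset.sum_range_succ, add_comm]
    simp [seqWord, length_decWord]

variable {w : Equiv.Perm (Fin n)}

theorem sum_card_of_mem (hv : v ∈ decreasingFactorizations n w ℓ) :
    ∑ k ∈ Finset.range ℓ, (v (k + 1)).card = permLength n w := by
  rw [← length_seqWord, ← factorizationWord_eq]
  exact hv.2.2

/-- The row lengths are bounded by those of the staircase, and the two sums agree. -/
theorem rowCard_eq (hw : permLength n w = n.choose 2) (hv : v ∈ decreasingFactorizations n w ℓ)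
    (r : ℕ) : rowCard v r ℓ = n - 1 - r := by
  have h := (mem_decreasingFactorizations_iff.1 hv).1
  have h1 := sum_card_of_mem hv
  rw [h.sum_card_eq (m := max (max ℓ n) (r + 1)) (by omega), hw,
    ← sum_staircase (m := max (max ℓ n) (r + 1)) (by omega)] at h1
  exact (Finset.sum_eq_sum_iff_of_le fun r _ => h.rowCard_le r).1 h1 r
    (Finset.mem_range.2 (by omega))

theorem FacSeq.egQ_eq (h : FacSeq n ℓ v) (K r c : ℕ) :
    (rowCard v r K ≤ c → egQ v K r c = 0) ∧
      (c < rowCard v r K → ∀ k, egQ v K r c ≤ k ↔ c < rowCard v r k) := by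
  induction K with
  | zero => exact ⟨fun _ => rfl, fun hc => absurd hc (by rw [rowCard_zero]; omega)⟩
  | succ K ih =>
    have hm := h.rowCard_le_succ r K
    rw [egQ]
    simp only [InShape, h.length_getD_egP]
    refine ⟨fun hc => ?_, fun hc k => ?_⟩
    · rw [if_neg (by omega)]
      exact ih.1 (by omega)
    · by_cases hc' : c < rowCard v r K
      · rw [if_neg (by omega)]
        exact ih.2 hc' k
      · rw [if_pos ⟨hc, hc'⟩]
        constructor
        · intro hk
          have := h.rowCard_mono r hk
          omega
        · intro hk
          by_contra hk'
          have := h.rowCard_mono r (show k ≤ K by omega)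
          omega

theorem egRecording_pattern (hw : permLength n w = n.choose 2)
    (hv : v ∈ decreasingFactorizations n w ℓ) :
    IsPattern (staircase n) (egRecording ℓ v) (rowCard v) ∧
      IsGT (staircase n) ℓ (rowCard v) := by
  have h := (mem_decreasingFactorizations_iff.1 hv).1
  have hlen : ∀ r, rowCard v r ℓ = (staircase n).rowLen r := fun r => by
    rw [rowCard_eq hw hv, rowLen_staircase]
  refine ⟨⟨fun r c hc => (h.egQ_eq ℓ r c).1 ?_, fun r k => ?_, fun r c k hc =>
    (h.egQ_eq ℓ r c).2 ?_ k⟩, ⟨h.rowCard_le_succ, h.rowCard_interlace, rowCard_zero v, hlen⟩⟩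
  · rw [YoungDiagram.mem_iff_lt_rowLen, ← hlen] at hc
    omega
  · rw [← hlen]; exact h.rowCard_le_last r k
  · rw [hlen]; exact YoungDiagram.mem_iff_lt_rowLen.1 hc

theorem egRecording_mem (hw : permLength n w = n.choose 2)
    (hv : v ∈ decreasingFactorizations n w ℓ) :
    egRecording ℓ v ∈ tableaux (staircase n) ℓ :=
  (egRecording_pattern hw hv).1.mem_tableaux (egRecording_pattern hw hv).2

/-- This is the bridge between the crystals: unpaired letters in the factors reaching row `r` are
counted by the open letters of the reading word at that row. -/
theorem FacSeq.isOpenCount (h : FacSeq n ℓ v) (hi : 1 ≤ i) (hi' : i < ℓ) :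
    IsOpenCount (rowCard v) i (rowEps v i) :=
  ⟨h.rowEps_eq hi hi', i + 1, fun r hr => by
    rw [rowEps, bumped_iterate_eq_empty (h.supp 0 (by omega)) r _ hr, eps_empty_right]⟩

theorem egRecording_f (hw : permLength n w = n.choose 2)
    (hv : v ∈ decreasingFactorizations n w ℓ) (hi : 1 ≤ i) (hi' : i < ℓ) :
    tabF (staircase n) i (egRecording ℓ v) = (factF i v).map (egRecording ℓ) := by
  have h := (mem_decreasingFactorizations_iff.1 hv).1
  obtain ⟨hP, hG⟩ := egRecording_pattern hw hv
  cases hF : factF i v with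
  | none =>
    exact hP.tabF_eq_none hG.mono hi (h.isOpenCount hi hi')
      (h.rowCard_le_of_forall hi hi' (factF_eq_none_iff.1 hF))
  | some v' =>
    -- The row at which the lowering deletes a cell is found by the same comparison of counts as the
    -- rightmost unpaired `i`.
    obtain ⟨r, h1, h2, h3, h4⟩ := h.fStep_rowCard hi hi' (factF_eq_some_iff.1 hF)
    have e : setValue (rowCard v) r i (rowCard v r i - 1) = rowCard v' := by
      funext s k
      by_cases hs : s = r ∧ k = i
      · rw [hs.1, hs.2, setValue_self]; omega
      · rw [setValue, if_neg hs, h4 s k fun h5 h6 => hs ⟨h5, h6⟩]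
    rw [hP.tabF_eq hG.mono hi (h.isOpenCount hi hi') h1 h2]
    have hL := hP.lower hG.mono hi (r := r) (by omega)
    rw [e] at hL
    exact congrArg some (hL.ext (egRecording_pattern hw (factF_mem hv hi hi' hF).1).1)

theorem egRecording_e (hw : permLength n w = n.choose 2)
    (hv : v ∈ decreasingFactorizations n w ℓ) (hi : 1 ≤ i) (hi' : i < ℓ) :
    tabE (staircase n) i (egRecording ℓ v) = (factE i v).map (egRecording ℓ) := by
  have h := (mem_decreasingFactorizations_iff.1 hv).1
  obtain ⟨hP, hG⟩ := egRecording_pattern hw hv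
  cases hE : factE i v with
  | none =>
    exact hP.tabE_eq_none hG.mono hi (h.isOpenCount hi hi')
      ((factE_eq_none_iff (h.zero_notMem _)).1 hE)
  | some v' =>
    obtain ⟨h1, h2⟩ := factE_mem hv hi hi' hE
    -- Raising is reduced to lowering, because the operators on tableaux invert each other.
    refine tabE_of_tabF (egRecording_mem hw h1) hi ?_
    rw [egRecording_f hw h1 hi hi', h2]
    rfl

theorem IsPattern.card_filter {μ : YoungDiagram} {T : Filling} {G : ℕ → ℕ → ℕ}
    (hT : IsPattern μ T G) {m : ℕ} (hm : ∀ r c, (r, c) ∈ μ → r < m) (k : ℕ) :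
    (μ.cells.filter fun x => T x.1 x.2 = k + 1).card =
      ∑ r ∈ Finset.range m, (G r (k + 1) - G r k) := by
  have e : ∀ r, G r (k + 1) - G r k = (Finset.Ico (G r k) (G r (k + 1))).card := fun r => by
    rw [Nat.card_Ico]
  rw [Finset.sum_congr rfl fun r _ => e r, ← Finset.card_sigma]
  refine Finset.card_nbij' (fun x => ⟨x.1, x.2⟩) (fun y => (y.1, y.2)) ?_ ?_ (fun _ _ => rfl)
    fun _ _ => rfl
  · rintro ⟨r, c⟩ hx
    simp only [Finset.coe_filter, Set.mem_ofPred_eq, YoungDiagram.mem_cells] at hx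
    have h1 := hT.le_iff r c k hx.1
    have h2 := hT.le_iff r c (k + 1) hx.1
    simp only [Finset.coe_sigma, Set.mem_sigma_iff, Finset.mem_coe, Finset.mem_range,
      Finset.mem_Ico]
    exact ⟨hm r c hx.1, by omega, by omega⟩
  · rintro ⟨r, c⟩ hx
    simp only [Finset.coe_sigma, Set.mem_sigma_iff, Finset.mem_coe, Finset.mem_range,
      Finset.mem_Ico] at hx
    have hc : (r, c) ∈ μ := YoungDiagram.mem_iff_lt_rowLen.2 (by
      have := hT.le r (k + 1); omega)
    have h1 := hT.le_iff r c k hc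
    have h2 := hT.le_iff r c (k + 1) hc
    simp only [Finset.coe_filter, Set.mem_ofPred_eq, YoungDiagram.mem_cells]
    exact ⟨hc, by omega⟩

theorem egRecording_wt (hw : permLength n w = n.choose 2)
    (hv : v ∈ decreasingFactorizations n w ℓ) :
    (tabCrystal (staircase n)).wt (egRecording ℓ v) = factCrystal.wt v := by
  have h := (mem_decreasingFactorizations_iff.1 hv).1
  have hT := egRecording_mem hw hv
  funext k
  simp only [tabCrystal, factCrystal]
  rw [Nat.cast_inj]
  cases k with
  | zero =>
    rw [h.supp 0 (by omega), Finset.card_empty, Finset.card_eq_zero, Finset.filter_eq_empty_iff]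
    intro x hx h0
    have := (hT.2 x.1 x.2 ((YoungDiagram.mem_cells _).1 hx)).1
    omega
  | succ k =>
    rw [h.card_eq_sum (m := max n (k + 1)) (by omega),
      (egRecording_pattern hw hv).1.card_filter (m := max n (k + 1))]
    intro r c hx
    rw [mem_staircase] at hx
    omega

end Recording

/-! ### Inversions -/

/-- The inversions of a permutation. -/
def inversions {n : ℕ} (w : Equiv.Perm (Fin n)) : Finset (Fin n × Fin n) :=
  Finset.univ.filter fun p => p.1 < p.2 ∧ w p.2 < w p.1

/-- An adjacent transposition preserves the order of every pair of positions except the pair it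
swaps. -/
theorem card_inversions_mul_simple {n i : ℕ} (w : Equiv.Perm (Fin n)) (hi : 1 ≤ i ∧ i < n) :
    (inversions (w * simpleTransposition n i)).card ≤ (inversions w).card + 1 := by
  rw [simpleTransposition, dif_pos hi]
  set x : Fin n := ⟨i - 1, by omega⟩
  set y : Fin n := ⟨i, hi.2⟩
  have key : ((inversions (w * Equiv.swap x y)).erase (x, y)).card ≤ (inversions w).card := by
    refine Finset.card_le_card_of_injOn
      (fun p => (Equiv.swap x y p.1, Equiv.swap x y p.2)) ?_ ?_
    · rintro ⟨a, b⟩ hp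
      rw [Finset.mem_coe, Finset.mem_erase, inversions, Finset.mem_filter] at hp
      rw [Finset.mem_coe, inversions, Finset.mem_filter]
      refine ⟨Finset.mem_univ _, ?_, hp.2.2.2⟩
      have h1 : a < b := hp.2.2.1
      change Equiv.swap x y a < Equiv.swap x y b
      have h2 : ¬(a = x ∧ b = y) := fun h => hp.1 (by rw [h.1, h.2])
      rw [Equiv.swap_apply_def, Equiv.swap_apply_def]
      have hx' : (x : ℕ) = i - 1 := rfl
      have hy' : (y : ℕ) = i := rfl
      simp only [Fin.ext_iff, Fin.lt_def] at h1 h2 ⊢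
      split_ifs <;> omega
    · rintro ⟨a, b⟩ - ⟨c, d⟩ - h
      obtain ⟨h1, h2⟩ := Prod.mk.inj h
      exact Prod.ext (Equiv.injective _ h1) (Equiv.injective _ h2)
  have := Finset.pred_card_le_card_erase (s := inversions (w * Equiv.swap x y)) (a := (x, y))
  omega

theorem card_inversions_permOf_le {n : ℕ} {a : List ℕ} (h : InRange n a) :
    (inversions (permOf n a)).card ≤ a.length := by
  induction a using List.reverseRecOn with
  | nil =>
    rw [List.length_nil, Nat.le_zero, Finset.card_eq_zero, inversions, Finset.filter_eq_empty_iff]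
    intro p _ hp
    exact lt_asymm hp.1 hp.2
  | append_singleton a i ih =>
    rw [inRange_append] at h
    have h1 := ih h.1
    have h2 := card_inversions_mul_simple (permOf n a) (h.2 i (by simp))
    rw [permOf_append, List.length_append]
    simp only [permOf, List.map_cons, List.map_nil, List.prod_singleton, List.length_singleton]
      at h1 h2 ⊢
    omega

theorem card_inversions_revPerm (n : ℕ) :
    (inversions (Fin.revPerm : Equiv.Perm (Fin n))).card = n.choose 2 := by
  have e : (inversions (Fin.revPerm : Equiv.Perm (Fin n))).card =
      ((Finset.univ : Finset (Fin n)).sigma fun b => Finset.Iio b).card := by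
    refine Finset.card_nbij' (fun p => ⟨p.2, p.1⟩) (fun p => (p.2, p.1)) ?_ ?_ (fun _ _ => rfl)
      fun _ _ => rfl
    · intro p hp
      simpa [inversions] using hp
    · intro p hp
      simpa [inversions] using hp
  rw [e, Finset.card_sigma]
  simp only [Fin.card_Iio]
  rw [Fin.sum_univ_eq_sum_range (fun k => k), Finset.sum_range_id, Nat.choose_two_right]

theorem exists_word {n : ℕ} (w : Equiv.Perm (Fin n)) : ∃ a, InRange n a ∧ permOf n a = w := by
  cases n with
  | zero => exact ⟨[], by simp [InRange], Subsingleton.elim _ _⟩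
  | succ n =>
    have hw : w ∈ Submonoid.closure
        (Set.range fun i : Fin n => Equiv.swap i.castSucc i.succ) := by
      rw [Equiv.Perm.mclosure_swap_castSucc_succ]
      trivial
    induction hw using Submonoid.closure_induction with
    | mem x hx =>
      obtain ⟨i, rfl⟩ := hx
      have hi : 1 ≤ (i : ℕ) + 1 ∧ (i : ℕ) + 1 < n + 1 := by omega
      refine ⟨[i + 1], by simp [InRange], ?_⟩
      simp only [permOf, List.map_cons, List.map_nil, List.prod_singleton]
      rw [simpleTransposition, dif_pos hi]
      congr 1
    | one => exact ⟨[], by simp [InRange], rfl⟩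
    | mul x y _ _ hx hy =>
      obtain ⟨a, ha, rfl⟩ := hx
      obtain ⟨b, hb, rfl⟩ := hy
      exact ⟨a ++ b, inRange_append.2 ⟨ha, hb⟩, permOf_append _ a b⟩

theorem exists_reducedWord {n : ℕ} (w : Equiv.Perm (Fin n)) : (reducedWords n w).Nonempty := by
  obtain ⟨a, h1, h2⟩ := exists_word w
  have hne : {k | ∃ a : List ℕ, IsWordFor n w a ∧ a.length = k}.Nonempty :=
    ⟨a.length, a, ⟨h1, h2⟩, rfl⟩
  obtain ⟨b, hb, hb'⟩ := Nat.sInf_mem hne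
  exact ⟨b, hb, hb'⟩

theorem choose_le_permLength_revPerm (n : ℕ) :
    n.choose 2 ≤ permLength n (Fin.revPerm : Equiv.Perm (Fin n)) := by
  obtain ⟨a, ⟨h1, h2⟩, h3⟩ := exists_reducedWord (Fin.revPerm : Equiv.Perm (Fin n))
  rw [← h3, ← card_inversions_revPerm, ← h2]
  exact card_inversions_permOf_le h1

/-! ### Highest weight factorizations -/

section HighestWeight
variable {n ℓ : ℕ} {w : Equiv.Perm (Fin n)} {v : Factors}

/-- Without a larger letter of `X`, the opened `y` would never be closed. -/
theorem exists_gt_of_eps_eq_zero {X Y : Finset ℕ} (h : eps X Y = 0) {y : ℕ} (hy : y ∈ Y) :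
    ∃ x ∈ X, y < x := by
  by_contra hcon
  push Not at hcon
  have : ∀ c, y + 1 ≤ c → carrier X Y c ≠ 0 := by
    intro c hc
    induction c, hc using Nat.le_induction with
    | base => rw [carrier_succ, if_pos hy]; omega
    | succ c hc ih =>
      rw [carrier_succ, if_neg fun hx => absurd (hcon c hx) (by omega)]
      omega
  exact this _ (lt_letterBound_right hy) h

theorem isHighestWeight_iff (h : FacSeq n ℓ v) :
    IsHighestWeight ℓ factCrystal v ↔ ∀ i, 1 ≤ i → i < ℓ → eps (v i) (v (i + 1)) = 0 :=
  forall_congr' fun _ => imp_congr_right fun _ => imp_congr_right fun _ =>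
    factE_eq_none_iff (h.zero_notMem _)

/-- Every letter of a factor lies below some letter of the preceding factor, so the upper bound
falls by at least one each time. -/
theorem subset_of_isHighestWeight (h : FacSeq n ℓ v) (hw : IsHighestWeight ℓ factCrystal v)
    (k : ℕ) : v (k + 1) ⊆ Finset.Icc 1 (n - (k + 1)) := by
  rw [isHighestWeight_iff h] at hw
  induction k with
  | zero =>
    intro x hx
    have := h.mem hx
    exact Finset.mem_Icc.2 (by omega)
  | succ k ih =>
    intro y hy
    have hk : k + 1 < ℓ := by
      by_contra hk
      rw [h.eq_empty_of_le (not_lt.1 hk)] at hy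
      simp at hy
    obtain ⟨x, hx, hxy⟩ := exists_gt_of_eps_eq_zero (hw (k + 1) (by omega) hk) hy
    have h1 := Finset.mem_Icc.1 (ih hx)
    have h2 := h.mem hy
    exact Finset.mem_Icc.2 (by omega)

theorem card_le_of_isHighestWeight (h : FacSeq n ℓ v) (hw : IsHighestWeight ℓ factCrystal v)
    (k : ℕ) : (v (k + 1)).card ≤ n - 1 - k := by
  have := Finset.card_le_card (subset_of_isHighestWeight h hw k)
  rw [Nat.card_Icc] at this
  omega

theorem exists_highestWeight (hv : v ∈ decreasingFactorizations n w ℓ) :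
    ∃ u ∈ decreasingFactorizations n w ℓ, IsHighestWeight ℓ factCrystal u := by
  -- A raising operator moves one letter from factor i+1 to factor i, so the sum of factor index
  -- times factor size drops by one.
  induction hm : ∑ k ∈ Finset.range (ℓ + 1), k * (v k).card using Nat.strong_induction_on
    generalizing v with
  | _ m ih =>
    by_cases hw : IsHighestWeight ℓ factCrystal v
    · exact ⟨v, hv, hw⟩
    · simp only [IsHighestWeight, not_forall] at hw
      obtain ⟨i, hi, hi', hE⟩ := hw
      obtain ⟨v', hE⟩ := Option.ne_none_iff_exists'.1 hE
      obtain ⟨h1, h2⟩ := factE_mem hv hi hi' hE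
      refine ih _ ?_ h1 rfl
      have key : ∑ k ∈ Finset.range (ℓ + 1), (k * (v k).card + if k = i then i else 0) =
          ∑ k ∈ Finset.range (ℓ + 1), (k * (v' k).card + if k = i + 1 then i + 1 else 0) := by
        refine Finset.sum_congr rfl fun k _ => ?_
        have := factF_card h1 hi hi' h2 k
        have := congrArg (k * ·) this
        simp only [mul_add, mul_ite, mul_one, mul_zero] at this
        split_ifs at this ⊢ <;> omega
      rw [Finset.sum_add_distrib, Finset.sum_add_distrib, Finset.sum_ite_eq', Finset.sum_ite_eq',
        if_pos (Finset.mem_range.2 (by omega)), if_pos (Finset.mem_range.2 (by omega)), hm] at key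
      omega

theorem permLength_le_of_isHighestWeight (hv : v ∈ decreasingFactorizations n w ℓ)
    (hh : IsHighestWeight ℓ factCrystal v) : permLength n w ≤ n.choose 2 := by
  have h := (mem_decreasingFactorizations_iff.1 hv).1
  rw [← sum_card_of_mem hv, ← sum_staircase (le_max_right ℓ n)]
  refine (Finset.sum_le_sum fun k _ => card_le_of_isHighestWeight h hh k).trans ?_
  exact Finset.sum_le_sum_of_subset (Finset.range_mono (le_max_left ℓ n))

theorem eq_staircase_of_isHighestWeight (hw : permLength n w = n.choose 2) (hn : n ≤ ℓ + 1)
    (hv : v ∈ decreasingFactorizations n w ℓ) (hh : IsHighestWeight ℓ factCrystal v) :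
    v = staircaseFactorization n := by
  have h := (mem_decreasingFactorizations_iff.1 hv).1
  have h1 := sum_card_of_mem hv
  have h2 : ∑ k ∈ Finset.range ℓ, (n - 1 - k) = n.choose 2 := by
    rw [← sum_staircase hn, Finset.sum_range_succ]
    omega
  rw [hw, ← h2] at h1
  have h3 := (Finset.sum_eq_sum_iff_of_le fun k _ => card_le_of_isHighestWeight h hh k).1 h1
  funext k
  cases k with
  | zero => rw [h.supp 0 (by omega), staircaseFactorization, if_pos rfl]
  | succ k =>
    rw [staircaseFactorization, if_neg (by omega)]
    refine Finset.eq_of_subset_of_card_le (subset_of_isHighestWeight h hh k) ?_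
    rw [Nat.card_Icc]
    rcases lt_or_ge k ℓ with hk | hk
    · rw [h3 k (Finset.mem_range.2 hk)]
      omega
    · omega

end HighestWeight

/-! ### Words as factorizations -/

section Words
variable {n : ℕ} {w : Equiv.Perm (Fin n)}

theorem wordFactorization_cons (i : ℕ) (a : List ℕ) {k : ℕ} (hk : k ≤ a.length) :
    wordFactorization (i :: a) k = wordFactorization a k := by
  unfold wordFactorization
  by_cases h : 1 ≤ k
  · rw [if_pos ⟨h, by simp; omega⟩, if_pos ⟨h, hk⟩, List.length_cons,
      show a.length + 1 - k = a.length - k + 1 by omega, List.getD_cons_succ]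
  · rw [if_neg fun h' => h h'.1, if_neg fun h' => h h'.1]

theorem seqWord_wordFactorization (a : List ℕ) :
    seqWord (facList (wordFactorization a) a.length) = a := by
  induction a with
  | nil => rfl
  | cons i a ih =>
    rw [List.length_cons, facList_succ, seqWord_append,
      facList_congr fun j _ hj => wordFactorization_cons i a hj, ih]
    simp [seqWord, wordFactorization, decWord_singleton]

theorem facList_of_empty {v : Factors} {j k : ℕ} (hjk : j ≤ k) (h : ∀ t, j < t → v t = ∅) :
    seqWord (facList v k) = seqWord (facList v j) := by
  induction k, hjk using Nat.le_induction with
  | base => rfl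
  | succ k hk ih =>
    rw [facList_succ, seqWord_append, ih, h (k + 1) (by omega)]
    simp [seqWord, decWord_empty]

theorem wordFactorization_mem {a : List ℕ} (ha : a ∈ reducedWords n w) {ℓ : ℕ}
    (hℓ : permLength n w ≤ ℓ) : wordFactorization a ∈ decreasingFactorizations n w ℓ := by
  have hl : a.length ≤ ℓ := ha.2.trans_le hℓ
  have he : ∀ t, a.length < t → wordFactorization a t = ∅ := fun t ht => if_neg (by omega)
  refine ⟨fun k hk => if_neg fun h => hk ⟨h.1, h.2.trans hl⟩, ?_⟩
  rw [factorizationWord_eq, facList_of_empty hl he,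
    seqWord_wordFactorization]
  exact ha

/-- The crystal itself bounds the length: split a reduced word into single letters and raise to
highest weight. -/
theorem permLength_le (w : Equiv.Perm (Fin n)) : permLength n w ≤ n.choose 2 := by
  obtain ⟨a, ha⟩ := exists_reducedWord w
  obtain ⟨u, hu, hu'⟩ := exists_highestWeight (wordFactorization_mem ha le_rfl)
  exact permLength_le_of_isHighestWeight hu hu'

theorem permLength_of_isLongest (hw : IsLongest n w) : permLength n w = n.choose 2 :=
  le_antisymm (permLength_le w) ((choose_le_permLength_revPerm n).trans (hw _))

theorem staircaseFactorization_mem (hw : permLength n w = n.choose 2) {ℓ : ℕ} (hn : n ≤ ℓ + 1) :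
    staircaseFactorization n ∈ decreasingFactorizations n w ℓ := by
  obtain ⟨a, ha⟩ := exists_reducedWord w
  -- The number of factors is first made large enough for a reduced word with one letter per factor.
  -- The factors of the resulting staircase beyond `ℓ` are empty and can be discarded.
  obtain ⟨u, hu, hu'⟩ := exists_highestWeight
    (wordFactorization_mem ha (le_max_left (permLength n w) ℓ))
  rw [eq_staircase_of_isHighestWeight hw (by omega) hu hu'] at hu
  have he : ∀ t, ℓ < t → staircaseFactorization n t = ∅ := fun t ht => by
    rw [staircaseFactorization, if_neg (by omega), Finset.Icc_eq_empty (by omega)]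
  refine ⟨fun k hk => ?_, ?_⟩
  · rcases Nat.eq_zero_or_pos k with rfl | hk'
    · rfl
    · exact he k (by omega)
  · have := hu.2
    rwa [factorizationWord_eq, facList_of_empty (le_max_right _ ℓ) he,
      ← factorizationWord_eq] at this

theorem isHighestWeight_iff_eq (hw : permLength n w = n.choose 2) {ℓ : ℕ} (hn : n ≤ ℓ + 1)
    {v : Factors} (hv : v ∈ decreasingFactorizations n w ℓ) :
    IsHighestWeight ℓ factCrystal v ↔ v = staircaseFactorization n := by
  refine ⟨eq_staircase_of_isHighestWeight hw hn hv, ?_⟩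
  rintro rfl
  obtain ⟨u, hu, hu'⟩ := exists_highestWeight hv
  rwa [eq_staircase_of_isHighestWeight hw hn hu hu'] at hu'

end Words

/-! ### The isomorphism -/

section Isomorphism
variable {n ℓ : ℕ} {w : Equiv.Perm (Fin n)}

/-- Elements with the same image are raised in parallel until both are the unique highest weight
element; lowering undoes each step. -/
theorem egRecording_injOn (hw : permLength n w = n.choose 2) (hn : n ≤ ℓ + 1) :
    Set.InjOn (egRecording ℓ) (decreasingFactorizations n w ℓ) := by
  intro v hv v' hv' h
  induction hm : ∑ x ∈ (staircase n).cells, egRecording ℓ v x.1 x.2 using Nat.strong_induction_on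
    generalizing v v' with
  | _ m ih =>
    have hE : ∀ i, 1 ≤ i → i < ℓ →
        (factE i v').map (egRecording ℓ) = (factE i v).map (egRecording ℓ) := fun i hi hi' => by
      rw [← egRecording_e hw hv hi hi', ← egRecording_e hw hv' hi hi', h]
    by_cases hh : IsHighestWeight ℓ factCrystal v
    · have hh' : IsHighestWeight ℓ factCrystal v' := fun i hi hi' => by
        have h1 : factE i v = none := hh i hi hi'
        have h2 := hE i hi hi'
        rw [h1, Option.map_none, Option.map_eq_none_iff] at h2
        exact h2
      rw [eq_staircase_of_isHighestWeight hw hn hv hh,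
        eq_staircase_of_isHighestWeight hw hn hv' hh']
    · simp only [IsHighestWeight, not_forall] at hh
      obtain ⟨i, hi, hi', hu⟩ := hh
      obtain ⟨u, hu⟩ := Option.ne_none_iff_exists'.1 hu
      have hu : factE i v = some u := hu
      have h2 := hE i hi hi'
      rw [hu, Option.map_some, Option.map_eq_some_iff] at h2
      obtain ⟨u', hu', e⟩ := h2
      have f1 := factE_mem hv hi hi' hu
      have f2 := factE_mem hv' hi hi' hu'
      have h3 := egRecording_e hw hv hi hi'
      rw [hu, Option.map_some] at h3
      have h4 := (tabE_mem (egRecording_mem hw hv) hi hi' h3).2.2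
      rw [hm] at h4
      have h5 := ih _ h4 f1.1 f2.1 e.symm rfl
      rw [h5, f2.2] at f1
      exact (Option.some.inj f1.2).symm

/-- Raise the tableau until it is the highest weight one, which is the image of the staircase
factorization; then lower on both sides. -/
theorem egRecording_surjOn (hw : permLength n w = n.choose 2) (hn : n ≤ ℓ + 1) :
    Set.SurjOn (egRecording ℓ) (decreasingFactorizations n w ℓ) (tableaux (staircase n) ℓ) := by
  intro T hT
  induction hm : ∑ x ∈ (staircase n).cells, T x.1 x.2 using Nat.strong_induction_on
    generalizing T with
  | _ m ih =>
    by_cases hh : IsHighestWeight ℓ (tabCrystal (staircase n)) T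
    · have hs := staircaseFactorization_mem hw hn
      refine ⟨staircaseFactorization n, hs, ?_⟩
      refine highestWeight_tableau_unique (egRecording_mem hw hs) hT (fun i hi hi' => ?_) hh
      have h1 : factE i (staircaseFactorization n) = none :=
        (isHighestWeight_iff_eq hw hn hs).2 rfl i hi hi'
      have h2 := egRecording_e hw hs hi hi'
      rw [h1] at h2
      exact h2
    · simp only [IsHighestWeight, not_forall] at hh
      obtain ⟨i, hi, hi', hu⟩ := hh
      obtain ⟨T', hT'⟩ := Option.ne_none_iff_exists'.1 hu
      obtain ⟨h1, h2, h3⟩ := tabE_mem hT hi hi' hT'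
      rw [hm] at h3
      obtain ⟨v', hv', rfl⟩ := ih _ h3 h1 rfl
      rw [egRecording_f hw hv' hi hi', Option.map_eq_some_iff] at h2
      obtain ⟨v, hv, e⟩ := h2
      exact ⟨v, (factF_mem hv' hi hi' hv).1, e⟩

theorem egRecording_isCrystalIso (hw : permLength n w = n.choose 2) (hn : n ≤ ℓ + 1) :
    IsCrystalIso ℓ factCrystal (decreasingFactorizations n w ℓ) (tabCrystal (staircase n))
      (tableaux (staircase n) ℓ) (egRecording ℓ) where
  bijOn := ⟨fun _ hv => egRecording_mem hw hv, egRecording_injOn hw hn, egRecording_surjOn hw hn⟩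
  map_wt _ hv := egRecording_wt hw hv
  map_e _ hi hi' _ hv := egRecording_e hw hv hi hi'
  map_f _ hi hi' _ hv := egRecording_f hw hv hi hi'

end Isomorphism

/-! ### Reduced words and standard tableaux -/

section Standard
variable {n ℓ : ℕ} {w : Equiv.Perm (Fin n)}

/-- It ensures that `ℓ ≥ N` lies in the range of `ℓ` where the isomorphism holds. -/
theorem le_choose_two_add_one (n : ℕ) : n ≤ n.choose 2 + 1 := by
  cases n with
  | zero => omega
  | succ n =>
    rw [Nat.choose_succ_succ, Nat.choose_one_right]
    omega

theorem card_staircase (n : ℕ) : (staircase n).card = n.choose 2 := by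
  have e : (staircase n).cells.card =
      ((Finset.range n).sigma fun r => Finset.range (n - 1 - r)).card := by
    refine Finset.card_nbij' (fun x => ⟨x.1, x.2⟩) (fun y => (y.1, y.2)) ?_ ?_ (fun _ _ => rfl)
      fun _ _ => rfl
    · rintro ⟨r, c⟩ hx
      rw [Finset.mem_coe, YoungDiagram.mem_cells, mem_staircase] at hx
      simp only [Finset.coe_sigma, Set.mem_sigma_iff, Finset.mem_coe, Finset.mem_range]
      omega
    · rintro ⟨r, c⟩ hx
      simp only [Finset.coe_sigma, Set.mem_sigma_iff, Finset.mem_coe, Finset.mem_range] at hx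
      rw [Finset.mem_coe, YoungDiagram.mem_cells]
      exact mem_staircase.2 (show r + c + 1 < n by omega)
  rw [YoungDiagram.card, e, Finset.card_sigma]
  simp only [Finset.card_range]
  exact sum_staircase le_rfl

theorem onesWeight_of_mem {N k : ℕ} (h : k ∈ Set.Icc 1 N) : onesWeight N k = 1 := if_pos h

theorem onesWeight_of_notMem {N k : ℕ} (h : k ∉ Set.Icc 1 N) : onesWeight N k = 0 := if_neg h

theorem card_wordFactorization (a : List ℕ) (k : ℕ) :
    ((wordFactorization a k).card : ℤ) = onesWeight a.length k := by
  unfold wordFactorization onesWeight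
  split_ifs <;> simp

theorem wordFactorization_seqWord {v : Factors} (m : ℕ)
    (h1 : ∀ k, 1 ≤ k → k ≤ m → (v k).card = 1) :
    (seqWord (facList v m)).length = m ∧
      ∀ k, 1 ≤ k → k ≤ m → wordFactorization (seqWord (facList v m)) k = v k := by
  induction m with
  | zero => exact ⟨rfl, fun k hk hk' => by omega⟩
  | succ m ih =>
    obtain ⟨ih1, ih2⟩ := ih fun k hk hk' => h1 k hk (by omega)
    obtain ⟨x, hx⟩ := Finset.card_eq_one.1 (h1 (m + 1) (by omega) le_rfl)
    have e : seqWord (facList v (m + 1)) = x :: seqWord (facList v m) := by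
      rw [facList_succ, seqWord_append, hx]
      simp [seqWord, decWord_singleton]
    rw [e]
    refine ⟨by rw [List.length_cons, ih1], fun k hk hk' => ?_⟩
    rcases Nat.lt_or_ge m k with h | h
    · obtain rfl : k = m + 1 := by omega
      rw [hx, wordFactorization, List.length_cons, ih1, if_pos ⟨hk, hk'⟩, Nat.sub_self,
        List.getD_cons_zero]
    · rw [wordFactorization_cons x _ (by omega), ih2 k hk h]

theorem wordFactorization_bijOn (hw : permLength n w = n.choose 2) (hN : n.choose 2 ≤ ℓ) :
    Set.BijOn wordFactorization (reducedWords n w)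
      {b ∈ decreasingFactorizations n w ℓ | factCrystal.wt b = onesWeight (n.choose 2)} := by
  have hlen : ∀ a ∈ reducedWords n w, a.length = n.choose 2 := fun a ha => ha.2.trans hw
  refine ⟨fun a ha => ⟨wordFactorization_mem ha (hw.trans_le hN), ?_⟩, fun a ha a' ha' h => ?_, ?_⟩
  · funext k
    rw [← hlen a ha]
    exact card_wordFactorization a k
  · rw [← seqWord_wordFactorization a, ← seqWord_wordFactorization a', h, hlen a ha, hlen a' ha']
  · rintro v ⟨hv, hwt⟩
    have hcard : ∀ k, ((v k).card : ℤ) = onesWeight (n.choose 2) k := congrFun hwt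
    have he : ∀ k, ¬(1 ≤ k ∧ k ≤ n.choose 2) → v k = ∅ := fun k hk => by
      have := hcard k
      rw [onesWeight, if_neg hk] at this
      exact Finset.card_eq_zero.1 (by exact_mod_cast this)
    obtain ⟨h1, h2⟩ := wordFactorization_seqWord (v := v) (n.choose 2) fun k hk hk' => by
      have := hcard k
      rw [onesWeight, if_pos ⟨hk, hk'⟩] at this
      exact_mod_cast this
    refine ⟨seqWord (facList v (n.choose 2)), ?_, ?_⟩
    · have := hv.2
      rwa [factorizationWord_eq, facList_of_empty hN fun t ht => he t (by omega)] at this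
    · funext k
      by_cases hk : 1 ≤ k ∧ k ≤ n.choose 2
      · exact h2 k hk.1 hk.2
      · rw [he k hk, wordFactorization, h1, if_neg hk]

theorem tableaux_ones_eq_standard {μ : YoungDiagram} (hμ : μ.card ≤ ℓ) :
    {T ∈ tableaux μ ℓ | (tabCrystal μ).wt T = onesWeight μ.card} = standardTableaux μ := by
  ext T
  constructor
  · rintro ⟨⟨⟨S, hS⟩, hent⟩, hwt⟩
    have hcard : ∀ k, ((μ.cells.filter fun x => T x.1 x.2 = k).card : ℤ) = onesWeight μ.card k :=
      congrFun hwt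
    have hbij : Set.BijOn (fun x : ℕ × ℕ => T x.1 x.2) (μ.cells : Set (ℕ × ℕ))
        (Set.Icc 1 μ.card) := by
      have hmap : Set.MapsTo (fun x : ℕ × ℕ => T x.1 x.2) (μ.cells : Set (ℕ × ℕ))
          (Set.Icc 1 μ.card) := by
        intro x hx
        by_contra hcon
        have := hcard (T x.1 x.2)
        rw [onesWeight_of_notMem hcon, Nat.cast_eq_zero, Finset.card_eq_zero,
          Finset.filter_eq_empty_iff] at this
        exact this hx rfl
      refine ⟨hmap, fun x hx y hy hxy => ?_, fun k hk => ?_⟩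
      · have := hcard (T x.1 x.2)
        rw [onesWeight_of_mem (hmap hx), Nat.cast_eq_one, Finset.card_eq_one] at this
        obtain ⟨z, hz⟩ := this
        have h1 : x ∈ μ.cells.filter fun z => T z.1 z.2 = T x.1 x.2 :=
          Finset.mem_filter.2 ⟨hx, rfl⟩
        have h2 : y ∈ μ.cells.filter fun z => T z.1 z.2 = T x.1 x.2 :=
          Finset.mem_filter.2 ⟨hy, hxy.symm⟩
        rw [hz, Finset.mem_singleton] at h1 h2
        rw [h1, h2]
      · have := hcard k
        rw [onesWeight_of_mem hk, Nat.cast_eq_one, Finset.card_eq_one] at this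
        obtain ⟨z, hz⟩ := this
        have h1 : z ∈ μ.cells.filter fun z => T z.1 z.2 = k := by
          rw [hz]; exact Finset.mem_singleton_self z
        rw [Finset.mem_filter] at h1
        exact ⟨z, h1.1, h1.2⟩
    refine ⟨fun r c hc => ?_, hbij, fun r c c' hc hc' => ?_, fun r r' c hr hr' => ?_⟩
    · rw [← hS]; exact S.zeros hc
    -- Rows of a semistandard tableau increase only weakly; strictness comes from each entry
    -- occurring once.
    · refine lt_of_le_of_ne ?_ fun h => ?_
      · rw [← hS, ← hS]; exact S.row_weak hc hc'
      · have := hbij.injOn (Finset.mem_coe.2 ((YoungDiagram.mem_cells _).2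
          (μ.up_left_mem le_rfl hc.le hc'))) (Finset.mem_coe.2 ((YoungDiagram.mem_cells _).2 hc')) h
        exact hc.ne (Prod.mk.inj this).2
    · rw [← hS, ← hS]; exact S.col_strict hr hr'
  · rintro ⟨h0, hbij, hrow, hcol⟩
    refine ⟨⟨⟨⟨T, fun hc hc' => (hrow _ _ _ hc hc').le, fun hr hr' => hcol _ _ _ hr hr',
      fun hc => h0 _ _ hc⟩, fun _ _ => rfl⟩, fun r c hc => ?_⟩, ?_⟩
    · obtain ⟨h1, h2⟩ := hbij.mapsTo (Finset.mem_coe.2 ((YoungDiagram.mem_cells _).2 hc))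
      exact ⟨h1, h2.trans hμ⟩
    · funext k
      change ((μ.cells.filter fun x => T x.1 x.2 = k).card : ℤ) = onesWeight μ.card k
      unfold onesWeight
      split_ifs with hk
      · obtain ⟨z, hz, hz'⟩ := hbij.surjOn (show k ∈ Set.Icc 1 μ.card from hk)
        rw [Nat.cast_eq_one, Finset.card_eq_one]
        refine ⟨z, Finset.eq_singleton_iff_unique_mem.2 ⟨Finset.mem_filter.2 ⟨hz, hz'⟩,
          fun y hy => ?_⟩⟩
        rw [Finset.mem_filter] at hy
        exact hbij.injOn hy.1 hz (hy.2.trans hz'.symm)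
      · rw [Nat.cast_eq_zero, Finset.card_eq_zero, Finset.filter_eq_empty_iff]
        rintro x hx rfl
        exact hk (hbij.mapsTo hx)

theorem egRecording_bijOn_standard (hw : permLength n w = n.choose 2) (hN : n.choose 2 ≤ ℓ) :
    Set.BijOn (egRecording ℓ)
      {b ∈ decreasingFactorizations n w ℓ | factCrystal.wt b = onesWeight (n.choose 2)}
      (standardTableaux (staircase n)) := by
  have hn : n ≤ ℓ + 1 := (le_choose_two_add_one n).trans (by omega)
  have h := egRecording_isCrystalIso hw hn
  rw [← tableaux_ones_eq_standard (ℓ := ℓ) (by rw [card_staircase]; exact hN), card_staircase]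
  refine ⟨fun b hb => ⟨h.bijOn.mapsTo hb.1, by rw [h.map_wt b hb.1, hb.2]⟩,
    h.bijOn.injOn.mono fun b hb => hb.1, ?_⟩
  rintro T ⟨hT, hwt⟩
  obtain ⟨b, hb, rfl⟩ := h.bijOn.surjOn hT
  exact ⟨b, ⟨hb, by rw [← h.map_wt b hb, hwt]⟩, rfl⟩

theorem reducedWords_finite (n : ℕ) (w : Equiv.Perm (Fin n)) : (reducedWords n w).Finite := by
  refine ((List.finite_length_eq (Fin n) (permLength n w)).image (List.map Fin.val)).subset ?_
  rintro a ⟨⟨h1, -⟩, h2⟩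
  refine ⟨a.pmap (fun i hi => ⟨i, hi⟩) fun i hi => (h1 i hi).2, ?_, ?_⟩
  · rw [Set.mem_ofPred_eq, List.length_pmap, h2]
  · rw [List.map_pmap]
    simp

end Standard

end StanleyCrystal

theorem mainTheorem2 (n : ℕ) (w₀ : Equiv.Perm (Fin n)) (hw₀ : IsLongest n w₀) :
    (∀ ℓ : ℕ, n ≤ ℓ + 1 →
      -- `B(w₀)` and `B(ρ)` are crystals of type `A_{ℓ-1}`
      IsCrystal ℓ factCrystal (decreasingFactorizations n w₀ ℓ) ∧
      IsCrystal ℓ (tabCrystal (staircase n)) (tableaux (staircase n) ℓ) ∧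
      -- the unique highest weight element of `B(w₀)`
      staircaseFactorization n ∈ decreasingFactorizations n w₀ ℓ ∧
      (∀ b ∈ decreasingFactorizations n w₀ ℓ,
        IsHighestWeight ℓ factCrystal b ↔ b = staircaseFactorization n) ∧
      -- `B(w₀) ≅ B(ρ)` through the recording map
      IsCrystalIso ℓ factCrystal (decreasingFactorizations n w₀ ℓ)
        (tabCrystal (staircase n)) (tableaux (staircase n) ℓ) (egRecording ℓ)) ∧
    (∀ ℓ : ℕ, n.choose 2 ≤ ℓ →
      -- the reduced words of `w₀` are the elements of weight `(1, …, 1)` of `B(w₀)`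
      Set.BijOn wordFactorization (reducedWords n w₀)
        {b ∈ decreasingFactorizations n w₀ ℓ | factCrystal.wt b = onesWeight (n.choose 2)} ∧
      -- the standard tableaux are the elements of weight `(1, …, 1)` of `B(ρ)`
      {T ∈ tableaux (staircase n) ℓ | (tabCrystal (staircase n)).wt T = onesWeight (n.choose 2)} =
        standardTableaux (staircase n) ∧
      -- the recording map restricts to a bijection between them
      Set.BijOn (egRecording ℓ)
        {b ∈ decreasingFactorizations n w₀ ℓ | factCrystal.wt b = onesWeight (n.choose 2)}
        (standardTableaux (staircase n)) ∧
      Set.BijOn (fun a => egRecording ℓ (wordFactorization a)) (reducedWords n w₀)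
        (standardTableaux (staircase n))) ∧
    -- the number of reduced words of `w₀`
    (reducedWords n w₀).Finite ∧ (standardTableaux (staircase n)).Finite ∧
    (reducedWords n w₀).ncard = (standardTableaux (staircase n)).ncard := by
  have hw := permLength_of_isLongest hw₀
  have hbij := fun ℓ (hN : n.choose 2 ≤ ℓ) =>
    (egRecording_bijOn_standard hw hN).comp (wordFactorization_bijOn hw hN)
  have hfin := reducedWords_finite n w₀
  refine ⟨fun ℓ hn => ?_, fun ℓ hN => ⟨wordFactorization_bijOn hw hN, ?_,
    egRecording_bijOn_standard hw hN, hbij ℓ hN⟩, hfin, ?_, ?_⟩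
  · have hmem := staircaseFactorization_mem hw hn
    have hiso := egRecording_isCrystalIso hw hn
    have hcr := factCrystal_isCrystal ⟨_, hmem⟩
    exact ⟨hcr, hiso.isCrystal hcr, hmem, fun b hb => isHighestWeight_iff_eq hw hn hb, hiso⟩
  · rw [← card_staircase]
    exact tableaux_ones_eq_standard (by rw [card_staircase]; exact hN)
  -- The smallest admissible value `ℓ = N` suffices for counting.
  · rw [← (hbij _ le_rfl).image_eq]
    exact hfin.image _
  · rw [← (hbij _ le_rfl).image_eq, (hbij _ le_rfl).injOn.ncard_image]
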